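/- **Problem.** The text $T=t_0\dots t_{n-1}$ and the pattern $P=p_0\dots p_{m-1}$ ($1\le m\le n$) are strings of natural numbers, where the symbol $0$ is a wild card. Position $j$ is a mismatch at alignment $i$ ($0\le i\le n-m$) if $t_{i+j}\ne p_j$ and neither symbol is $0$; $q_i$ is the number of mismatches at alignment $i$. The $k$-mismatches problem asks for all $i$ with $q_i\le k$. **Time** is counted on a random access machine with unit-cost arithmetic on integers and on the complex numbers used by the FFT; a number from a finite range can be chosen at random in one step, and a uniformly random subset of the $m$ positions in $O(m)$ steps. Symbols are first encoded by $0,\dots,m+1$ according to their first occurrence in $P$, so all other integers have $O(\log n)$ bits. Convolutions are computed by the FFT on blocks of $T$ of length $2m$. Below, $\lg$ is the base-$2$ logarithm, and $c$ is a fixed natural number. **The 1-mismatch algorithm.** Let $e_{i,j}=(t_{i+j}-p_j)^2t_{i+j}p_j$. Compute $E_i=\sum_j e_{i,j}$ and $E_i'=\sum_j(i+j)e_{i,j}$ for all $i$ by six convolutions. If $E_i\neq0$, and $B=\lfloor E_i'/E_i\rfloor$ is in $[i,i+m)$ with $e_{i,B-i}=E_i$, then report $B-i$ as the only mismatch at alignment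 $i$. A *sampling step with $s$ positions* chooses $s$ positions of $P$ uniformly at random without repetition, replaces $P$ by the string $P'$ that has wild cards at all other positions, and runs the 1-mismatch algorithm on $T$ and $P'$; a mismatch $j$ reported at alignment $i$ that is not yet in the list $L(i)$ is added to it, and $e_{i,j}$ is subtracted from $E_i$. Numbers of positions are rounded down. **Algorithm 1.** Compute all $E_i$, set all $L(i)=\emptyset$, and do $ck\lceil\lg n\rceil$ sampling steps with $m/k$ positions. **Algorithm 2.** Compute all $E_i$ and set all $L(i)=\emptyset$. For $k'=k,\lfloor k/2\rfloor,\lfloor k/4\rfloor,\dots,1$, take $c\max(k',\lceil\lg n\rceil)$ independent random samples of $m/k'$ positions. For each sample and each alignment with $E_i\ne0$ and $|L(i)|\le k$, subtract from the two error sums of the sample the contributions of the mismatches that were in $L(i)$ at the start of this iteration, test the rest for a single new mismatch, and record it as above. (The subtraction is done for all samples at once, on vectors with one field of $b=O(\log m)$ bits per sample, packed into words of $\lceil\lg n\rceil$ bits, or of $b$ bits if that is more, and touching nonzero words only; an alignment is skipped in an iteration if more than $8ckb$ words would be touched.) **Algorithm 3.** Repeat the following rounds. (1) Run Algorithm 1,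 or Algorithm 2. (2) For $\ell=1,\dots,w$, where $w=\lfloor\lg\lfloor m/(2k)\rfloor\rfloor$, do $c\max(k,\lceil\lg n\rceil)$ sampling steps with $m/(2^{\ell+1}k)$ positions. (3) If for every alignment $i$ either $E_i=0$ or $|L(i)|>k$, then quit and output all $i$ with $|L(i)|\le k$, together with the lists $L(i)$. **Theorem.** Algorithm 3 is a Las Vegas algorithm: for all $1\le m\le n$, $k$, $c$, $T$, $P$, and for both choices in step (1), whenever it quits, its answer is exactly $\{i: q_i\le k\}$, every $L(i)$ consists of mismatches at alignment $i$, and either contains all of them or has more than $k$ elements. Moreover there is a constant $c_0$ such that for every $c\ge c_0$ there are constants $C$ and $n_0$ such that for all real $\alpha\ge1$, all $n\ge n_0$, all $m\le n$ and $k\ge1$ with $4k\le m$ (that is, $w\geq 1$), and all $T$ and $P$, the following hold, each with probability at least $1-n^{-\alpha}$: * with Algorithm 2 in step (1), Algorithm 3 quits after at most $C\alpha\,(nk\log^2m+n\log^2m\log n+n\log m\log n\log\log n)$ steps; * with Algorithm 1 in step (1), Algorithm 3 quits after at most $C\alpha\,(nk\log m\log n+nk\log^2m+n\log^2m\log n)$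 steps. -/

import Mathlib

/-!
  # Las Vegas pattern matching with `k` mismatches and wild cards

Strings are arrays of natural numbers; the symbol `0` is the wild card.  Positions are counted
from `0`, so an alignment `i` ranges over `0, …, n - m`.

Programs are written in two step-counting monads: `Timed` (deterministic) and `Rand` (with coin
tosses).  One step is an arithmetic operation, a shift, a rounding or a comparison of numbers, the
evaluation of a root of unity, an access to a memory cell, or the choice of one random number.
Numbers are integers, or the complex numbers of the Fourier transform; since the symbols are first
encoded by numbers up to `m + 1`, all the integers that occur afterwards have `O(log n)` bits.  Memory cells that were never written hold a
default value, so that a set of integers may be kept as a list together with a table, and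
membership costs one step.
-/

open Finset

noncomputable section

namespace KMismatch

/-! ## The problem -/

/-- The pattern position `j` is a mismatch at alignment `i`: the two symbols differ and neither
of them is a wild card. -/
def IsMismatch {n m : ℕ} (T : Fin n → ℕ) (P : Fin m → ℕ) (i j : ℕ) : Prop :=
  ∃ (hj : j < m) (hi : i + j < n),
    T ⟨i + j, hi⟩ ≠ 0 ∧ P ⟨j, hj⟩ ≠ 0 ∧ T ⟨i + j, hi⟩ ≠ P ⟨j, hj⟩

open Classical in
/-- The set of mismatches at alignment `i`; its cardinality is the Hamming distance. -/
def mismatches {n m : ℕ} (T : Fin n → ℕ) (P : Fin m → ℕ) (i : ℕ) : Finset ℕ :=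
  (range m).filter (IsMismatch T P i)

/-- The answer to the `k`-mismatches problem. -/
def kMismatches {n m : ℕ} (k : ℕ) (T : Fin n → ℕ) (P : Fin m → ℕ) : Finset ℕ :=
  (range (n - m + 1)).filter fun i => (mismatches T P i).card ≤ k

/-! ## Step counting -/

/-- A value together with the number of steps used to compute it. -/
structure Timed (α : Type) where
  val : α
  steps : ℕ

instance : Monad Timed where
  pure a := ⟨a, 0⟩
  bind x f := ⟨(f x.val).val, x.steps + (f x.val).steps⟩

/-- The value `a`, for `r` steps. -/
def charge {α : Type} (r : ℕ) (a : α) : Timed α := ⟨a, r⟩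

/-- Fill an array of length `N`, one entry after the other. -/
def tab {α : Type} [Inhabited α] (N : ℕ) (f : ℕ → Timed α) : Timed (ℕ → α) :=
  ⟨fun i => if i < N then (f i).val else default, ∑ i ∈ range N, ((f i).steps + 1)⟩

/-- Add up `N` numbers, one after the other. -/
def sumUp (N : ℕ) (f : ℕ → Timed ℤ) : Timed ℤ :=
  ⟨∑ i ∈ range N, (f i).val, ∑ i ∈ range N, ((f i).steps + 1)⟩

/-- `for i := first to first + count - 1 do body i`, deterministic. -/
def loopT {α : Type} (body : ℕ → α → Timed α) : (count first : ℕ) → α → Timed α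
  | 0, _, a => pure a
  | N + 1, i, a => do
    let a ← body i a
    let a ← charge 1 a
    loopT body N (i + 1) a

/-- A randomized computation: the joint law of its result and its number of steps. -/
def Rand (α : Type) : Type := PMF (Timed α)

instance : Monad Rand where
  pure a := PMF.pure (⟨a, 0⟩ : Timed _)
  bind x f := PMF.bind x fun y =>
    PMF.map (fun z : Timed _ => (⟨z.val, y.steps + z.steps⟩ : Timed _)) (f y.val)

/-- A deterministic computation as a randomized one. -/
def Rand.lift {α : Type} (x : Timed α) : Rand α := PMF.pure x

/-- `for i := first to first + count - 1 do body i`, randomized. -/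
def loopR {α : Type} (body : ℕ → α → Rand α) : (count first : ℕ) → α → Rand α
  | 0, _, a => pure a
  | N + 1, i, a => do
    let a ← body i a
    let a ← Rand.lift (charge 1 a)
    loopR body N (i + 1) a

/-- Choose `s` of the `m` pattern positions uniformly at random (without repetition; `s` is cut
down to `m` if it is larger); this takes at most `5 m + 1` steps by swapping random entries to the
front of the array `0, …, m - 1`. -/
def draw (m s : ℕ) : Rand (Finset ℕ) :=
  PMF.map (fun S => (⟨S, 5 * m + 1⟩ : Timed (Finset ℕ)))
    (PMF.uniformOfFinset (powersetCard (min s m) (range m))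
      (powersetCard_nonempty.2 (by simp)))

/-- Choose `N` independent random sets of `s` positions. -/
def drawMany (m s : ℕ) : ℕ → Rand (List (Finset ℕ))
  | 0 => pure []
  | N + 1 => do
    let S ← draw m s
    let l ← drawMany m s N
    Rand.lift (charge 1 (S :: l))

/-! ## Convolution by the fast Fourier transform -/

/-- The fast Fourier transform of length `2 ^ d` with root of unity `ζ`; the powers of `ζ` are
obtained by successive multiplication. -/
def fft : (d : ℕ) → ℂ → (ℕ → ℂ) → Timed (ℕ → ℂ)
  | 0, _, a => tab 1 fun i => charge 1 (a i)
  | d + 1, ζ, a => do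
    let even ← tab (2 ^ d) fun i => charge 2 (a (2 * i))
    let odd ← tab (2 ^ d) fun i => charge 3 (a (2 * i + 1))
    let F ← fft d (ζ ^ 2) even
    let G ← fft d (ζ ^ 2) odd
    tab (2 ^ (d + 1)) fun j => charge 10 (F (j % 2 ^ d) + ζ ^ j * G (j % 2 ^ d))

/-- The convolution `i ↦ ∑ j < m, a (i + j) * b j`, for `0 ≤ i ≤ n - m`, of an array `a` of
length `n` and an array `b` of length `m`.  The longer array is cut into overlapping blocks of
length `2 m` that start at the multiples of `m`. -/
def convolve (n m : ℕ) (a b : ℕ → ℤ) : Timed (ℕ → ℤ) := do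
  let d ← charge (2 * m + 1) (Nat.clog 2 (2 * m))
  let ζ ← charge 5 (Complex.exp (2 * Real.pi * Complex.I / (2 : ℂ) ^ d))
  let pat ← tab (2 ^ d) fun j => charge 3 (if j < m then (b j : ℂ) else 0)
  let B ← fft d ζ⁻¹ pat
  let blocks ← tab (n / m + 1) fun β => do
    let window ← tab (2 ^ d) fun i =>
      charge 7 (if i < 2 * m ∧ β * m + i < n then (a (β * m + i) : ℂ) else 0)
    let A ← fft d ζ window
    let AB ← tab (2 ^ d) fun u => charge 3 (A u * B u)
    let c ← fft d ζ⁻¹ AB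
    tab m fun x => charge 4 (round ((c x).re / 2 ^ d))
  tab (n - m + 1) fun i => charge 4 (blocks (i / m) (i % m))

/-! ## The `1`-mismatch algorithm -/

/-- The error term of the text symbol `t (i + j)` and the pattern symbol `p j`. -/
def err (t p : ℕ → ℤ) (i j : ℕ) : ℤ := (t (i + j) - p j) ^ 2 * t (i + j) * p j

/-- `i ↦ ∑ j < m, (i + j) ^ r * t (i + j) ^ a * p j ^ b`, by one convolution.  It is used with
`r ≤ 1` and `a, b ≤ 3`. -/
def powerSums (n m r a b : ℕ) (t p : ℕ → ℤ) : Timed (ℕ → ℤ) := do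
  let t' ← tab n fun i => charge 5 ((i : ℤ) ^ r * t i ^ a)
  let p' ← tab m fun j => charge 3 (p j ^ b)
  convolve n m t' p'

/-- For every alignment `i`, the sums `E i = ∑ j, err t p i j` and
`E' i = ∑ j, (i + j) * err t p i j`, by six convolutions. -/
def errorSums (n m : ℕ) (t p : ℕ → ℤ) : Timed (ℕ → ℤ × ℤ) := do
  let x ← powerSums n m 0 3 1 t p
  let y ← powerSums n m 0 2 2 t p
  let z ← powerSums n m 0 1 3 t p
  let x' ← powerSums n m 1 3 1 t p
  let y' ← powerSums n m 1 2 2 t p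
  let z' ← powerSums n m 1 1 3 t p
  tab (n - m + 1) fun i =>
    charge 14 (x i - 2 * y i + z i, x' i - 2 * y' i + z' i)

/-- The test for a single mismatch at alignment `i`, given the values `E` and `E'` of its two
error sums: the quotient `E' / E` must be a text position in the window of `i` whose error term is
all of `E`.  The result is the pattern position of the mismatch, if there is exactly one. -/
def isolate (m : ℕ) (t p : ℕ → ℤ) (i : ℕ) (E E' : ℤ) : Option ℕ :=
  if E ≠ 0 ∧ (i : ℤ) ≤ E' / E ∧ E' / E < i + m ∧ err t p i (E' / E - i).toNat = E
  then some (E' / E - i).toNat else none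

/-- The `1`-mismatch algorithm: for every alignment at Hamming distance exactly `1`, the pattern
position of the mismatch. -/
def oneMismatch (n m : ℕ) (t p : ℕ → ℤ) : Timed (ℕ → Option ℕ) := do
  let X ← errorSums n m t p
  tab (n - m + 1) fun i => charge 20 (isolate m t p i (X i).1 (X i).2)

/-! ## Sampling -/

/-- What is kept for one alignment: the set `L` of the pattern positions of the mismatches found
so far, and the sum `E` of the error terms that are not accounted for by `L`. -/
structure Loc where
  E : ℤ
  L : Finset ℕ

instance : Inhabited Loc := ⟨⟨0, ∅⟩⟩

/-- Add the mismatch `j` to the list of alignment `i`, unless it is there already. -/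
def Loc.add (t p : ℕ → ℤ) (i j : ℕ) (s : Loc) : Loc :=
  if j ∈ s.L then s else ⟨s.E - err t p i j, insert j s.L⟩

/-- The alignment is settled: all its mismatches are known, or more than `k` of them are. -/
def Loc.Settled (k : ℕ) (s : Loc) : Prop := s.E = 0 ∨ k < s.L.card

/-- Compute `E i` and set `L i` empty, for every alignment `i`. -/
def start (n m : ℕ) (t p : ℕ → ℤ) : Timed (ℕ → Loc) := do
  let X ← errorSums n m t p
  tab (n - m + 1) fun i => charge 3 ⟨(X i).1, ∅⟩

/-- The pattern with wild cards at all positions outside `S`. -/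
def mask (m : ℕ) (p : ℕ → ℤ) (S : Finset ℕ) : Timed (ℕ → ℤ) :=
  tab m fun j => charge 3 (if j ∈ S then p j else 0)

/-- One sampling step: choose `s` positions of the pattern uniformly at random, put wild cards
everywhere else, run the `1`-mismatch algorithm, and record what it finds. -/
def samplingStep (n m s : ℕ) (t p : ℕ → ℤ) (st : ℕ → Loc) : Rand (ℕ → Loc) := do
  let S ← draw m s
  Rand.lift do
    let p' ← mask m p S
    let hit ← oneMismatch n m t p'
    tab (n - m + 1) fun i => charge 15 <|
      match hit i with
      | none => st i
      | some j => (st i).add t p i j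

/-! ## The two algorithms for the first step -/

/-- Algorithm 1: `c k log n` sampling steps with `m / k` positions each. -/
def algorithm1 (c n m k : ℕ) (t p : ℕ → ℤ) : Rand (ℕ → Loc) := do
  let st ← Rand.lift (start n m t p)
  loopR (fun _ st => samplingStep n m (m / k) t p st) (c * k * Nat.clog 2 n) 0 st

/-- Number of bits that hold any sum `∑ j * err` or `∑ err` over pattern positions `j`, when all
symbols are at most `m + 1`. -/
def fieldBits (m : ℕ) : ℕ := 6 * Nat.size (m + 1)

/-- Number of such fields that fit into a word of `log n` bits (and at least one). -/
def fieldsPerWord (n m : ℕ) : ℕ := max 1 (Nat.clog 2 n / fieldBits m)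

/-- Number of words that hold `N` fields. -/
def wordCount (n m N : ℕ) : ℕ := N / fieldsPerWord n m + 1

/-- For every pattern position `j`, the vector that says which of the samples contain `j`, as an
array of words with one field per sample, together with the set of indices of its nonzero words. -/
def incidence (n m N : ℕ) (Ss : List (Finset ℕ)) : Timed (ℕ → (ℕ → ℤ) × Finset ℕ) :=
  tab m fun j => do
    let words ← tab (wordCount n m N) fun u =>
      sumUp (fieldsPerWord n m) fun v =>
        charge 6 (if j ∈ Ss.getD (u * fieldsPerWord n m + v) ∅
          then 2 ^ (fieldBits m * v) else 0)
    charge (3 * wordCount n m N)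
      (words, (range (wordCount n m N)).filter fun u => words u ≠ 0)

/-- The sums `∑ err` and `∑ j * err` over the known mismatches `j` of alignment `i` that lie in a
sample, for all samples at once, one field per sample: the vector of each `j ∈ L`, multiplied by
its error term, is added up, touching the nonzero words only. -/
def knownSums (n m N : ℕ) (rows : ℕ → (ℕ → ℤ) × Finset ℕ) (t p : ℕ → ℤ) (i : ℕ)
    (L : Finset ℕ) : Timed (ℕ → ℤ × ℤ) :=
  ⟨fun u => (∑ j ∈ L, err t p i j * (rows j).1 u, ∑ j ∈ L, (j : ℤ) * err t p i j * (rows j).1 u),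
    2 * wordCount n m N + ∑ j ∈ L, (12 + 10 * (rows j).2.card)⟩

/-- The entry for sample number `x` in a vector of fields. -/
def field (n m : ℕ) (w : ℕ → ℤ) (x : ℕ) : ℤ :=
  w (x / fieldsPerWord n m) / 2 ^ (fieldBits m * (x % fieldsPerWord n m)) % 2 ^ fieldBits m

/-- Search, in each of the `N` samples `Ss`, for single mismatches that are left over once the
mismatches known beforehand are subtracted.  Settled alignments are skipped, and so are those for
which the subtraction would touch more than `8 c k * fieldBits m` words. -/
def residualSearch (c n m k N : ℕ) (Ss : List (Finset ℕ)) (t p : ℕ → ℤ) (st : ℕ → Loc) :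
    Timed (ℕ → Loc) := do
  let rows ← incidence n m N Ss
  let samples ← tab N fun x => do
    let p' ← mask m p (Ss.getD x ∅)
    let X ← errorSums n m t p'
    charge 2 (p', X)
  tab (n - m + 1) fun i => do
    let s ← charge 1 (st i)
    let work ← charge (if s.E = 0 ∨ k < s.L.card then 3 else 3 + 2 * s.L.card)
      (∑ j ∈ s.L, (rows j).2.card)
    if s.E = 0 ∨ k < s.L.card ∨ 8 * c * k * fieldBits m < work then charge 4 s
    else do
      let K ← knownSums n m N rows t p i s.L
      loopT (fun x s' =>
        let D := field n m (fun u => (K u).1) x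
        let D' := field n m (fun u => (K u).2) x
        let p' := (samples x).1
        let X := (samples x).2 i
        charge 60 <|
          match isolate m t p' i (X.1 - D) (X.2 - (i * D + D')) with
          | none => s'
          | some j => if j ∈ s.L then s' else s'.add t p i j) N 0 s

/-- Algorithm 2: for `k' = k, ⌊k / 2⌋, ⌊k / 4⌋, …, 1`, an iteration with `c max (k', log n)`
samples of `m / k'` positions each, in which the mismatches found in the previous iterations are
subtracted. -/
def algorithm2 (c n m k : ℕ) (t p : ℕ → ℤ) : Rand (ℕ → Loc) := do
  let st ← Rand.lift (start n m t p)
  loopR (fun l st => do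
    let k' := k / 2 ^ l
    let N := c * max k' (Nat.clog 2 n)
    let Ss ← drawMany m (m / k') N
    Rand.lift (residualSearch c n m k N Ss t p st)) (Nat.log 2 k + 1) 0 st

/-! ## Algorithm 3 -/

/-- Which algorithm is used in the first step of Algorithm 3. -/
inductive FirstStep
  | alg1
  | alg2

/-- The first step of Algorithm 3. -/
def firstStep (a : FirstStep) (c n m k : ℕ) (t p : ℕ → ℤ) : Rand (ℕ → Loc) :=
  match a with
  | .alg1 => algorithm1 c n m k t p
  | .alg2 => algorithm2 c n m k t p

/-- The second step of Algorithm 3: phases `l = 1, …, w`, where `w = log ⌊m / (2 k)⌋`, with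
`c max (k, log n)` sampling steps of `m / (2 ^ (l + 1) k)` positions each. -/
def phases (c n m k : ℕ) (t p : ℕ → ℤ) (st : ℕ → Loc) : Rand (ℕ → Loc) :=
  loopR (fun l st =>
    loopR (fun _ st => samplingStep n m (m / (2 ^ (l + 1) * k)) t p st)
      (c * max k (Nat.clog 2 n)) 0 st)
    (Nat.log 2 (m / (2 * k))) 1 st

/-- The number that stands for the symbol `x`: `0` for the wild card, and otherwise one more than
the first position of `x` in the pattern (`m + 1` if `x` does not occur there). -/
def code {m : ℕ} (P : Fin m → ℕ) (x : ℕ) : ℤ :=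
  if x = 0 then 0 else ((List.ofFn P).idxOf x : ℤ) + 1

/-- The text with its symbols encoded; the codes are kept in a table that is addressed by
symbols and filled by one pass over the pattern. -/
def encodeText {n m : ℕ} (T : Fin n → ℕ) (P : Fin m → ℕ) : Timed (ℕ → ℤ) := do
  charge (4 * m) ()
  tab n fun i => charge 4 (if h : i < n then code P (T ⟨i, h⟩) else 0)

/-- The pattern with its symbols encoded. -/
def encodePattern {m : ℕ} (P : Fin m → ℕ) : Timed (ℕ → ℤ) :=
  tab m fun j => charge 4 (if h : j < m then code P (P ⟨j, h⟩) else 0)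

/-- The output: the alignments reported to have at most `k` mismatches, and the list of mismatches
found at each alignment. -/
structure Output where
  answer : Finset ℕ
  lists : ℕ → Finset ℕ

/-- The output is right: the answer is that of the `k`-mismatches problem, and at each alignment
either exactly all the mismatches are listed, or more than `k` of them. -/
def Output.Correct {n m : ℕ} (out : Output) (k : ℕ) (T : Fin n → ℕ) (P : Fin m → ℕ) : Prop :=
  out.answer = kMismatches k T P ∧
  ∀ i < n - m + 1, out.lists i ⊆ mismatches T P i ∧
    (out.lists i = mismatches T P i ∨ k < (out.lists i).card)

open Classical in
/-- At most `N` rounds of the main loop of Algorithm 3; the result is `none` if the algorithm has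
not quit by then. -/
def rounds (a : FirstStep) (c n m k : ℕ) (t p : ℕ → ℤ) : ℕ → Rand (Option Output)
  | 0 => pure none
  | N + 1 => do
    let st ← firstStep a c n m k t p
    let st ← phases c n m k t p st
    let st ← Rand.lift (charge (4 * (n - m + 1) + 1) st)
    if ∀ i < n - m + 1, (st i).Settled k then
      Rand.lift (charge (4 * (n - m + 1)) (some
        ⟨(range (n - m + 1)).filter fun i => (st i).L.card ≤ k, fun i => (st i).L⟩))
    else
      rounds a c n m k t p N

/-- Algorithm 3, cut off after `N` rounds. -/
def algorithm3 (a : FirstStep) (c k : ℕ) {n m : ℕ} (T : Fin n → ℕ) (P : Fin m → ℕ) (N : ℕ) :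
    Rand (Option Output) := do
  let t ← Rand.lift (encodeText T P)
  let p ← Rand.lift (encodePattern P)
  rounds a c n m k t p N

/-- The outcomes that have positive probability. -/
def Rand.outcomes {α : Type} (x : Rand α) : Set (Timed α) := PMF.support x

/-- The probability that the algorithm (without any cut-off) quits after at most `b` steps. -/
def haltProb {α : Type} (A : ℕ → Rand (Option α)) (b : ℝ) : ENNReal :=
  ⨆ N, PMF.toOuterMeasure (A N) {x : Timed (Option α) | x.val.isSome ∧ (x.steps : ℝ) ≤ b}

/-- The time bound of Algorithm 3 with Algorithm 1 in its first step. -/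
def bound1 (n m k : ℕ) : ℝ :=
  n * k * Real.log m * Real.log n + n * k * Real.log m ^ 2 + n * Real.log m ^ 2 * Real.log n

/-- The time bound of Algorithm 3 with Algorithm 2 in its first step. -/
def bound2 (n m k : ℕ) : ℝ :=
  n * k * Real.log m ^ 2 + n * Real.log m ^ 2 * Real.log n +
    n * Real.log m * Real.log n * Real.log (Real.log n)

end KMismatch

end

/-!
# Pattern matching with `k` mismatches and wild cards: correctness and running time

**Correctness.** The error term of a text symbol and a pattern symbol is nonnegative, and it is
positive exactly at a mismatch (`errPositions_encode`). The test `isolate` reports a position only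
after it has seen that its error term is nonzero, so whatever is added to a list is a mismatch, even
if the sums given to the test were wrong (`isolate_eq_some`). Hence `E i` always is the sum of the
error terms that are not listed, provided that it is right at the start, which is the correctness of
the convolution (`convolve_val`). So `E i = 0` means that the list of `i` is complete
(`Loc.Valid.settled_iff`), and the output is right whenever all alignments are settled
(`algorithm3_correct`).

**Termination.** A random sample of `s` of the `m` positions meets a set `R` of `O(m / s)` positions
in a given one of its elements, and in no other, with probability `Ω(s / m)`
(`fail_draw_isolate_le`). So if `Ω(m / s)` mismatches in such a set `R` are still unknown, the
sample isolates one of these with constant probability. The potential `2 ^ (g - x)`, where `x` is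
the number of mismatches found and `g` the number wanted, then loses a constant fraction of its
expectation with each sample, and after `c max (k, log n)` samples the probability that `x < g` is a
negative power of `n`, for `g = O(k)` (`ev_potential_le`, `two_pow_mul_le_tiny`). This is used
twice.

* For alignments with `q ≥ 2 k` mismatches one wants `g = k + 1`. While at most `k` mismatches are
  known, half of them are unknown, and one of the phases of the second step has samples of about
  `m / q` positions (`exists_phase`, `phases_fail`).
* For `q < 2 k`, an iteration of Algorithm 2 with parameter `k'` starts with fewer than `2 k'`
  unknown mismatches and leaves fewer than `2 ⌊k' / 2⌋`, or none if `k' = 1`, as in the last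
  iteration (`iteration_fail`, `algorithm2_fail`). The subtraction of the known mismatches is exact since no
  field overflows (`field_incidence`), and it is rarely skipped: if `k' ≤ log n`, the vectors have
  few words, and otherwise the number of pairs of a known mismatch and a sample that contains it has
  a small exponential moment (`drawMany_fail_work`).

With Algorithm 1 instead, each single mismatch of an alignment with `q < 2 k` is isolated with
probability `Ω(1 / k)` by each of the `c k log n` samples, and a union bound suffices
(`algorithm1_fail`). All together, a round fails with probability at most `1 / n`, and `⌈α⌉` rounds
fail with probability at most `n ^ (-α)` (`round_fail`, `rounds_fail`).

**Running time.** The cost of a round is bounded in every outcome, not only on average, because a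
residual search skips the alignments that would cost too much (`rounds_costLe`). It is dominated by
the convolutions, of `O(n log m)` steps each, and by the subtractions of Algorithm 2.
-/

noncomputable section

namespace KMismatch

open scoped ENNReal

/-! ### Timed and randomized computations -/

section Timed

variable {α β : Type}

@[simp] theorem Timed.steps_pure (a : α) : (pure a : Timed α).steps = 0 := rfl
@[simp] theorem Timed.val_bind (x : Timed α) (f : α → Timed β) :
    (x >>= f).val = (f x.val).val := rfl
@[simp] theorem Timed.steps_bind (x : Timed α) (f : α → Timed β) :
    (x >>= f).steps = x.steps + (f x.val).steps := rfl
@[simp] theorem val_charge (r : ℕ) (a : α) : (charge r a).val = a := rfl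
@[simp] theorem steps_charge (r : ℕ) (a : α) : (charge r a).steps = r := rfl

@[simp] theorem val_tab [Inhabited α] (N : ℕ) (f : ℕ → Timed α) (i : ℕ) :
    (tab N f).val i = if i < N then (f i).val else default := rfl

theorem val_tab_of_lt [Inhabited α] {N : ℕ} (f : ℕ → Timed α) {i : ℕ} (hi : i < N) :
    (tab N f).val i = (f i).val := by simp [hi]

@[simp] theorem steps_tab [Inhabited α] (N : ℕ) (f : ℕ → Timed α) :
    (tab N f).steps = ∑ i ∈ range N, ((f i).steps + 1) := rfl

theorem steps_tab_le [Inhabited α] {N b : ℕ} {f : ℕ → Timed α} (h : ∀ i, (f i).steps ≤ b) :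
    (tab N f).steps ≤ N * (b + 1) := by
  rw [steps_tab]
  refine (Finset.sum_le_card_nsmul _ _ (b + 1) fun i _ => ?_).trans (by simp)
  exact Nat.succ_le_succ (h i)

theorem steps_tab_charge [Inhabited α] (N r : ℕ) (f : ℕ → α) :
    (tab N fun i => charge r (f i)).steps = N * (r + 1) := by
  simp

theorem steps_sumUp_le {N b : ℕ} {f : ℕ → Timed ℤ} (h : ∀ i, (f i).steps ≤ b) :
    (sumUp N f).steps ≤ N * (b + 1) := by
  have : (sumUp N f).steps = ∑ i ∈ range N, ((f i).steps + 1) := rfl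
  rw [this]
  refine (Finset.sum_le_card_nsmul _ _ (b + 1) fun i _ => ?_).trans (by simp)
  exact Nat.succ_le_succ (h i)

theorem steps_loopT_le {b : ℕ} {body : ℕ → α → Timed α} (h : ∀ i a, (body i a).steps ≤ b)
    (N i : ℕ) (a : α) : (loopT body N i a).steps ≤ N * (b + 1) := by
  induction N generalizing i a with
  | zero => simp [loopT]
  | succ N ih =>
    have h1 := h i a
    have h2 := ih (i + 1) (body i a).val
    simp only [loopT, Timed.steps_bind, steps_charge, val_charge]
    linarith

end Timed

namespace Rand

variable {α β : Type}

/-- The property `Q` holds for every result that has positive probability. -/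
def Holds (x : Rand α) (Q : α → Prop) : Prop := ∀ y ∈ x.outcomes, Q y.val

/-- The number of steps is at most `b` in every outcome of positive probability. -/
def CostLe (x : Rand α) (b : ℕ) : Prop := ∀ y ∈ x.outcomes, y.steps ≤ b

/-- The joint law of the result and the number of steps, as a probability mass function. -/
def law (x : Rand α) : PMF (Timed α) := x

/-- The expected value of `f` at the result of a randomized computation. -/
def ev (x : Rand α) (f : α → ℝ≥0∞) : ℝ≥0∞ := ∑' y : Timed α, x.law y * f y.val

open Classical in
/-- The probability that the result does not have the property `Q`. -/
def fail (x : Rand α) (Q : α → Prop) : ℝ≥0∞ := x.ev fun a => if Q a then 0 else 1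

theorem mem_outcomes_pure {a : α} {y : Timed α} :
    y ∈ (pure a : Rand α).outcomes ↔ y = ⟨a, 0⟩ :=
  PMF.mem_support_pure_iff _ _

theorem mem_outcomes_lift {x : Timed α} {y : Timed α} : y ∈ (lift x).outcomes ↔ y = x :=
  PMF.mem_support_pure_iff _ _

theorem mem_outcomes_bind {x : Rand α} {f : α → Rand β} {y : Timed β} :
    y ∈ (x >>= f).outcomes ↔
      ∃ u ∈ x.outcomes, ∃ z ∈ (f u.val).outcomes, y = ⟨z.val, u.steps + z.steps⟩ := by
  refine (PMF.mem_support_bind_iff _ _ _).trans ?_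
  refine exists_congr fun u => and_congr_right fun _ => ?_
  refine (PMF.mem_support_map_iff _ _ _).trans ?_
  exact exists_congr fun z => and_congr_right fun _ => eq_comm

theorem Holds.mono {x : Rand α} {Q Q' : α → Prop} (h : x.Holds Q) (hQ : ∀ a, Q a → Q' a) :
    x.Holds Q' := fun y hy => hQ _ (h y hy)

theorem holds_pure {a : α} {Q : α → Prop} (h : Q a) : (pure a : Rand α).Holds Q := by
  intro y hy; rw [mem_outcomes_pure.1 hy]; exact h

theorem holds_lift {x : Timed α} {Q : α → Prop} (h : Q x.val) : (lift x).Holds Q := by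
  intro y hy; rw [mem_outcomes_lift.1 hy]; exact h

theorem Holds.bind {x : Rand α} {f : α → Rand β} {Q : α → Prop} {Q' : β → Prop}
    (h : x.Holds Q) (hf : ∀ a, Q a → (f a).Holds Q') : (x >>= f).Holds Q' := by
  intro y hy
  obtain ⟨u, hu, z, hz, rfl⟩ := mem_outcomes_bind.1 hy
  exact hf _ (h u hu) z hz

theorem holds_true (x : Rand α) : x.Holds fun _ => True := fun _ _ => trivial

theorem CostLe.mono {x : Rand α} {b b' : ℕ} (h : x.CostLe b) (hb : b ≤ b') : x.CostLe b' :=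
  fun y hy => (h y hy).trans hb

theorem costLe_pure (a : α) : (pure a : Rand α).CostLe 0 := by
  intro y hy; rw [mem_outcomes_pure.1 hy]

theorem costLe_lift {x : Timed α} {b : ℕ} (h : x.steps ≤ b) : (lift x).CostLe b := by
  intro y hy; rw [mem_outcomes_lift.1 hy]; exact h

theorem CostLe.bind {x : Rand α} {f : α → Rand β} {b b' : ℕ}
    (h : x.CostLe b) (hf : ∀ a, (f a).CostLe b') : (x >>= f).CostLe (b + b') := by
  intro y hy
  obtain ⟨u, hu, z, hz, rfl⟩ := mem_outcomes_bind.1 hy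
  exact add_le_add (h u hu) (hf _ z hz)

@[simp] theorem ev_lift (x : Timed α) (f : α → ℝ≥0∞) : (lift x).ev f = f x.val := by
  have : (lift x).ev f = ∑' y : Timed α, (PMF.pure x) y * f y.val := rfl
  rw [this, tsum_eq_single x]
  · simp
  · intro y hy; simp [PMF.pure_apply, hy]

@[simp] theorem ev_pure (a : α) (f : α → ℝ≥0∞) : (pure a : Rand α).ev f = f a :=
  ev_lift ⟨a, 0⟩ f

@[simp] theorem ev_bind (x : Rand α) (g : α → Rand β) (f : β → ℝ≥0∞) :
    (x >>= g).ev f = x.ev fun a => (g a).ev f := by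
  have key : ∀ (p : PMF (Timed β)) (s : ℕ),
      ∑' y : Timed β, (PMF.map (fun z : Timed β => (⟨z.val, s + z.steps⟩ : Timed β)) p) y * f y.val
        = ∑' z, p z * f z.val := by
    intro p s
    simp only [PMF.map_apply, ← ENNReal.tsum_mul_right]
    rw [ENNReal.tsum_comm]
    refine tsum_congr fun z => ?_
    rw [tsum_eq_single (⟨z.val, s + z.steps⟩ : Timed β)]
    · simp
    · intro y hy; simp [hy]
  have h1 : (x >>= g).ev f = ∑' y : Timed β, (∑' a : Timed α, x.law a *
      (PMF.map (fun z : Timed β => (⟨z.val, a.steps + z.steps⟩ : Timed β)) (g a.val)) y)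
        * f y.val := by
    refine tsum_congr fun y => ?_
    congr 1
  rw [h1]
  simp only [← ENNReal.tsum_mul_right]
  rw [ENNReal.tsum_comm]
  refine tsum_congr fun a => ?_
  simp only [mul_assoc, ENNReal.tsum_mul_left]
  exact congrArg _ (key _ _)

theorem ev_mono_of_holds {x : Rand α} {Q : α → Prop} {f g : α → ℝ≥0∞} (hx : x.Holds Q)
    (h : ∀ a, Q a → f a ≤ g a) : x.ev f ≤ x.ev g := by
  refine ENNReal.tsum_le_tsum fun y => ?_
  by_cases hy : y ∈ x.outcomes
  · gcongr; exact h _ (hx y hy)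
  · have : x.law y = 0 := (PMF.apply_eq_zero_iff _ _).2 hy
    rw [this]; simp

theorem ev_mono {x : Rand α} {f g : α → ℝ≥0∞} (h : ∀ a, f a ≤ g a) : x.ev f ≤ x.ev g :=
  ev_mono_of_holds x.holds_true fun a _ => h a

theorem ev_const_mul (x : Rand α) (r : ℝ≥0∞) (f : α → ℝ≥0∞) :
    (x.ev fun a => r * f a) = r * x.ev f := by
  rw [ev, ev, ← ENNReal.tsum_mul_left]
  exact tsum_congr fun y => by ring

theorem ev_add (x : Rand α) (f g : α → ℝ≥0∞) :
    (x.ev fun a => f a + g a) = x.ev f + x.ev g := by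
  rw [ev, ev, ev, ← ENNReal.tsum_add]
  exact tsum_congr fun y => by ring

@[simp] theorem ev_const (x : Rand α) (r : ℝ≥0∞) : (x.ev fun _ => r) = r := by
  rw [ev, ENNReal.tsum_mul_right]
  have : ∑' y : Timed α, x.law y = 1 := PMF.tsum_coe _
  rw [this, one_mul]

theorem ev_finset_sum {ι : Type*} (x : Rand α) (s : Finset ι) (f : ι → α → ℝ≥0∞) :
    (x.ev fun a => ∑ i ∈ s, f i a) = ∑ i ∈ s, x.ev (f i) := by
  classical
  induction s using Finset.induction_on with
  | empty => simp
  | insert i s hi ih => simp only [Finset.sum_insert hi, ev_add, ih]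

theorem fail_le_one (x : Rand α) (Q : α → Prop) : x.fail Q ≤ 1 := by
  refine (ev_mono (g := fun _ => 1) fun a => ?_).trans (by simp)
  split_ifs <;> simp

theorem fail_mono_of_holds {x : Rand α} {I Q Q' : α → Prop} (hx : x.Holds I)
    (h : ∀ a, I a → Q a → Q' a) : x.fail Q' ≤ x.fail Q := by
  refine ev_mono_of_holds hx fun a ha => ?_
  by_cases hq : Q a
  · simp [hq, h a ha hq]
  · simp only [hq, if_false]; split_ifs <;> simp

theorem fail_eq_zero {x : Rand α} {Q : α → Prop} (hx : x.Holds Q) : x.fail Q = 0 := by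
  refine le_antisymm ?_ zero_le
  refine (ev_mono_of_holds (g := fun _ => 0) hx fun a ha => ?_).trans (by simp)
  simp [ha]

/-- Markov's inequality. -/
theorem fail_le_ev {x : Rand α} {I Q : α → Prop} {f : α → ℝ≥0∞} (hx : x.Holds I)
    (h : ∀ a, I a → ¬ Q a → 1 ≤ f a) : x.fail Q ≤ x.ev f := by
  refine ev_mono_of_holds hx fun a ha => ?_
  by_cases hq : Q a
  · simp [hq]
  · simpa [hq] using h a ha hq

@[simp] theorem fail_bind (x : Rand α) (g : α → Rand β) (Q : β → Prop) :
    (x >>= g).fail Q = x.ev fun a => (g a).fail Q := ev_bind _ _ _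

open Classical in
@[simp] theorem fail_lift (x : Timed α) (Q : α → Prop) :
    (lift x).fail Q = if Q x.val then 0 else 1 := ev_lift _ _

/-- The union bound for two computations in sequence. -/
theorem fail_bind_le {x : Rand α} {g : α → Rand β} {I Q : α → Prop} {Q' : β → Prop}
    {ε ε' : ℝ≥0∞} (hx : x.Holds I) (h : x.fail Q ≤ ε)
    (hg : ∀ a, I a → Q a → (g a).fail Q' ≤ ε') : (x >>= g).fail Q' ≤ ε + ε' := by
  classical
  rw [fail_bind]
  calc (x.ev fun a => (g a).fail Q') ≤ x.ev fun a => (if Q a then 0 else 1) + ε' := by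
        refine ev_mono_of_holds hx fun a ha => ?_
        by_cases hq : Q a
        · simpa [hq] using hg a ha hq
        · simpa [hq] using (fail_le_one _ _).trans le_self_add
    _ = x.fail Q + ε' := by rw [ev_add, ev_const]; rfl
    _ ≤ ε + ε' := by gcongr

theorem fail_forall_le {ι : Type*} (x : Rand α) (s : Finset ι) (Q : ι → α → Prop) :
    (x.fail fun a => ∀ i ∈ s, Q i a) ≤ ∑ i ∈ s, x.fail (Q i) := by
  classical
  unfold fail
  rw [← ev_finset_sum]
  refine ev_mono fun a => ?_
  split_ifs with h
  · simp
  · push Not at h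
    obtain ⟨i, hi, hq⟩ := h
    refine le_trans ?_ (Finset.single_le_sum (fun _ _ => zero_le) hi)
    simp [hq]

theorem fail_and_le (x : Rand α) (Q Q' : α → Prop) :
    x.fail (fun a => Q a ∧ Q' a) ≤ x.fail Q + x.fail Q' := by
  classical
  unfold fail
  rw [← ev_add]
  refine ev_mono fun a => ?_
  by_cases h : Q a <;> by_cases h' : Q' a <;> simp [h, h']

theorem holds_loopR {body : ℕ → α → Rand α} {I : α → Prop}
    (h : ∀ i a, I a → (body i a).Holds I) (N i : ℕ) {a : α} (ha : I a) :
    (loopR body N i a).Holds I := by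
  induction N generalizing i a with
  | zero => exact holds_pure ha
  | succ N ih =>
    refine (h i a ha).bind fun b hb => ?_
    refine (holds_lift (Q := I) hb).bind fun b' hb' => ih _ hb'

theorem costLe_loopR {body : ℕ → α → Rand α} {b : ℕ} (h : ∀ i a, (body i a).CostLe b)
    (N i : ℕ) (a : α) : (loopR body N i a).CostLe (N * (b + 1)) := by
  induction N generalizing i a with
  | zero => simpa [loopR] using costLe_pure a
  | succ N ih =>
    have := (h i a).bind (f := fun b => lift (charge 1 b) >>= loopR body N (i + 1)) fun b =>
      (costLe_lift (x := charge 1 b) (b := 1) (by simp)).bind fun b' => ih (i + 1) b'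
    exact this.mono (by linarith)

/-- If each pass through a loop multiplies the expectation of `φ` by at most `ρ`, then the whole
loop multiplies it by at most `ρ ^ N`. -/
theorem ev_loopR_le {body : ℕ → α → Rand α} {I : α → Prop} {φ : α → ℝ≥0∞} {ρ : ℝ≥0∞}
    (h : ∀ i a, I a → (body i a).Holds I) (hφ : ∀ i a, I a → (body i a).ev φ ≤ ρ * φ a)
    (N i : ℕ) {a : α} (ha : I a) : (loopR body N i a).ev φ ≤ ρ ^ N * φ a := by
  induction N generalizing i a with
  | zero => simp [loopR]
  | succ N ih =>
    simp only [loopR, ev_bind, ev_lift, val_charge]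
    calc ((body i a).ev fun b => (loopR body N (i + 1) b).ev φ)
        ≤ (body i a).ev fun b => ρ ^ N * φ b := ev_mono_of_holds (h i a ha) fun b hb => ih _ hb
      _ = ρ ^ N * (body i a).ev φ := ev_const_mul _ _ _
      _ ≤ ρ ^ N * (ρ * φ a) := by gcongr; exact hφ i a ha
      _ = ρ ^ (N + 1) * φ a := by ring

/-- The union bound for a loop whose `i`-th pass leads from `G i` to `G (i + 1)`, except with
probability `ε`. -/
theorem fail_loopR_le {body : ℕ → α → Rand α} {I : α → Prop} {G : ℕ → α → Prop} {ε : ℝ≥0∞}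
    {N₀ : ℕ} (h : ∀ i a, I a → (body i a).Holds I)
    (hG : ∀ i a, i < N₀ → I a → G i a → (body i a).fail (G (i + 1)) ≤ ε)
    (N i : ℕ) (hN : i + N ≤ N₀) {a : α} (ha : I a) (hi : G i a) :
    (loopR body N i a).fail (G (i + N)) ≤ N * ε := by
  induction N generalizing i a with
  | zero => exact (fail_eq_zero (holds_pure hi)).trans_le zero_le
  | succ N ih =>
    have := fail_bind_le (g := fun b => lift (charge 1 b) >>= loopR body N (i + 1))
      (Q' := G (i + (N + 1))) (ε' := N * ε) (h i a ha)
      (hG i a (by omega) ha hi) fun b hb hb' => by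
        rw [fail_bind, ev_lift, val_charge, show i + (N + 1) = i + 1 + N by ring]
        exact ih (i + 1) (by omega) hb hb'
    refine this.trans_eq ?_
    push_cast; ring

/-- If some pass of a loop achieves `Q`, and `Q` is never lost, then the loop achieves `Q`. -/
theorem fail_loopR_of_pass {body : ℕ → α → Rand α} {I Q : α → Prop} {ε : ℝ≥0∞} {l : ℕ}
    (h : ∀ i a, I a → (body i a).Holds I) (hQ : ∀ i a, I a → Q a → (body i a).Holds Q)
    (hl : ∀ a, I a → (body l a).fail Q ≤ ε) (N i : ℕ) (hil : i ≤ l) (hlN : l < i + N) {a : α}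
    (ha : I a) : (loopR body N i a).fail Q ≤ ε := by
  induction N generalizing i a with
  | zero => omega
  | succ N ih =>
    rcases hil.eq_or_lt with rfl | hlt
    · have := fail_bind_le (g := fun b => lift (charge 1 b) >>= loopR body N (i + 1))
        (Q' := Q) (ε' := 0) (h i a ha) (hl a ha) fun b hb hb' => by
          rw [fail_bind, ev_lift, val_charge]
          refine (fail_eq_zero ?_).le
          exact (holds_loopR (I := fun a => I a ∧ Q a) (fun j c hc y hy =>
            ⟨h j c hc.1 y hy, hQ j c hc.1 hc.2 y hy⟩) N (i + 1) ⟨hb, hb'⟩).mono fun _ h => h.2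
      rw [add_zero] at this
      exact this
    · have : (loopR body (N + 1) i a).fail Q = (body i a).ev fun b =>
          (loopR body N (i + 1) b).fail Q := by
        simp only [loopR, fail_bind, ev_lift, val_charge]
      rw [this]
      refine (ev_mono_of_holds (g := fun _ => ε) (h i a ha) fun b hb => ?_).trans (by simp)
      exact ih (i + 1) hlt (by omega) hb

end Rand

/-! ### Convolution by the Fourier transform -/

/-- The fast transform computes the discrete Fourier transform, for any root of unity whose order
divides `2 ^ d`. -/
theorem fft_val (d : ℕ) (ζ : ℂ) (hζ : ζ ^ 2 ^ d = 1) (a : ℕ → ℂ) {j : ℕ} (hj : j < 2 ^ d) :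
    (fft d ζ a).val j = ∑ i ∈ range (2 ^ d), a i * ζ ^ (i * j) := by
  induction d generalizing ζ a j with
  | zero =>
    obtain rfl : j = 0 := by simpa using hj
    simp [fft]
  | succ d ih =>
    have hζ2 : (ζ ^ 2) ^ 2 ^ d = 1 := by rw [← pow_mul, ← pow_succ', hζ]
    have hmod : j % 2 ^ d < 2 ^ d := Nat.mod_lt _ (by positivity)
    -- the transforms of length `2 ^ d` are periodic in `j`
    have hper : ∀ i, (ζ ^ 2) ^ (i * (j % 2 ^ d)) = ζ ^ (2 * i * j) := by
      intro i
      conv_rhs => rw [← Nat.mod_add_div j (2 ^ d)]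
      rw [mul_assoc, pow_mul ζ 2, mul_add, pow_add, mul_left_comm i, pow_mul _ (2 ^ d), hζ2]
      simp
    have hsplit : ∀ (N : ℕ) (f : ℕ → ℂ), ∑ i ∈ range (2 * N), f i =
        ∑ i ∈ range N, f (2 * i) + ∑ i ∈ range N, f (2 * i + 1) := by
      intro N f
      induction N with
      | zero => simp
      | succ N ihN => rw [mul_add, mul_one, sum_range_succ, sum_range_succ, ihN, sum_range_succ,
          sum_range_succ]; ring
    simp only [fft, Timed.val_bind, val_tab, val_charge, hj, if_true]
    rw [ih _ hζ2 _ hmod, ih _ hζ2 _ hmod, pow_succ' 2 d, hsplit, mul_sum]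
    congr 1
    · refine sum_congr rfl fun i hi => ?_
      rw [val_tab_of_lt _ (mem_range.1 hi), hper, val_charge]
    · refine sum_congr rfl fun i hi => ?_
      rw [val_tab_of_lt _ (mem_range.1 hi), hper, val_charge]
      ring

theorem fft_steps (d : ℕ) (ζ : ℂ) (a : ℕ → ℂ) : (fft d ζ a).steps ≤ 2 ^ d * (15 * d + 2) := by
  induction d generalizing ζ a with
  | zero => simp [fft]
  | succ d ih =>
    simp only [fft, Timed.steps_bind, steps_tab_charge]
    have h1 := ih (ζ ^ 2) (tab (2 ^ d) fun i => charge 2 (a (2 * i))).val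
    have h2 := ih (ζ ^ 2) (tab (2 ^ d) fun i => charge 3 (a (2 * i + 1))).val
    rw [pow_succ 2 d]
    nlinarith [pow_pos (show 0 < 2 by norm_num) d]

/-- The root of unity that `convolve` uses is primitive. -/
theorem isPrimitiveRoot_fft (d : ℕ) :
    IsPrimitiveRoot (Complex.exp (2 * Real.pi * Complex.I / (2 : ℂ) ^ d)) (2 ^ d) := by
  have := Complex.isPrimitiveRoot_exp (2 ^ d) (by positivity)
  simpa using this

/-- Orthogonality of the characters of `ℤ / N`. -/
theorem sum_root_of_unity {N : ℕ} {ζ : ℂ} (h : IsPrimitiveRoot ζ N) {x y : ℕ}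
    (hx : x < N) (hy : y < N) :
    ∑ u ∈ range N, ζ ^ (x * u) * ζ⁻¹ ^ (y * u) = if x = y then (N : ℂ) else 0 := by
  have hζ : ζ ≠ 0 := h.ne_zero (by omega)
  have hterm : ∀ u, ζ ^ (x * u) * ζ⁻¹ ^ (y * u) = (ζ ^ x * (ζ ^ y)⁻¹) ^ u := by
    intro u; rw [mul_pow, pow_mul, pow_mul, inv_pow, inv_pow, ← inv_pow]
  simp only [hterm]
  split_ifs with hxy
  · subst hxy
    simp [hζ]
  · have hne : ζ ^ x * (ζ ^ y)⁻¹ ≠ 1 := by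
      intro h1
      rw [mul_inv_eq_one₀ (pow_ne_zero _ hζ)] at h1
      exact hxy (h.pow_inj hx hy h1)
    rw [geom_sum_eq hne, mul_pow, ← pow_mul, inv_pow, ← pow_mul, mul_comm x, mul_comm y, pow_mul,
      pow_mul, h.pow_eq_one]
    simp

/-- A block of length `2 m` is at most as long as the transform, so the cyclic convolution with the
pattern does not wrap around at the first `m` positions of the block. -/
theorem convolve_val {n m : ℕ} (hm : 1 ≤ m) (hmn : m ≤ n) (a b : ℕ → ℤ) {i : ℕ}
    (hi : i < n - m + 1) :
    (convolve n m a b).val i = ∑ j ∈ range m, a (i + j) * b j := by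
  set d := Nat.clog 2 (2 * m) with hd
  have h2m : 2 * m ≤ 2 ^ d := Nat.le_pow_clog (by norm_num) _
  set ζ := Complex.exp (2 * Real.pi * Complex.I / (2 : ℂ) ^ d) with hζdef
  have hζ : IsPrimitiveRoot ζ (2 ^ d) := isPrimitiveRoot_fft d
  have hone : ζ ^ 2 ^ d = 1 := hζ.pow_eq_one
  have hone' : ζ⁻¹ ^ 2 ^ d = 1 := by rw [inv_pow, hone, inv_one]
  have hdiv : i / m < n / m + 1 := Nat.lt_succ_of_le (Nat.div_le_div_right (by omega))
  have hmod : i % m < m := Nat.mod_lt _ hm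
  simp only [convolve, Timed.val_bind, val_tab, val_charge, hi, hdiv, hmod, if_true, ← hd, ← hζdef]
  set x := i % m with hx
  set w : ℕ → ℂ := fun s => if s < 2 * m ∧ i / m * m + s < n then (a (i / m * m + s) : ℂ) else 0
    with hw
  set q : ℕ → ℂ := fun j => if j < m then (b j : ℂ) else 0 with hq
  rw [fft_val _ _ hone' _ (by omega)]
  have hprod : ∀ u ∈ range (2 ^ d),
      (tab (2 ^ d) fun u => charge 3 ((fft d ζ (tab (2 ^ d) fun s => charge 7 (w s)).val).val u *
        (fft d ζ⁻¹ (tab (2 ^ d) fun j => charge 3 (q j)).val).val u)).val u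
      = ∑ s ∈ range (2 ^ d), ∑ j ∈ range m, w s * b j * (ζ ^ (s * u) * ζ⁻¹ ^ (j * u)) := by
    intro u hu
    have hu := mem_range.1 hu
    rw [val_tab_of_lt _ hu, val_charge, fft_val _ _ hone _ hu, fft_val _ _ hone' _ hu]
    have : ∑ j ∈ range (2 ^ d), (tab (2 ^ d) fun j => charge 3 (q j)).val j * ζ⁻¹ ^ (j * u) =
        ∑ j ∈ range m, b j * ζ⁻¹ ^ (j * u) := by
      symm
      refine sum_subset_zero_on_sdiff (range_subset_range.2 (by omega)) ?_ ?_
      · intro j hj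
        simp only [mem_sdiff, mem_range, not_lt] at hj
        simp [hq, hj.1, not_lt.2 hj.2]
      · intro j hj
        have hj := mem_range.1 hj
        rw [val_tab_of_lt _ (by omega)]
        simp [hq, hj]
    rw [this, sum_mul_sum]
    refine sum_congr rfl fun s hs => sum_congr rfl fun j _ => ?_
    rw [val_tab_of_lt _ (mem_range.1 hs), val_charge]
    ring
  rw [sum_congr rfl fun u hu => by rw [hprod u hu]]
  have hmain : ∑ u ∈ range (2 ^ d), (∑ s ∈ range (2 ^ d), ∑ j ∈ range m,
      w s * b j * (ζ ^ (s * u) * ζ⁻¹ ^ (j * u))) * ζ⁻¹ ^ (u * x)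
      = 2 ^ d * ∑ j ∈ range m, (a (i + j) : ℂ) * b j := by
    have h1 : ∀ u, (∑ s ∈ range (2 ^ d), ∑ j ∈ range m,
        w s * b j * (ζ ^ (s * u) * ζ⁻¹ ^ (j * u))) * ζ⁻¹ ^ (u * x)
        = ∑ j ∈ range m, ∑ s ∈ range (2 ^ d),
          w s * b j * (ζ ^ (s * u) * ζ⁻¹ ^ ((j + x) * u)) := by
      intro u
      rw [sum_comm, sum_mul]
      refine sum_congr rfl fun j _ => ?_
      rw [sum_mul]
      refine sum_congr rfl fun s _ => ?_
      rw [add_mul, pow_add, mul_comm u x]; ring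
    simp only [h1]
    rw [sum_comm, mul_sum]
    refine sum_congr rfl fun j hj => ?_
    have hj := mem_range.1 hj
    rw [sum_comm]
    simp only [← mul_sum]
    have hjx : j + x < 2 ^ d := by omega
    rw [sum_congr rfl fun s hs => by rw [sum_root_of_unity hζ (mem_range.1 hs) hjx]]
    rw [sum_eq_single (j + x)]
    · have hpos : i / m * m + (j + x) = i + j := by
        have := Nat.div_add_mod' i m
        omega
      have hlt : i + j < n := by omega
      simp only [hw, hpos, hlt, and_true, show j + x < 2 * m by omega, if_true]
      push_cast; ring
    · intro s _ hs; simp [hs]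
    · intro h; exact absurd (mem_range.2 hjx) h
  rw [hmain]
  have hre : ((2 ^ d * ∑ j ∈ range m, (a (i + j) : ℂ) * b j).re / 2 ^ d : ℝ)
      = ((∑ j ∈ range m, a (i + j) * b j : ℤ) : ℝ) := by
    have : (2 ^ d * ∑ j ∈ range m, (a (i + j) : ℂ) * b j)
        = ((2 ^ d * ∑ j ∈ range m, (a (i + j) : ℝ) * b j : ℝ) : ℂ) := by push_cast; rfl
    rw [this, Complex.ofReal_re, mul_div_cancel_left₀ _ (by positivity)]
    push_cast; rfl
  rw [hre, round_intCast]

theorem convolve_steps {n m : ℕ} (hm : 1 ≤ m) (hmn : m ≤ n) (a b : ℕ → ℤ) :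
    (convolve n m a b).steps ≤ 500 * n * (Nat.clog 2 m + 1) := by
  set d := Nat.clog 2 (2 * m) with hd
  have hd1 : d = Nat.clog 2 m + 1 := by
    rw [hd, Nat.clog_of_two_le (by norm_num) (by omega)]; congr 2; omega
  have h4 : 2 ^ d ≤ 4 * m := by
    rcases Nat.lt_or_ge 1 m with h | h
    · have := Nat.pow_pred_clog_lt_self (b := 2) (by norm_num) h
      rw [hd1, pow_succ]
      have hc : 0 < Nat.clog 2 m := Nat.clog_pos (by norm_num) h
      obtain ⟨e, he⟩ : ∃ e, Nat.clog 2 m = e + 1 := ⟨_, (Nat.succ_pred_eq_of_pos hc).symm⟩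
      rw [he, Nat.pred_succ] at this
      rw [he, pow_succ]; omega
    · obtain rfl : m = 1 := by omega
      simp [hd1]
  have hdpos : 1 ≤ d := by omega
  have hfft : ∀ ζ w, (fft d ζ w).steps ≤ 68 * m * d := fun ζ w =>
    (fft_steps d ζ w).trans (by nlinarith)
  simp only [convolve, Timed.steps_bind, steps_tab_charge, steps_charge, val_charge,
    ← hd]
  have hblocks : ∀ (N : ℕ) (f : ℕ → Timed (ℕ → ℤ)), (∀ β, (f β).steps ≤ 189 * m * d) →
      (tab N f).steps ≤ N * (190 * m * d) := fun N f h =>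
    (steps_tab_le h).trans (Nat.mul_le_mul_left _ (by nlinarith))
  have hnm : n / m * m ≤ n := Nat.div_mul_le_self n m
  refine (add_le_add le_rfl (add_le_add le_rfl (add_le_add le_rfl (add_le_add (hfft _ _)
    (add_le_add (hblocks _ _ fun β => ?_) le_rfl))))).trans ?_
  · simp only [Timed.steps_bind, steps_tab_charge]
    refine (add_le_add le_rfl (add_le_add (hfft _ _)
      (add_le_add le_rfl (add_le_add (hfft _ _) le_rfl)))).trans ?_
    nlinarith
  · have h1 : (n / m + 1) * (190 * m * d) ≤ 380 * n * d := by
      have : (n / m + 1) * m ≤ 2 * n := by rw [add_mul]; omega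
      calc (n / m + 1) * (190 * m * d) = 190 * d * ((n / m + 1) * m) := by ring
        _ ≤ 190 * d * (2 * n) := Nat.mul_le_mul_left _ this
        _ = 380 * n * d := by ring
    have h2 : 68 * m * d ≤ 68 * n * d := by gcongr
    have h3 : n ≤ n * d := Nat.le_mul_of_pos_right _ hdpos
    have h4' : n - m + 1 ≤ n := by omega
    rw [← hd1]
    nlinarith

/-! ### The `1`-mismatch test -/

theorem powerSums_val {n m : ℕ} (hm : 1 ≤ m) (hmn : m ≤ n) (r a b : ℕ) (t p : ℕ → ℤ) {i : ℕ}
    (hi : i < n - m + 1) :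
    (powerSums n m r a b t p).val i =
      ∑ j ∈ range m, ((i + j : ℕ) : ℤ) ^ r * t (i + j) ^ a * p j ^ b := by
  simp only [powerSums, Timed.val_bind]
  rw [convolve_val hm hmn _ _ hi]
  refine sum_congr rfl fun j hj => ?_
  have hj := mem_range.1 hj
  rw [val_tab_of_lt _ (by omega), val_tab_of_lt _ hj, val_charge, val_charge]

theorem powerSums_steps {n m : ℕ} (hm : 1 ≤ m) (hmn : m ≤ n) (r a b : ℕ) (t p : ℕ → ℤ) :
    (powerSums n m r a b t p).steps ≤ 510 * n * (Nat.clog 2 m + 1) := by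
  simp only [powerSums, Timed.steps_bind, steps_tab_charge]
  refine (add_le_add le_rfl (add_le_add le_rfl (convolve_steps hm hmn _ _))).trans ?_
  nlinarith

theorem errorSums_val {n m : ℕ} (hm : 1 ≤ m) (hmn : m ≤ n) (t p : ℕ → ℤ) {i : ℕ}
    (hi : i < n - m + 1) :
    (errorSums n m t p).val i =
      (∑ j ∈ range m, err t p i j, ∑ j ∈ range m, ((i : ℤ) + j) * err t p i j) := by
  simp only [errorSums, Timed.val_bind]
  rw [val_tab_of_lt _ hi, val_charge]
  simp only [powerSums_val hm hmn _ _ _ _ _ hi, mul_sum, ← sum_sub_distrib, ← sum_add_distrib]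
  congr 1 <;> refine sum_congr rfl fun j _ => ?_ <;> simp only [err] <;> push_cast <;> ring

theorem errorSums_steps {n m : ℕ} (hm : 1 ≤ m) (hmn : m ≤ n) (t p : ℕ → ℤ) :
    (errorSums n m t p).steps ≤ 3100 * n * (Nat.clog 2 m + 1) := by
  simp only [errorSums, Timed.steps_bind, steps_tab_charge]
  have h := fun r a b => powerSums_steps hm hmn r a b t p
  refine (add_le_add (h _ _ _) (add_le_add (h _ _ _) (add_le_add (h _ _ _) (add_le_add (h _ _ _)
    (add_le_add (h _ _ _) (add_le_add (h _ _ _) le_rfl)))))).trans ?_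
  have : n - m + 1 ≤ n := by omega
  nlinarith

theorem oneMismatch_steps {n m : ℕ} (hm : 1 ≤ m) (hmn : m ≤ n) (t p : ℕ → ℤ) :
    (oneMismatch n m t p).steps ≤ 3121 * n * (Nat.clog 2 m + 1) := by
  simp only [oneMismatch, Timed.steps_bind, steps_tab_charge]
  refine (add_le_add (errorSums_steps hm hmn _ _) le_rfl).trans ?_
  have : n - m + 1 ≤ n := by omega
  nlinarith

/-- Soundness of the test: whatever the two sums are, the position reported has a nonzero error
term. -/
theorem isolate_eq_some {m : ℕ} {t p : ℕ → ℤ} {i j : ℕ} {E E' : ℤ}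
    (h : isolate m t p i E E' = some j) : j < m ∧ err t p i j ≠ 0 := by
  unfold isolate at h
  split_ifs at h with hc
  obtain ⟨h0, h1, h2, h3⟩ := hc
  obtain rfl := Option.some.inj h
  exact ⟨by omega, by rw [h3]; exact h0⟩

/-- Completeness of the test: a single error term passes it. -/
theorem isolate_single {m : ℕ} {t p : ℕ → ℤ} {i j : ℕ} (hj : j < m) (h : err t p i j ≠ 0) :
    isolate m t p i (err t p i j) (((i : ℤ) + j) * err t p i j) = some j := by
  unfold isolate
  have h1 : ((i : ℤ) + j) * err t p i j / err t p i j = i + j := Int.mul_ediv_cancel _ h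
  have h2 : ((i : ℤ) + j - i).toNat = j := by omega
  rw [h1, h2, if_pos ⟨h, by omega, by omega, rfl⟩]

/-! ### Mismatches of the encoded strings, and the state of an alignment -/

/-- The mismatches at alignment `i`, in terms of the encoded strings: the pattern positions whose
error term does not vanish. -/
def errPositions (m : ℕ) (t p : ℕ → ℤ) (i : ℕ) : Finset ℕ :=
  (range m).filter fun j => err t p i j ≠ 0

theorem mem_errPositions {m : ℕ} {t p : ℕ → ℤ} {i j : ℕ} :
    j ∈ errPositions m t p i ↔ j < m ∧ err t p i j ≠ 0 := by
  simp [errPositions]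

theorem errPositions_subset (m : ℕ) (t p : ℕ → ℤ) (i : ℕ) : errPositions m t p i ⊆ range m :=
  filter_subset _ _

theorem err_nonneg {t p : ℕ → ℤ} (ht : ∀ i, 0 ≤ t i) (hp : ∀ j, 0 ≤ p j) (i j : ℕ) :
    0 ≤ err t p i j :=
  mul_nonneg (mul_nonneg (sq_nonneg _) (ht _)) (hp _)

theorem mask_val {m : ℕ} (p : ℕ → ℤ) (S : Finset ℕ) {j : ℕ} (hj : j < m) :
    (mask m p S).val j = if j ∈ S then p j else 0 := by
  simp [mask, hj]

theorem err_mask {m : ℕ} (t p : ℕ → ℤ) (S : Finset ℕ) (i : ℕ) {j : ℕ} (hj : j < m) :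
    err t (mask m p S).val i j = if j ∈ S then err t p i j else 0 := by
  simp only [err, mask_val p S hj]
  split_ifs <;> simp

theorem mem_of_isolate_mask {m : ℕ} {t p : ℕ → ℤ} {S : Finset ℕ} {i j : ℕ} {E E' : ℤ}
    (h : isolate m t (mask m p S).val i E E' = some j) : j ∈ errPositions m t p i := by
  obtain ⟨hj, he⟩ := isolate_eq_some h
  rw [err_mask t p S i hj] at he
  split_ifs at he with hS
  · exact mem_errPositions.2 ⟨hj, he⟩
  · exact absurd rfl he

theorem sum_err_mask (m : ℕ) (t p : ℕ → ℤ) (S : Finset ℕ) (i : ℕ) (g : ℕ → ℤ) :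
    ∑ j ∈ range m, g j * err t (mask m p S).val i j =
      ∑ j ∈ errPositions m t p i ∩ S, g j * err t p i j := by
  symm
  refine sum_subset_zero_on_sdiff ?_ ?_ ?_
  · exact inter_subset_left.trans (errPositions_subset m t p i)
  · intro j hj
    simp only [mem_sdiff, mem_range, mem_inter, mem_errPositions, not_and] at hj
    rw [err_mask t p S i hj.1]
    split_ifs with hS
    · have : err t p i j = 0 := by
        by_contra h0; exact hj.2 ⟨hj.1, h0⟩ hS
      simp [this]
    · simp
  · intro j hj
    have hj' := mem_inter.1 hj
    rw [err_mask t p S i (mem_errPositions.1 hj'.1).1, if_pos hj'.2]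

/-- The invariant of the state of alignment `i`: only mismatches are listed, and `E` is the sum
of the error terms of the others. -/
def Loc.Valid (m : ℕ) (t p : ℕ → ℤ) (i : ℕ) (s : Loc) : Prop :=
  s.L ⊆ errPositions m t p i ∧ s.E = ∑ j ∈ errPositions m t p i \ s.L, err t p i j

/-- A later state of alignment `i`: the invariant is kept, and the list has not shrunk. -/
def Loc.Ext (m : ℕ) (t p : ℕ → ℤ) (i : ℕ) (s s' : Loc) : Prop :=
  (s.Valid m t p i → s'.Valid m t p i) ∧ s.L ⊆ s'.L

theorem Loc.Ext.refl (m : ℕ) (t p : ℕ → ℤ) (i : ℕ) (s : Loc) : s.Ext m t p i s :=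
  ⟨id, Subset.rfl⟩

theorem Loc.Ext.trans {m : ℕ} {t p : ℕ → ℤ} {i : ℕ} {s s' s'' : Loc}
    (h : s.Ext m t p i s') (h' : s'.Ext m t p i s'') : s.Ext m t p i s'' :=
  ⟨fun hs => h'.1 (h.1 hs), h.2.trans h'.2⟩

theorem Loc.L_add (t p : ℕ → ℤ) (i j : ℕ) (s : Loc) : (s.add t p i j).L = insert j s.L := by
  unfold Loc.add
  split_ifs with h
  · rw [insert_eq_of_mem h]
  · rfl

theorem Loc.ext_add {m : ℕ} {t p : ℕ → ℤ} {i j : ℕ} (hj : j ∈ errPositions m t p i) (s : Loc) :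
    s.Ext m t p i (s.add t p i j) := by
  refine ⟨fun hs => ⟨?_, ?_⟩, ?_⟩
  · rw [Loc.L_add]; exact insert_subset hj hs.1
  · unfold Loc.add
    split_ifs with h
    · exact hs.2
    · have hmem : j ∈ errPositions m t p i \ s.L := mem_sdiff.2 ⟨hj, h⟩
      have : errPositions m t p i \ insert j s.L = (errPositions m t p i \ s.L).erase j := by
        ext x; simp only [mem_sdiff, mem_insert, mem_erase]; tauto
      simp only [this]
      rw [hs.2, ← add_sum_erase _ _ hmem]
      ring
  · rw [Loc.L_add]; exact subset_insert _ _

/-- A list that makes its alignment settled: more than `k` mismatches are known, or all are. -/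
def Done (m k : ℕ) (t p : ℕ → ℤ) (i : ℕ) (s : Loc) : Prop :=
  k < s.L.card ∨ errPositions m t p i ⊆ s.L

theorem Done.ext {m k : ℕ} {t p : ℕ → ℤ} {i : ℕ} {s s' : Loc} (h : Done m k t p i s)
    (hs : s.Ext m t p i s') : Done m k t p i s' :=
  h.imp (fun h => h.trans_le (card_le_card hs.2)) fun h => h.trans hs.2

theorem Loc.Valid.E_eq_zero_iff {m : ℕ} {t p : ℕ → ℤ} (ht : ∀ i, 0 ≤ t i) (hp : ∀ j, 0 ≤ p j)
    {i : ℕ} {s : Loc} (hs : s.Valid m t p i) : s.E = 0 ↔ errPositions m t p i ⊆ s.L := by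
  rw [hs.2, sum_eq_zero_iff_of_nonneg fun j _ => err_nonneg ht hp i j, ← sdiff_eq_empty_iff_subset,
    eq_empty_iff_forall_notMem]
  refine forall_congr' fun j => ⟨fun h hj => ?_, fun h hj => absurd hj h⟩
  exact (mem_errPositions.1 (mem_sdiff.1 hj).1).2 (h hj)

theorem Loc.Valid.settled_iff {m k : ℕ} {t p : ℕ → ℤ} (ht : ∀ i, 0 ≤ t i) (hp : ∀ j, 0 ≤ p j)
    {i : ℕ} {s : Loc} (hs : s.Valid m t p i) : s.Settled k ↔ Done m k t p i s := by
  rw [Loc.Settled, hs.E_eq_zero_iff ht hp, Done, or_comm]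

/-- The invariant of the state of the algorithm. -/
def AllValid (n m : ℕ) (t p : ℕ → ℤ) (st : ℕ → Loc) : Prop :=
  ∀ i < n - m + 1, (st i).Valid m t p i

/-- A later state of the algorithm. -/
def AllExt (n m : ℕ) (t p : ℕ → ℤ) (st st' : ℕ → Loc) : Prop :=
  ∀ i < n - m + 1, (st i).Ext m t p i (st' i)

theorem AllExt.refl (n m : ℕ) (t p : ℕ → ℤ) (st : ℕ → Loc) : AllExt n m t p st st :=
  fun _ _ => Loc.Ext.refl _ _ _ _ _

theorem AllExt.trans {n m : ℕ} {t p : ℕ → ℤ} {st st' st'' : ℕ → Loc} (h : AllExt n m t p st st')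
    (h' : AllExt n m t p st' st'') : AllExt n m t p st st'' :=
  fun i hi => (h i hi).trans (h' i hi)

theorem AllExt.valid {n m : ℕ} {t p : ℕ → ℤ} {st st' : ℕ → Loc} (h : AllExt n m t p st st')
    (hst : AllValid n m t p st) : AllValid n m t p st' :=
  fun i hi => (h i hi).1 (hst i hi)

theorem start_val {n m : ℕ} (hm : 1 ≤ m) (hmn : m ≤ n) (t p : ℕ → ℤ) :
    AllValid n m t p (start n m t p).val ∧ ∀ i, ((start n m t p).val i).L = ∅ := by
  constructor
  · intro i hi
    simp only [start, Timed.val_bind, val_tab_of_lt _ hi, val_charge]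
    refine ⟨empty_subset _, ?_⟩
    rw [errorSums_val hm hmn t p hi, sdiff_empty, errPositions, sum_filter_ne_zero]
  · intro i
    simp only [start, Timed.val_bind, val_tab, val_charge]
    split_ifs <;> rfl

/-! ### Sampling steps and residual searches extend the lists -/

/-- A sampling step once its sample has been drawn. -/
def sampleWith (n m : ℕ) (t p : ℕ → ℤ) (st : ℕ → Loc) (S : Finset ℕ) : Timed (ℕ → Loc) := do
  let p' ← mask m p S
  let hit ← oneMismatch n m t p'
  tab (n - m + 1) fun i => charge 15 <|
    match hit i with
    | none => st i
    | some j => (st i).add t p i j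

theorem samplingStep_eq (n m s : ℕ) (t p : ℕ → ℤ) (st : ℕ → Loc) :
    samplingStep n m s t p st = draw m s >>= fun S => Rand.lift (sampleWith n m t p st S) := rfl

theorem sampleWith_ext (n m : ℕ) (t p : ℕ → ℤ) (st : ℕ → Loc) (S : Finset ℕ) :
    AllExt n m t p st (sampleWith n m t p st S).val := by
  intro i hi
  simp only [sampleWith, oneMismatch, Timed.val_bind, val_tab_of_lt _ hi, val_charge]
  split
  · exact Loc.Ext.refl _ _ _ _ _
  · next j hj => exact Loc.ext_add (mem_of_isolate_mask hj) _

/-- A mismatch that is alone in the sample gets listed. -/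
theorem sampleWith_single {n m : ℕ} (hm : 1 ≤ m) (hmn : m ≤ n) (t p : ℕ → ℤ) (st : ℕ → Loc)
    {S : Finset ℕ} {i j : ℕ} (hi : i < n - m + 1) (h : errPositions m t p i ∩ S = {j}) :
    ((sampleWith n m t p st S).val i).L = insert j (st i).L := by
  have hmem : j ∈ errPositions m t p i ∩ S := h ▸ mem_singleton_self j
  obtain ⟨hj, hS⟩ := mem_inter.1 hmem
  obtain ⟨hjm, hne⟩ := mem_errPositions.1 hj
  have h1 : err t (mask m p S).val i j = err t p i j := by rw [err_mask t p S i hjm, if_pos hS]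
  have hhit : isolate m t (mask m p S).val i ((errorSums n m t (mask m p S).val).val i).1
      ((errorSums n m t (mask m p S).val).val i).2 = some j := by
    rw [errorSums_val hm hmn _ _ hi]
    have hE := sum_err_mask m t p S i fun _ => 1
    simp only [one_mul] at hE
    simp only [hE, sum_err_mask m t p S i, h, sum_singleton]
    rw [← h1]
    exact isolate_single hjm (by rwa [h1])
  simp only [sampleWith, oneMismatch, Timed.val_bind, val_tab_of_lt _ hi, val_charge, hhit]
  exact Loc.L_add _ _ _ _ _

theorem samplingStep_holds (n m s : ℕ) (t p : ℕ → ℤ) (st : ℕ → Loc) :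
    (samplingStep n m s t p st).Holds (AllExt n m t p st) :=
  (Rand.holds_true _).bind fun S _ => Rand.holds_lift (sampleWith_ext n m t p st S)

theorem loopR_ext {n m : ℕ} {t p : ℕ → ℤ} {body : ℕ → (ℕ → Loc) → Rand (ℕ → Loc)}
    (h : ∀ l st, (body l st).Holds (AllExt n m t p st)) (N l : ℕ) (st : ℕ → Loc) :
    (loopR body N l st).Holds (AllExt n m t p st) :=
  Rand.holds_loopR (fun l st' h' => (h l st').mono fun _ => h'.trans) N l (AllExt.refl n m t p st)

theorem loopT_induction {α : Type} {body : ℕ → α → Timed α} {Q : α → Prop}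
    (h : ∀ x a, Q a → Q (body x a).val) (N x : ℕ) {a : α} (ha : Q a) :
    Q (loopT body N x a).val := by
  induction N generalizing x a with
  | zero => exact ha
  | succ N ih => exact ih (x + 1) (h x a ha)

/-- The error sums of all the samples of a residual search, together with the masked patterns. -/
def sampleSums (n m N : ℕ) (Ss : List (Finset ℕ)) (t p : ℕ → ℤ) :
    Timed (ℕ → (ℕ → ℤ) × (ℕ → ℤ × ℤ)) :=
  tab N fun x => do
    let p' ← mask m p (Ss.getD x ∅)
    let X ← errorSums n m t p'
    charge 2 (p', X)

/-- What a residual search does for one sample at alignment `i`, when `s` is the state at the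
start, `s'` the present one, and `K` the vector of known sums. -/
def residualUpdate (n m : ℕ) (samples : ℕ → (ℕ → ℤ) × (ℕ → ℤ × ℤ)) (t p : ℕ → ℤ) (i : ℕ)
    (s : Loc) (K : ℕ → ℤ × ℤ) (x : ℕ) (s' : Loc) : Timed Loc :=
  let D := field n m (fun u => (K u).1) x
  let D' := field n m (fun u => (K u).2) x
  let p' := (samples x).1
  let X := (samples x).2 i
  charge 60 <|
    match isolate m t p' i (X.1 - D) (X.2 - (i * D + D')) with
    | none => s'
    | some j => if j ∈ s.L then s' else s'.add t p i j

/-- A residual search at one alignment. -/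
def residualAt (c n m k N : ℕ) (rows : ℕ → (ℕ → ℤ) × Finset ℕ)
    (samples : ℕ → (ℕ → ℤ) × (ℕ → ℤ × ℤ)) (t p : ℕ → ℤ) (i : ℕ) (s : Loc) : Timed Loc := do
  let work ← charge (if s.E = 0 ∨ k < s.L.card then 3 else 3 + 2 * s.L.card)
    (∑ j ∈ s.L, (rows j).2.card)
  if s.E = 0 ∨ k < s.L.card ∨ 8 * c * k * fieldBits m < work then charge 4 s
  else do
    let K ← knownSums n m N rows t p i s.L
    loopT (residualUpdate n m samples t p i s K) N 0 s

theorem residualSearch_eq (c n m k N : ℕ) (Ss : List (Finset ℕ)) (t p : ℕ → ℤ) (st : ℕ → Loc) :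
    residualSearch c n m k N Ss t p st = (do
      let rows ← incidence n m N Ss
      let samples ← sampleSums n m N Ss t p
      tab (n - m + 1) fun i => do
        let s ← charge 1 (st i)
        residualAt c n m k N rows samples t p i s) := rfl

theorem residualSearch_val (c n m k N : ℕ) (Ss : List (Finset ℕ)) (t p : ℕ → ℤ) (st : ℕ → Loc)
    {i : ℕ} (hi : i < n - m + 1) :
    (residualSearch c n m k N Ss t p st).val i =
      (residualAt c n m k N (incidence n m N Ss).val (sampleSums n m N Ss t p).val t p i
        (st i)).val := by
  simp only [residualSearch_eq, Timed.val_bind, val_tab_of_lt _ hi, val_charge]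

theorem residualUpdate_ext (n m N : ℕ) (Ss : List (Finset ℕ)) (t p : ℕ → ℤ) (i : ℕ)
    (s : Loc) (K : ℕ → ℤ × ℤ) (x : ℕ) (s' : Loc) :
    s'.Ext m t p i
      (residualUpdate n m (sampleSums n m N Ss t p).val t p i s K x s').val := by
  simp only [residualUpdate, val_charge]
  split
  · exact Loc.Ext.refl _ _ _ _ _
  · next j hj =>
    split_ifs with hL
    · exact Loc.Ext.refl _ _ _ _ _
    · refine Loc.ext_add ?_ _
      rw [sampleSums, val_tab] at hj
      split_ifs at hj with hx
      · exact mem_of_isolate_mask hj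
      · -- beyond the table of samples the pattern is the default one, which is zero
        exact absurd (isolate_eq_some hj).2 (by simp [err, default])

theorem residualSearch_ext (c n m k N : ℕ) (Ss : List (Finset ℕ)) (t p : ℕ → ℤ) (st : ℕ → Loc) :
    AllExt n m t p st (residualSearch c n m k N Ss t p st).val := by
  intro i hi
  rw [residualSearch_val _ _ _ _ _ _ _ _ _ hi, residualAt, Timed.val_bind, val_charge]
  split_ifs with hif
  · exact Loc.Ext.refl _ _ _ _ _
  · exact loopT_induction (Q := fun s' => (st i).Ext m t p i s') (fun x s' hs' =>
      hs'.trans (residualUpdate_ext _ _ _ _ _ _ _ _ _ _ _)) N 0 (Loc.Ext.refl _ _ _ _ _)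

theorem algorithm1_holds {n m : ℕ} (hm : 1 ≤ m) (hmn : m ≤ n) (c k : ℕ) (t p : ℕ → ℤ) :
    (algorithm1 c n m k t p).Holds (AllValid n m t p) :=
  (Rand.holds_lift (start_val hm hmn t p).1).bind fun st hst =>
    (loopR_ext (fun _ st => samplingStep_holds n m _ t p st) _ _ st).mono fun _ h => h.valid hst

theorem algorithm2_holds {n m : ℕ} (hm : 1 ≤ m) (hmn : m ≤ n) (c k : ℕ) (t p : ℕ → ℤ) :
    (algorithm2 c n m k t p).Holds (AllValid n m t p) := by
  refine (Rand.holds_lift (start_val hm hmn t p).1).bind fun st hst =>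
    (loopR_ext (fun l st => ?_) _ _ st).mono fun _ h => h.valid hst
  exact (Rand.holds_true _).bind fun Ss _ => Rand.holds_lift (residualSearch_ext _ _ _ _ _ _ _ _ _)

theorem firstStep_holds {n m : ℕ} (hm : 1 ≤ m) (hmn : m ≤ n) (a : FirstStep) (c k : ℕ)
    (t p : ℕ → ℤ) : (firstStep a c n m k t p).Holds (AllValid n m t p) := by
  cases a
  · exact algorithm1_holds hm hmn c k t p
  · exact algorithm2_holds hm hmn c k t p

theorem phases_holds (c n m k : ℕ) (t p : ℕ → ℤ) (st : ℕ → Loc) :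
    (phases c n m k t p st).Holds (AllExt n m t p st) :=
  loopR_ext (fun _ st => loopR_ext (fun _ st => samplingStep_holds n m _ t p st) _ _ st) _ _ st

/-! ### The output is correct -/

section Encoding

variable {n m : ℕ} (T : Fin n → ℕ) (P : Fin m → ℕ)

theorem code_nonneg (x : ℕ) : 0 ≤ code P x := by
  unfold code; split_ifs <;> positivity

theorem code_le (x : ℕ) : code P x ≤ m + 1 := by
  unfold code
  split_ifs
  · positivity
  · have : (List.ofFn P).idxOf x ≤ (List.ofFn P).length := List.idxOf_le_length
    rw [List.length_ofFn] at this
    omega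

theorem code_eq_zero {x : ℕ} : code P x = 0 ↔ x = 0 := by
  unfold code; split_ifs with h
  · simp [h]
  · simp only [h, iff_false]; positivity

theorem code_inj {x : ℕ} {j : Fin m} (hx : x ≠ 0) (hj : P j ≠ 0) :
    code P x = code P (P j) ↔ x = P j := by
  refine ⟨fun h => ?_, fun h => by rw [h]⟩
  simp only [code, hx, hj, if_false] at h
  have hmem : P j ∈ List.ofFn P := (List.mem_ofFn' _ _).2 ⟨j, rfl⟩
  exact ((List.idxOf_inj hmem).1 (by omega)).symm

theorem encodeText_nonneg (i : ℕ) : 0 ≤ (encodeText T P).val i := by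
  simp only [encodeText, Timed.val_bind, val_tab, val_charge]
  split_ifs
  · exact code_nonneg _ _
  · exact le_rfl

theorem encodeText_le (i : ℕ) : (encodeText T P).val i ≤ m + 1 := by
  simp only [encodeText, Timed.val_bind, val_tab, val_charge]
  split_ifs
  · exact code_le _ _
  · simp only [default]; positivity

theorem encodePattern_nonneg (j : ℕ) : 0 ≤ (encodePattern P).val j := by
  simp only [encodePattern, val_tab, val_charge]
  split_ifs
  · exact code_nonneg _ _
  · exact le_rfl

theorem encodePattern_le (j : ℕ) : (encodePattern P).val j ≤ m + 1 := by
  simp only [encodePattern, val_tab, val_charge]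
  split_ifs
  · exact code_le _ _
  · simp only [default]; positivity

/-- The encoding keeps the pattern symbols apart, and gives all others the code `m + 1`; hence it
neither loses nor creates mismatches. -/
theorem errPositions_encode (i : ℕ) :
    errPositions m (encodeText T P).val (encodePattern P).val i = mismatches T P i := by
  classical
  ext j
  rw [mem_errPositions, mismatches, mem_filter, mem_range]
  refine and_congr_right fun hj => ?_
  by_cases hi : i + j < n
  · simp only [IsMismatch, err, encodeText, encodePattern, Timed.val_bind, val_tab_of_lt _ hi,
      val_tab_of_lt _ hj, val_charge, hi, hj, dif_pos, exists_true_left, ne_eq, mul_eq_zero,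
      pow_eq_zero_iff two_ne_zero, sub_eq_zero, code_eq_zero, not_or]
    constructor
    · rintro ⟨⟨h1, h2⟩, h3⟩
      exact ⟨h2, h3, fun h => h1 (by rw [h])⟩
    · rintro ⟨h2, h3, h1⟩
      exact ⟨⟨fun h => h1 ((code_inj P h2 h3).1 h), h2⟩, h3⟩
  · have h0 : (encodeText T P).val (i + j) = 0 := by
      simp [encodeText, hi]
    simp [IsMismatch, err, h0, hi]

end Encoding

/-- Only the invariant is needed: a state is settled exactly if its list is complete or long. -/
theorem rounds_correct {n m : ℕ} (hm : 1 ≤ m) (hmn : m ≤ n) (a : FirstStep) (c k : ℕ)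
    (T : Fin n → ℕ) (P : Fin m → ℕ) (N : ℕ) :
    (rounds a c n m k (encodeText T P).val (encodePattern P).val N).Holds
      fun o => ∀ out, o = some out → out.Correct k T P := by
  set t := (encodeText T P).val with ht
  set p := (encodePattern P).val with hp
  induction N with
  | zero => exact Rand.holds_pure (by simp)
  | succ N ih =>
    refine (firstStep_holds hm hmn a c k t p).bind fun st hst => ?_
    refine ((phases_holds c n m k t p st).mono fun _ h => h.valid hst).bind fun st hst => ?_
    refine (Rand.holds_lift (Q := AllValid n m t p) hst).bind fun st hst => ?_
    split_ifs with hif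
    · refine Rand.holds_lift ?_
      rintro out h
      obtain rfl := Option.some.inj h
      have hM : ∀ i, errPositions m t p i = mismatches T P i := errPositions_encode T P
      have hkey : ∀ i < n - m + 1, (st i).L ⊆ mismatches T P i ∧
          ((st i).L = mismatches T P i ∨ k < ((st i).L).card) := by
        intro i hi
        have h1 := (hst i hi).1
        have h2 := ((hst i hi).settled_iff (encodeText_nonneg T P) (encodePattern_nonneg P)).1
          (hif i hi)
        rw [← hM]
        exact ⟨h1, h2.symm.imp_left fun h => Subset.antisymm h1 h⟩
      refine ⟨?_, hkey⟩
      refine filter_congr fun i hi => ?_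
      obtain ⟨h1, h2⟩ := hkey i (mem_range.1 hi)
      rcases h2 with h2 | h2
      · rw [h2]
      · exact iff_of_false (not_le.2 h2) (not_le.2 (h2.trans_le (card_le_card h1)))
    · exact ih

theorem algorithm3_correct {n m : ℕ} (hm : 1 ≤ m) (hmn : m ≤ n) (a : FirstStep) (c k : ℕ)
    (T : Fin n → ℕ) (P : Fin m → ℕ) (N : ℕ) :
    (algorithm3 a c k T P N).Holds fun o => ∀ out, o = some out → out.Correct k T P := by
  refine (Rand.holds_lift (Q := fun t => t = (encodeText T P).val) rfl).bind ?_
  rintro _ rfl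
  refine (Rand.holds_lift (Q := fun p => p = (encodePattern P).val) rfl).bind ?_
  rintro _ rfl
  exact rounds_correct hm hmn a c k T P N

/-! ### Random subsets of fixed size -/

theorem ev_draw {m s : ℕ} (hs : s ≤ m) (f : Finset ℕ → ℝ≥0∞) :
    (draw m s).ev f = (∑ S ∈ powersetCard s (range m), f S) * (m.choose s : ℝ≥0∞)⁻¹ := by
  have hne : (powersetCard (min s m) (range m)).Nonempty := powersetCard_nonempty.2 (by simp)
  have h1 : (draw m s).ev f = ∑' y : Timed (Finset ℕ),
      (PMF.map (fun S => (⟨S, 5 * m + 1⟩ : Timed (Finset ℕ)))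
        (PMF.uniformOfFinset (powersetCard (min s m) (range m)) hne)) y * f y.val := rfl
  have h2 : (draw m s).ev f = ∑' S : Finset ℕ,
      (PMF.uniformOfFinset (powersetCard (min s m) (range m)) hne) S * f S := by
    rw [h1]
    simp only [PMF.map_apply, ← ENNReal.tsum_mul_right]
    rw [ENNReal.tsum_comm]
    refine tsum_congr fun S => ?_
    rw [tsum_eq_single (⟨S, 5 * m + 1⟩ : Timed (Finset ℕ))]
    · simp
    · intro y hy; simp [hy]
  rw [h2, tsum_eq_sum (s := powersetCard s (range m)), sum_mul]
  · refine sum_congr rfl fun S hS => ?_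
    simp only [PMF.uniformOfFinset_apply, min_eq_left hs, hS, if_true, card_powersetCard,
      card_range]
    rw [mul_comm]
  · intro S hS
    simp [PMF.uniformOfFinset_apply, min_eq_left hs, hS]

theorem fail_draw_le {m s : ℕ} (hs : s ≤ m) (Q : Finset ℕ → Prop) [DecidablePred Q] {x : ℝ}
    (hx : x * m.choose s ≤ ((powersetCard s (range m)).filter Q).card) :
    (draw m s).fail Q ≤ ENNReal.ofReal (1 - x) := by
  have hpos : (0 : ℝ) < m.choose s := by exact_mod_cast Nat.choose_pos hs
  have hsum : (draw m s).fail Q =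
      (((powersetCard s (range m)).filter fun S => ¬ Q S).card : ℝ≥0∞) *
        (m.choose s : ℝ≥0∞)⁻¹ := by
    rw [Rand.fail, ev_draw hs, card_filter]
    push_cast
    congr 1
    refine sum_congr rfl fun S _ => ?_
    by_cases h : Q S <;> simp [h]
  have hcard : ((powersetCard s (range m)).filter Q).card +
      ((powersetCard s (range m)).filter fun S => ¬ Q S).card = m.choose s := by
    rw [card_filter_add_card_filter_not, card_powersetCard, card_range]
  rw [hsum, ← ENNReal.ofReal_natCast, ← ENNReal.ofReal_natCast (m.choose s),
    ← ENNReal.ofReal_inv_of_pos hpos, ← ENNReal.ofReal_mul (by positivity)]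
  refine ENNReal.ofReal_le_ofReal ?_
  rw [← div_eq_mul_inv, div_le_iff₀ hpos]
  have : (((powersetCard s (range m)).filter Q).card : ℝ) +
      ((powersetCard s (range m)).filter fun S => ¬ Q S).card = m.choose s := by
    exact_mod_cast hcard
  linarith

/-- A subset that meets `R` in one element of `A` is that element together with a subset of the
complement of `R`. -/
theorem card_isolating {m s : ℕ} (hs : 1 ≤ s) {R A : Finset ℕ} (hR : R ⊆ range m) (hA : A ⊆ R) :
    A.card * (m - R.card).choose (s - 1) ≤
      ((powersetCard s (range m)).filter fun S => ∃ j ∈ A, R ∩ S = {j}).card := by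
  have hcard : A.card * (m - R.card).choose (s - 1) =
      (A ×ˢ powersetCard (s - 1) (range m \ R)).card := by
    rw [card_product, card_powersetCard, card_sdiff_of_subset hR, card_range]
  have key : ∀ x ∈ A ×ˢ powersetCard (s - 1) (range m \ R),
      x.1 ∈ R ∧ Disjoint R x.2 ∧ x.2 ⊆ range m ∧ x.2.card = s - 1 := by
    intro x hx
    obtain ⟨h1, h2⟩ := mem_product.1 hx
    obtain ⟨h3, h4⟩ := mem_powersetCard.1 h2
    exact ⟨hA h1, disjoint_left.2 fun j hj hj' => (mem_sdiff.1 (h3 hj')).2 hj,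
      h3.trans sdiff_subset, h4⟩
  have hinter : ∀ x ∈ A ×ˢ powersetCard (s - 1) (range m \ R), R ∩ insert x.1 x.2 = {x.1} := by
    intro x hx
    obtain ⟨h1, h2, h3, h4⟩ := key x hx
    rw [inter_insert_of_mem h1, disjoint_iff_inter_eq_empty.1 h2]
    simp
  rw [hcard]
  refine card_le_card_of_injOn (fun x => insert x.1 x.2) ?_ ?_
  · intro x hx
    have hx := mem_coe.1 hx
    obtain ⟨h1, h2, h3, h4⟩ := key x hx
    refine mem_coe.2 (mem_filter.2 ⟨mem_powersetCard.2 ⟨insert_subset (hR h1) h3, ?_⟩,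
      x.1, (mem_product.1 hx).1, hinter x hx⟩)
    rw [card_insert_of_notMem fun h => disjoint_left.1 h2 h1 h, h4]
    omega
  · intro x hx y hy hxy
    have hx := mem_coe.1 hx
    have hy := mem_coe.1 hy
    simp only at hxy
    have h1 : x.1 = y.1 := by
      have := hinter x hx
      rw [hxy, hinter y hy] at this
      exact (singleton_injective this).symm
    refine Prod.ext h1 ?_
    have e : ∀ z ∈ A ×ˢ powersetCard (s - 1) (range m \ R), insert z.1 z.2 \ R = z.2 := by
      intro z hz
      obtain ⟨h1, h2, -, -⟩ := key z hz
      rw [insert_sdiff_of_mem _ h1, sdiff_eq_self_of_disjoint h2.symm]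
    rw [← e x hx, ← e y hy, hxy]

/-- Avoiding `r - 1` given elements costs at most a constant factor when `s r = O(m)`. -/
theorem choose_sub_ge {m r s : ℕ} (hr : 1 ≤ r) (hrm : r ≤ m) (hs : 1 ≤ s)
    (h1 : 2 ≤ r → 4 * (s - 1) ≤ 3 * (m + 1 - r)) (h2 : (s - 1) * (r - 1) ≤ 4 * (m + 1 - r)) :
    (s / m * Real.exp (-16)) * m.choose s ≤ ((m - r).choose (s - 1) : ℝ) := by
  obtain ⟨u, rfl⟩ : ∃ u, s = u + 1 := ⟨s - 1, by omega⟩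
  obtain ⟨q, rfl⟩ : ∃ q, r = q + 1 := ⟨r - 1, by omega⟩
  obtain ⟨M, rfl⟩ : ∃ M, m = M + 1 := ⟨m - 1, by omega⟩
  have hqM : q ≤ M := by omega
  have e1 : M + 1 - (q + 1) = M - q := by omega
  have e2 : M + 1 + 1 - (q + 1) = M + 1 - q := by omega
  simp only [Nat.add_sub_cancel, e1, e2] at h1 h2 ⊢
  have habs : ((u + 1 : ℕ) : ℝ) / ((M + 1 : ℕ) : ℝ) * ((M + 1).choose (u + 1) : ℝ) =
      (M.choose u : ℝ) := by
    have : ((M : ℝ) + 1) * (M.choose u : ℝ) = ((M + 1).choose (u + 1) : ℝ) * (u + 1) := by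
      exact_mod_cast Nat.add_one_mul_choose_eq M u
    have hM : ((M : ℝ) + 1) ≠ 0 := by positivity
    push_cast
    field_simp
    linarith
  rcases Nat.eq_zero_or_pos q with rfl | hq
  · rw [mul_right_comm, habs, Nat.sub_zero]
    exact mul_le_of_le_one_right (by positivity) (Real.exp_le_one_iff.2 (by norm_num))
  have h1 := h1 (by omega)
  have hD : (0 : ℝ) < M + 1 - q := by
    have : (q : ℝ) ≤ M := by exact_mod_cast hqM
    linarith
  have hcast : ((M + 1 - q : ℕ) : ℝ) = M + 1 - q := by
    rw [Nat.cast_sub (by omega)]; push_cast; ring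
  have h1' : 4 * (u : ℝ) ≤ 3 * (M + 1 - q) := by rw [← hcast]; exact_mod_cast h1
  have h2' : (u : ℝ) * q ≤ 4 * (M + 1 - q) := by rw [← hcast]; exact_mod_cast h2
  set x : ℝ := u / (M + 1 - q) with hx
  have hx0 : 0 ≤ x := by positivity
  have hx1 : x ≤ 3 / 4 := by rw [hx, div_le_iff₀ hD]; linarith
  have hx2 : x * q ≤ 4 := by rw [hx, div_mul_eq_mul_div, div_le_iff₀ hD]; exact h2'
  have hstep : ∀ i ≤ q, (1 - x) ^ i * (M.choose u : ℝ) ≤ ((M - i).choose u : ℝ) := by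
    intro i hi
    induction i with
    | zero => simp
    | succ i ih =>
      have ih := ih (by omega)
      obtain ⟨K, hK⟩ : ∃ K, M - i = K + 1 := ⟨M - i - 1, by omega⟩
      rw [hK] at ih
      have hK' : M - (i + 1) = K := by omega
      rw [hK']
      have hKR : (K : ℝ) + 1 = M - i := by
        have : (M : ℝ) = K + 1 + i := by exact_mod_cast (by omega : M = K + 1 + i)
        rw [this]; ring
      have hDK : (M : ℝ) + 1 - q ≤ K + 1 := by
        have : (i : ℝ) + 1 ≤ q := by exact_mod_cast hi
        rw [hKR]; linarith
      have huK : (u : ℝ) ≤ x * (K + 1) := by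
        calc (u : ℝ) = x * (M + 1 - q) := by rw [hx, div_mul_cancel₀ _ hD.ne']
          _ ≤ x * (K + 1) := by gcongr
      have hsucc : ((K.choose u : ℕ) : ℝ) * (K + 1) =
          ((K + 1).choose u : ℝ) * ((K + 1 - u : ℕ) : ℝ) := by
        exact_mod_cast Nat.choose_mul_succ_eq K u
      have hsub : (K : ℝ) + 1 - u ≤ ((K + 1 - u : ℕ) : ℝ) := by
        rcases le_total u (K + 1) with h | h
        · rw [Nat.cast_sub h]; push_cast; exact le_rfl
        · have : ((K : ℝ) + 1) ≤ u := by exact_mod_cast h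
          have h' : (0 : ℝ) ≤ ((K + 1 - u : ℕ) : ℝ) := by positivity
          linarith
      have hKpos : (0 : ℝ) < K + 1 := by positivity
      refine le_of_mul_le_mul_right ?_ hKpos
      calc (1 - x) ^ (i + 1) * (M.choose u : ℝ) * (K + 1)
          = ((1 - x) ^ i * (M.choose u : ℝ)) * ((1 - x) * (K + 1)) := by ring
        _ ≤ ((K + 1).choose u : ℝ) * ((1 - x) * (K + 1)) := by
            gcongr
            exact mul_nonneg (by linarith) hKpos.le
        _ ≤ ((K + 1).choose u : ℝ) * ((K + 1 - u : ℕ) : ℝ) := by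
            gcongr
            nlinarith
        _ = _ := hsucc.symm
  have hexp : Real.exp (-16) ≤ (1 - x) ^ q := by
    have h3 : Real.exp (-(4 * x)) ≤ 1 - x := by
      have h4 : 1 + 4 * x ≤ Real.exp (4 * x) := by linarith [Real.add_one_le_exp (4 * x)]
      rw [Real.exp_neg, inv_le_iff_one_le_mul₀ (Real.exp_pos _)]
      nlinarith
    calc Real.exp (-16) ≤ Real.exp (q * (-(4 * x))) := by
          apply Real.exp_le_exp.2; nlinarith
      _ = Real.exp (-(4 * x)) ^ q := by rw [Real.exp_nat_mul]
      _ ≤ (1 - x) ^ q := by gcongr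
  calc ((u + 1 : ℕ) : ℝ) / ((M + 1 : ℕ) : ℝ) * Real.exp (-16) * ((M + 1).choose (u + 1) : ℝ)
      = Real.exp (-16) * (((u + 1 : ℕ) : ℝ) / ((M + 1 : ℕ) : ℝ) *
          ((M + 1).choose (u + 1) : ℝ)) := by
        ring
    _ = Real.exp (-16) * (M.choose u : ℝ) := by rw [habs]
    _ ≤ (1 - x) ^ q * (M.choose u : ℝ) := by gcongr
    _ ≤ _ := hstep q le_rfl

/-- A random sample isolates one of the elements of `A` among those of `R` with probability at
least `|A| (s / m) e⁻¹⁶`, provided that `s |R| = O(m)`. -/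
theorem fail_draw_isolate_le {m s : ℕ} (hs : 1 ≤ s) (hsm : s ≤ m) {R A : Finset ℕ}
    (hR : R ⊆ range m) (hA : A ⊆ R) (hR1 : 1 ≤ R.card)
    (h1 : 2 ≤ R.card → 4 * (s - 1) ≤ 3 * (m + 1 - R.card))
    (h2 : (s - 1) * (R.card - 1) ≤ 4 * (m + 1 - R.card)) :
    (draw m s).fail (fun S => ∃ j ∈ A, R ∩ S = {j}) ≤
      ENNReal.ofReal (1 - A.card * (s / m * Real.exp (-16))) := by
  classical
  refine fail_draw_le hsm _ ?_
  have hRm : R.card ≤ m := by simpa using card_le_card hR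
  have h3 := choose_sub_ge hR1 hRm hs h1 h2
  have h4 : ((A.card * (m - R.card).choose (s - 1) : ℕ) : ℝ) ≤ _ :=
    Nat.cast_le.2 (card_isolating hs hR hA)
  refine le_trans ?_ h4
  push_cast
  rw [mul_assoc]
  gcongr

/-- A random subset of size `s` contains `B` with probability at most `(s / m) ^ |B|`. -/
theorem card_superset_le {m s : ℕ} {B : Finset ℕ} (hB : B ⊆ range m) :
    ((powersetCard s (range m)).filter fun S => B ⊆ S).card * m ^ B.card ≤
      s ^ B.card * m.choose s := by
  rcases lt_or_ge s B.card with hlt | hle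
  · have : (powersetCard s (range m)).filter (fun S => B ⊆ S) = ∅ := by
      refine filter_eq_empty_iff.2 fun S hS hBS => ?_
      have := card_le_card hBS
      rw [(mem_powersetCard.1 hS).2] at this
      omega
    simp [this]
  have hcount : ((powersetCard s (range m)).filter fun S => B ⊆ S).card ≤
      (m - B.card).choose (s - B.card) := by
    have : (m - B.card).choose (s - B.card) =
        (powersetCard (s - B.card) (range m \ B)).card := by
      rw [card_powersetCard, card_sdiff_of_subset hB, card_range]
    rw [this]
    refine card_le_card_of_injOn (fun S => S \ B) ?_ ?_
    · intro S hS
      obtain ⟨h1, h2⟩ := mem_filter.1 (mem_coe.1 hS)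
      obtain ⟨h3, h4⟩ := mem_powersetCard.1 h1
      refine mem_coe.2 (mem_powersetCard.2 ⟨sdiff_subset_sdiff h3 Subset.rfl, ?_⟩)
      rw [card_sdiff_of_subset h2, h4]
    · intro S hS S' hS' h
      have h2 := (mem_filter.1 (mem_coe.1 hS)).2
      have h2' := (mem_filter.1 (mem_coe.1 hS')).2
      simp only at h
      rw [← sdiff_union_of_subset h2, ← sdiff_union_of_subset h2', h]
  have hch : ∀ b m s : ℕ, b ≤ s → s ≤ m → (m - b).choose (s - b) * m ^ b ≤ s ^ b * m.choose s := by
    intro b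
    induction b with
    | zero => intro m s _ _; simp
    | succ b ih =>
      intro m s hbs hsm
      obtain ⟨s, rfl⟩ : ∃ u, s = u + 1 := ⟨s - 1, by omega⟩
      obtain ⟨m, rfl⟩ : ∃ u, m = u + 1 := ⟨m - 1, by omega⟩
      have ih := ih m s (by omega) (by omega)
      have hsm' : s ≤ m := by omega
      rw [Nat.add_sub_add_right, Nat.add_sub_add_right]
      rcases Nat.eq_zero_or_pos m with hm | hm
      · obtain rfl : s = 0 := by omega
        obtain rfl : b = 0 := by omega
        subst hm
        simp
      refine Nat.le_of_mul_le_mul_right ?_ (pow_pos hm b)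
      -- `s / m ≤ (s + 1) / (m + 1)`
      have hfrac : s * (m + 1) ≤ (s + 1) * m := by nlinarith
      calc (m - b).choose (s - b) * (m + 1) ^ (b + 1) * m ^ b
          = ((m - b).choose (s - b) * m ^ b) * (m + 1) ^ (b + 1) := by ring
        _ ≤ (s ^ b * m.choose s) * (m + 1) ^ (b + 1) := by gcongr
        _ = (s * (m + 1)) ^ b * ((m + 1) * m.choose s) := by rw [mul_pow, pow_succ]; ring
        _ ≤ ((s + 1) * m) ^ b * ((m + 1) * m.choose s) := by gcongr
        _ = ((s + 1) * m) ^ b * ((m + 1).choose (s + 1) * (s + 1)) := by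
            rw [Nat.add_one_mul_choose_eq]
        _ = (s + 1) ^ (b + 1) * (m + 1).choose (s + 1) * m ^ b := by rw [mul_pow, pow_succ]; ring
  rcases lt_or_ge m s with hms | hsm
  · have : powersetCard s (range m) = ∅ := powersetCard_eq_empty.2 (by simpa using hms)
    simp [this]
  · exact (Nat.mul_le_mul_right _ hcount).trans (hch _ _ _ hle hsm)

/-- The exponential moment of the size of the intersection of a sample with a given set. -/
theorem ev_draw_two_pow_le {m s : ℕ} (hm : 1 ≤ m) (hsm : s ≤ m) {A : Finset ℕ}
    (hA : A ⊆ range m) :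
    ((draw m s).ev fun S => 2 ^ (A ∩ S).card) ≤ ENNReal.ofReal ((1 + s / m) ^ A.card) := by
  classical
  have hpos : (0 : ℝ) < m.choose s := by exact_mod_cast Nat.choose_pos hsm
  have hmpos : (0 : ℝ) < m := by exact_mod_cast hm
  have h1 : ∑ S ∈ powersetCard s (range m), 2 ^ (A ∩ S).card =
      ∑ B ∈ A.powerset, ((powersetCard s (range m)).filter fun S => B ⊆ S).card := by
    simp only [card_filter]
    rw [sum_comm]
    refine sum_congr rfl fun S _ => ?_
    rw [← card_filter, ← card_powerset]
    congr 1
    ext B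
    simp only [mem_powerset, mem_filter, subset_inter_iff]
  have h2 : ((∑ S ∈ powersetCard s (range m), 2 ^ (A ∩ S).card : ℕ) : ℝ) ≤
      (1 + s / m) ^ A.card * m.choose s := by
    rw [h1, add_comm (1 : ℝ), ← sum_pow_mul_eq_add_pow, sum_mul]
    push_cast
    refine sum_le_sum fun B hB => ?_
    have := card_superset_le (s := s) ((mem_powerset.1 hB).trans hA)
    have : (((powersetCard s (range m)).filter fun S => B ⊆ S).card : ℝ) * m ^ B.card ≤
      s ^ B.card * m.choose s := by exact_mod_cast this
    rw [one_pow, mul_one, div_pow, div_mul_eq_mul_div, le_div_iff₀ (by positivity)]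
    exact this
  rw [ev_draw hsm]
  have h3 : ∑ S ∈ powersetCard s (range m), (2 : ℝ≥0∞) ^ (A ∩ S).card =
      ENNReal.ofReal ((∑ S ∈ powersetCard s (range m), 2 ^ (A ∩ S).card : ℕ) : ℝ) := by
    rw [ENNReal.ofReal_natCast]; push_cast; rfl
  rw [h3, ← ENNReal.ofReal_natCast (m.choose s), ← ENNReal.ofReal_inv_of_pos hpos,
    ← ENNReal.ofReal_mul (by positivity), ← div_eq_mul_inv]
  exact ENNReal.ofReal_le_ofReal ((div_le_iff₀ hpos).2 h2)

/-! ### The potential of a growing set -/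

/-- The potential of a set of `x` elements that is meant to grow to `g` elements: it halves with
every new element, and vanishes at the goal. -/
def potential (g x : ℕ) : ℝ≥0∞ := if x < g then 2 ^ (g - x) else 0

theorem potential_le_two_pow (g x : ℕ) : potential g x ≤ 2 ^ g := by
  unfold potential
  split_ifs
  · exact pow_le_pow_right₀ one_le_two (Nat.sub_le _ _)
  · exact zero_le

theorem one_le_potential {g x : ℕ} (h : x < g) : 1 ≤ potential g x := by
  rw [potential, if_pos h]
  exact one_le_pow₀ one_le_two

theorem potential_anti {g x y : ℕ} (h : x ≤ y) : potential g y ≤ potential g x := by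
  unfold potential
  split_ifs with h1 h2
  · exact pow_le_pow_right₀ one_le_two (by omega)
  · omega
  · exact zero_le
  · exact le_rfl

theorem two_mul_potential_le {g x y : ℕ} (h : x < y) : 2 * potential g y ≤ potential g x := by
  unfold potential
  split_ifs with h1 h2
  · rw [← pow_succ']
    exact pow_le_pow_right₀ one_le_two (by omega)
  · omega
  · simp
  · simp

/-- If the set never shrinks and grows with probability at least `p`, then its expected potential
goes down by the factor `1 - p / 2`. -/
theorem ev_potential_le {α : Type} {x : Rand α} {f : α → ℕ} {g y : ℕ} {Q : α → Prop} {p : ℝ}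
    (hmono : x.Holds fun a => y ≤ f a) (hp : p ≤ 1)
    (hQ : y < g → x.fail Q ≤ ENNReal.ofReal (1 - p)) (hgrow : x.Holds fun a => Q a → y < f a) :
    (x.ev fun a => potential g (f a)) ≤ ENNReal.ofReal (1 - p / 2) * potential g y := by
  classical
  rcases lt_or_ge y g with hy | hy
  · have h2 : ∀ a, y ≤ f a ∧ (Q a → y < f a) →
        potential g (f a) ≤ (potential g y / 2) * (1 + if Q a then 0 else 1) := by
      intro a ha
      split_ifs with hq
      · rw [add_zero, mul_one, ENNReal.le_div_iff_mul_le (by simp) (by simp), mul_comm]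
        exact two_mul_potential_le (ha.2 hq)
      · rw [one_add_one_eq_two, ENNReal.div_mul_cancel (by simp) (by simp)]
        exact potential_anti ha.1
    have hboth : x.Holds fun a => y ≤ f a ∧ (Q a → y < f a) :=
      fun z hz => ⟨hmono z hz, hgrow z hz⟩
    refine (Rand.ev_mono_of_holds hboth h2).trans ?_
    rw [Rand.ev_const_mul, Rand.ev_add, Rand.ev_const]
    have h3 : 1 + (x.ev fun a => if Q a then (0 : ℝ≥0∞) else 1) ≤
        2 * ENNReal.ofReal (1 - p / 2) := by
      calc _ ≤ 1 + ENNReal.ofReal (1 - p) := by gcongr; exact hQ hy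
        _ = ENNReal.ofReal (1 + (1 - p)) := by
          rw [ENNReal.ofReal_add zero_le_one (by linarith), ENNReal.ofReal_one]
        _ = 2 * ENNReal.ofReal (1 - p / 2) := by
          rw [← ENNReal.ofReal_ofNat, ← ENNReal.ofReal_mul (by norm_num)]
          congr 1; ring
    calc potential g y / 2 * (1 + x.ev fun a => if Q a then (0 : ℝ≥0∞) else 1)
        ≤ potential g y / 2 * (2 * ENNReal.ofReal (1 - p / 2)) := by gcongr
      _ = potential g y / 2 * 2 * ENNReal.ofReal (1 - p / 2) := by ring
      _ = _ := by rw [ENNReal.div_mul_cancel (by simp) (by simp), mul_comm]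
  · have h0 : ∀ z, y ≤ z → potential g z = 0 := fun z hz => if_neg (by omega)
    refine (Rand.ev_mono_of_holds (g := fun _ => 0) hmono fun a ha => (h0 _ ha).le).trans ?_
    simp

/-! ### Numerical estimates -/

/-- The relative decrease of the expected potential per sample. It is half the lower bound
`e⁻¹⁶ / 8` for the probability that a sample isolates an unknown mismatch: a factor `1 / 4` for the
size of the sample and the number of unknown mismatches, a further `1 / 2` in the phases. -/
def rate : ℝ := Real.exp (-16) / 16

theorem rate_pos : 0 < rate := by unfold rate; positivity

theorem rate_le : rate ≤ 1 := by
  have : Real.exp (-16) ≤ 1 := Real.exp_le_one_iff.2 (by norm_num)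
  unfold rate; linarith

theorem one_sub_pow_le {x : ℝ} (hx : x ≤ 1) (N : ℕ) : (1 - x) ^ N ≤ Real.exp (-(N * x)) := by
  calc (1 - x) ^ N ≤ Real.exp (-x) ^ N :=
        pow_le_pow_left₀ (by linarith) (by linarith [Real.add_one_le_exp (-x)]) N
    _ = Real.exp (-(N * x)) := by rw [← Real.exp_nat_mul]; ring_nf

/-- The failure probability of a single event in the analysis, a negative power of `n`. -/
def tiny (n : ℕ) : ℝ≥0∞ := ENNReal.ofReal (Real.exp (-(4 * Nat.clog 2 n : ℕ)))

/-- Enough steps bring the potential down from `2 ^ g`, with `g = O(K)`, to a negative power of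
`n`. -/
theorem two_pow_mul_le_tiny {n c K g N : ℕ} (hc : 8 ≤ c * rate) (hg : g ≤ 4 * K)
    (hN : c * max K (Nat.clog 2 n) ≤ N) :
    ENNReal.ofReal (1 - rate) ^ N * 2 ^ g ≤ tiny n := by
  have h2 : (2 : ℝ≥0∞) ^ g = ENNReal.ofReal (2 ^ g) := by
    rw [ENNReal.ofReal_pow (by norm_num), ENNReal.ofReal_ofNat]
  rw [h2, ← ENNReal.ofReal_pow (by linarith [rate_le]),
    ← ENNReal.ofReal_mul (pow_nonneg (by linarith [rate_le]) _)]
  refine ENNReal.ofReal_le_ofReal ?_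
  set Λ := Nat.clog 2 n
  have h3 : (2 : ℝ) ^ g ≤ Real.exp (4 * K) := by
    calc (2 : ℝ) ^ g ≤ Real.exp 1 ^ g := by
          gcongr; linarith [Real.add_one_le_exp (1 : ℝ)]
      _ = Real.exp g := by rw [← Real.exp_nat_mul, mul_one]
      _ ≤ Real.exp (4 * K) := Real.exp_le_exp.2 (by exact_mod_cast hg)
  have h4 : (4 * K + 4 * Λ : ℝ) ≤ N * rate := by
    obtain ⟨x, hx⟩ : ∃ x, max K Λ = x := ⟨_, rfl⟩
    rw [hx] at hN
    have h5 : (c : ℝ) * x ≤ N := by exact_mod_cast hN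
    have h6 : (K : ℝ) ≤ x := by exact_mod_cast hx ▸ le_max_left K Λ
    have h7 : (Λ : ℝ) ≤ x := by exact_mod_cast hx ▸ le_max_right K Λ
    calc (4 * K + 4 * Λ : ℝ) ≤ 8 * x := by linarith
      _ ≤ (c * rate) * x := by gcongr
      _ = (c * x) * rate := by ring
      _ ≤ N * rate := by gcongr; exact rate_pos.le
  calc (1 - rate) ^ N * (2 : ℝ) ^ g ≤ Real.exp (-(N * rate)) * Real.exp (4 * K) :=
        mul_le_mul (one_sub_pow_le rate_le N) h3 (by positivity) (by positivity)
    _ = Real.exp (-(N * rate) + 4 * K) := (Real.exp_add _ _).symm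
    _ ≤ _ := Real.exp_le_exp.2 (by push_cast; linarith)

/-! ### Sampling with an expected constant number of mismatches -/

/-- The conditions under which a sample of `s` positions isolates each given one of `r` mismatches
with probability `Ω (s / m)`. -/
structure GoodSize (m s r : ℕ) : Prop where
  one_le : 1 ≤ s
  le : s ≤ m
  sparse : 2 ≤ r → 4 * (s - 1) ≤ 3 * (m + 1 - r)
  balanced : (s - 1) * (r - 1) ≤ 4 * (m + 1 - r)

/-- For fewer than `2 κ` mismatches, samples of `m / κ` positions have a good size. -/
theorem goodSize_div {m κ r : ℕ} (hκ : 1 ≤ κ) (hr : r ≤ 2 * κ - 1) (hm : 4 * κ ≤ m) :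
    GoodSize m (m / κ) r := by
  have h1 : m / κ * κ ≤ m := Nat.div_mul_le_self m κ
  obtain ⟨x, hx⟩ : ∃ x, m + 1 - r = x := ⟨_, rfl⟩
  refine ⟨(Nat.one_le_div_iff (by omega)).2 (by omega), Nat.div_le_self _ _, fun h => ?_, ?_⟩
  · rw [hx]
    rcases Nat.lt_or_ge κ 3 with h3 | h3
    · obtain rfl : κ = 2 := by omega
      omega
    · have : m / κ * 3 ≤ m := (Nat.mul_le_mul_left _ h3).trans h1
      omega
  · rw [hx]
    calc (m / κ - 1) * (r - 1) ≤ m / κ * (2 * κ) := Nat.mul_le_mul (Nat.sub_le _ _) (by omega)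
      _ = 2 * (m / κ * κ) := by ring
      _ ≤ 4 * x := by omega

theorem one_div_le_div {m κ : ℕ} (hκ : 1 ≤ κ) (hm : κ ≤ m) :
    1 / (2 * κ : ℝ) ≤ ((m / κ : ℕ) : ℝ) / m := by
  have h1 : m < κ * (m / κ + 1) := Nat.lt_mul_div_succ m (by omega)
  have h2 : 1 ≤ m / κ := (Nat.one_le_div_iff (by omega)).2 hm
  have h3 : m ≤ 2 * κ * (m / κ) := by nlinarith
  have h4 : (m : ℝ) ≤ 2 * κ * (m / κ : ℕ) := by exact_mod_cast h3
  have hκ' : (0 : ℝ) < κ := by exact_mod_cast hκ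
  have hm' : (0 : ℝ) < m := by exact_mod_cast (by omega : 0 < m)
  rw [div_le_div_iff₀ (by positivity) hm']
  linarith

theorem fail_draw_le_of_goodSize {m s : ℕ} {R A : Finset ℕ} {x : ℝ} (h : GoodSize m s R.card)
    (hR : R ⊆ range m) (hA : A ⊆ R) (hR1 : 1 ≤ R.card)
    (hx : x ≤ A.card * (s / m * Real.exp (-16))) :
    (draw m s).fail (fun S => ∃ j ∈ A, R ∩ S = {j}) ≤ ENNReal.ofReal (1 - x) :=
  (fail_draw_isolate_le h.one_le h.le hR hA hR1 h.sparse h.balanced).trans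
    (ENNReal.ofReal_le_ofReal (by linarith))

/-! ### Algorithm 1 finds all of fewer than `2 k` mismatches -/

section FirstStep

variable {n m : ℕ} {t p : ℕ → ℤ}

theorem samplingStep_fail_mem (hm : 1 ≤ m) (hmn : m ≤ n) {s i j : ℕ} (hi : i < n - m + 1)
    (hj : j ∈ errPositions m t p i) (h : GoodSize m s (errPositions m t p i).card)
    (st : ℕ → Loc) :
    (samplingStep n m s t p st).fail (fun st' => j ∈ (st' i).L) ≤
      ENNReal.ofReal (1 - s / m * Real.exp (-16)) := by
  classical
  rw [samplingStep_eq, Rand.fail_bind]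
  refine le_trans (Rand.ev_mono fun S => ?_) (fail_draw_le_of_goodSize (A := {j}) h
    (errPositions_subset m t p i) (by simpa using hj) (card_pos.2 ⟨j, hj⟩)
    (x := s / m * Real.exp (-16)) (by simp))
  rw [Rand.fail_lift]
  by_cases hS : errPositions m t p i ∩ S = {j}
  · rw [sampleWith_single hm hmn t p st hi hS]
    simp
  · simp only [mem_singleton, exists_eq_left, hS, if_false]
    split_ifs <;> simp

theorem algorithm1_fail (hm : 1 ≤ m) (hmn : m ≤ n) {c k i : ℕ} (hc : 8 ≤ c * rate) (hk : 1 ≤ k)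
    (hkm : 4 * k ≤ m) (hi : i < n - m + 1) (hq : (errPositions m t p i).card ≤ 2 * k - 1) :
    (algorithm1 c n m k t p).fail (fun st => Done m k t p i (st i)) ≤ n * tiny n := by
  classical
  have hgood := goodSize_div hk hq hkm
  set s := m / k with hs
  set N := c * k * Nat.clog 2 n with hN
  have hone : ∀ j ∈ errPositions m t p i, ∀ st : ℕ → Loc,
      (loopR (fun _ st => samplingStep n m s t p st) N 0 st).fail (fun st' => j ∈ (st' i).L) ≤
        tiny n := by
    intro j hj st
    have hstep : ∀ st : ℕ → Loc, ((samplingStep n m s t p st).ev fun st' =>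
        if j ∈ (st' i).L then (0 : ℝ≥0∞) else 1) ≤
        ENNReal.ofReal (1 - s / m * Real.exp (-16)) * (if j ∈ (st i).L then (0 : ℝ≥0∞) else 1) := by
      intro st
      by_cases hjst : j ∈ (st i).L
      · refine (Rand.ev_mono_of_holds (g := fun _ => 0) (samplingStep_holds n m s t p st)
          fun st' h => ?_).trans (by simp)
        simp [(h i hi).2 hjst]
      · rw [if_neg hjst, mul_one]
        have := samplingStep_fail_mem hm hmn hi hj hgood st
        unfold Rand.fail at this
        convert this
    have hloop := Rand.ev_loopR_le (I := fun _ => True) (fun _ st _ => Rand.holds_true _)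
      (fun _ st _ => hstep st) N 0 (a := st) trivial
    have hpow : ENNReal.ofReal (1 - s / m * Real.exp (-16)) ^ N ≤ tiny n := by
      have hx : 1 / (2 * k : ℝ) ≤ s / m := one_div_le_div hk (by omega)
      have hkpos : (0 : ℝ) < k := by exact_mod_cast hk
      have hsm : (s : ℝ) / m ≤ 1 := div_le_one_of_le₀ (by exact_mod_cast hgood.le) (by positivity)
      have he : Real.exp (-16) ≤ 1 := Real.exp_le_one_iff.2 (by norm_num)
      have hle : s / m * Real.exp (-16) ≤ 1 := mul_le_one₀ hsm (by positivity) he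
      rw [← ENNReal.ofReal_pow (by linarith)]
      refine ENNReal.ofReal_le_ofReal ((one_sub_pow_le hle N).trans (Real.exp_le_exp.2 ?_))
      have h1 : (4 * Nat.clog 2 n : ℝ) ≤ N * (1 / (2 * k) * Real.exp (-16)) := by
        have : (N : ℝ) * (1 / (2 * k) * Real.exp (-16)) = 8 * (c * rate) * Nat.clog 2 n := by
          rw [hN, rate]; push_cast; field_simp; ring
        rw [this]
        have : (0 : ℝ) ≤ Nat.clog 2 n := Nat.cast_nonneg _
        nlinarith
      have h2 : (N : ℝ) * (1 / (2 * k) * Real.exp (-16)) ≤ N * (s / m * Real.exp (-16)) := by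
        gcongr
      push_cast
      linarith
    refine le_trans ?_ hpow
    refine le_trans ?_ (hloop.trans (mul_le_of_le_one_right zero_le (by split_ifs <;> simp)))
    unfold Rand.fail
    exact le_of_eq (by congr!)
  have hall : ∀ st : ℕ → Loc, (loopR (fun _ st => samplingStep n m s t p st) N 0 st).fail
      (fun st' => Done m k t p i (st' i)) ≤ n * tiny n := by
    intro st
    refine (Rand.fail_mono_of_holds (I := fun _ => True) (Rand.holds_true _)
      (Q' := fun st' => Done m k t p i (st' i))
      (Q := fun st' : ℕ → Loc => ∀ j ∈ errPositions m t p i, j ∈ (st' i).L)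
      fun st' _ h => Or.inr h).trans ?_
    refine (Rand.fail_forall_le _ _ _).trans ?_
    refine (Finset.sum_le_card_nsmul _ _ _ fun j hj => hone j hj st).trans ?_
    rw [nsmul_eq_mul]
    gcongr
    omega
  change (Rand.lift (start n m t p) >>= _).fail _ ≤ _
  rw [Rand.fail_bind, Rand.ev_lift]
  exact hall _

/-! ### The second step settles the alignments with at least `2 k` mismatches -/

/-- `2 * rate` is a lower bound for the probability that a sample isolates one of the unknown
mismatches, as long as fewer than `g` are known. -/
theorem samplingStep_potential (hm : 1 ≤ m) (hmn : m ≤ n) {s i g : ℕ} (hi : i < n - m + 1)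
    (h : GoodSize m s (errPositions m t p i).card) {st : ℕ → Loc}
    (hst : AllValid n m t p st)
    (hp : ∀ L ⊆ errPositions m t p i, L.card < g →
      2 * rate ≤ (errPositions m t p i \ L).card * (s / m * Real.exp (-16))) :
    ((samplingStep n m s t p st).ev fun st' => potential g (st' i).L.card) ≤
      ENNReal.ofReal (1 - rate) * potential g (st i).L.card := by
  classical
  rw [samplingStep_eq, Rand.ev_bind]
  simp only [Rand.ev_lift]
  set R := errPositions m t p i with hR
  have hrate : 2 * rate ≤ 1 := by
    have : Real.exp (-16) ≤ 1 := Real.exp_le_one_iff.2 (by norm_num)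
    unfold rate; linarith
  have := ev_potential_le (x := draw m s) (f := fun S => ((sampleWith n m t p st S).val i).L.card)
    (g := g) (y := (st i).L.card) (Q := fun S => ∃ j ∈ R \ (st i).L, R ∩ S = {j}) (p := 2 * rate)
    (fun y _ => card_le_card (sampleWith_ext n m t p st y.val i hi).2) hrate ?_ ?_
  · simpa using this
  · intro hg
    have hx := hp (st i).L (hst i hi).1 hg
    refine fail_draw_le_of_goodSize h (errPositions_subset m t p i) sdiff_subset ?_ hx
    by_contra h0
    have h0 : R.card = 0 := by omega
    have : R \ (st i).L = ∅ := by rw [card_eq_zero.1 h0]; simp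
    rw [this] at hx
    simp only [card_empty, Nat.cast_zero, zero_mul] at hx
    linarith [rate_pos]
  · rintro y - ⟨j, hj, hS⟩
    rw [sampleWith_single hm hmn t p st hi hS, card_insert_of_notMem (mem_sdiff.1 hj).2]
    omega

/-- For `q ≥ 2 k` mismatches there is a phase whose sample size fits. -/
theorem exists_phase {k q : ℕ} (hk : 1 ≤ k) (hkm : 4 * k ≤ m) (hq : 2 * k ≤ q) (hqm : q ≤ m) :
    ∃ l, 1 ≤ l ∧ l < 1 + Nat.log 2 (m / (2 * k)) ∧ 2 ^ (l + 1) * k ≤ 2 * q ∧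
      2 ^ (l + 1) * k ≤ m ∧ GoodSize m (m / (2 ^ (l + 1) * k)) q := by
  set w := Nat.log 2 (m / (2 * k)) with hw
  have hdiv : 2 ≤ m / (2 * k) := (Nat.le_div_iff_mul_le (by omega)).2 (by omega)
  have hw1 : 1 ≤ w := Nat.log_pos (by norm_num) hdiv
  have hpw : 2 ^ w * (2 * k) ≤ m :=
    (Nat.le_div_iff_mul_le (by omega)).1 (Nat.pow_log_le_self 2 (by omega))
  set l := Nat.findGreatest (fun l => 2 ^ l * k ≤ q) w with hl
  have hl1 : 1 ≤ l := Nat.le_findGreatest hw1 (by simpa using hq)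
  have hlw : l ≤ w := Nat.findGreatest_le w
  have hlq : 2 ^ l * k ≤ q :=
    Nat.findGreatest_spec (P := fun l => 2 ^ l * k ≤ q) hw1 (by simpa using hq)
  have hle : 2 ^ l ≤ 2 ^ w := Nat.pow_le_pow_right (by norm_num) hlw
  have hκm : 2 ^ (l + 1) * k ≤ m := by
    calc 2 ^ (l + 1) * k = 2 ^ l * (2 * k) := by ring
      _ ≤ 2 ^ w * (2 * k) := by gcongr
      _ ≤ m := hpw
  have hκpos : 0 < 2 ^ (l + 1) * k := by positivity
  have hs1 : 1 ≤ m / (2 ^ (l + 1) * k) := (Nat.one_le_div_iff hκpos).2 hκm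
  have hcase : m / (2 ^ (l + 1) * k) = 1 ∨
      q < 2 ^ (l + 1) * k ∧ 2 * (2 ^ (l + 1) * k) ≤ m ∧ 4 ≤ 2 ^ (l + 1) * k := by
    rcases hlw.eq_or_lt with hlw | hlw
    · -- in the last phase the samples are singletons
      have h1 : m / (2 * k) < 2 ^ (w + 1) := Nat.lt_pow_succ_log_self (by norm_num) _
      have h2 : m / (2 ^ (l + 1) * k) < 2 := by
        rw [Nat.div_lt_iff_lt_mul hκpos]
        have := (Nat.div_lt_iff_lt_mul (by omega)).1 h1
        rw [hlw]; linarith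
      exact Or.inl (by omega)
    · refine Or.inr ⟨?_, ?_, ?_⟩
      · by_contra hcon
        exact Nat.findGreatest_is_greatest (P := fun l => 2 ^ l * k ≤ q) (Nat.lt_succ_self l) hlw
          (not_lt.1 hcon)
      · calc 2 * (2 ^ (l + 1) * k) = 2 ^ (l + 1) * (2 * k) := by ring
          _ ≤ 2 ^ w * (2 * k) := Nat.mul_le_mul_right _ (Nat.pow_le_pow_right (by norm_num) hlw)
          _ ≤ m := hpw
      · calc 4 = 2 ^ (1 + 1) * 1 := by norm_num
          _ ≤ 2 ^ (l + 1) * k :=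
            Nat.mul_le_mul (Nat.pow_le_pow_right (by norm_num) (by omega)) hk
  refine ⟨l, hl1, by omega, by rw [pow_succ]; linarith, hκm, ?_⟩
  generalize 2 ^ (l + 1) * k = κ at *
  have h5 : m / κ * κ ≤ m := Nat.div_mul_le_self m κ
  obtain ⟨x, hx⟩ : ∃ x, m + 1 - q = x := ⟨_, rfl⟩
  refine ⟨hs1, Nat.div_le_self _ _, fun _ => ?_, ?_⟩ <;> rw [hx] <;>
    rcases hcase with h | ⟨h6, h7, h8⟩
  · simp [h]
  · have : m / κ * 4 ≤ m := (Nat.mul_le_mul_left _ h8).trans h5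
    omega
  · simp [h]
  · calc (m / κ - 1) * (q - 1) ≤ m / κ * κ := Nat.mul_le_mul (Nat.sub_le _ _) (by omega)
      _ ≤ 4 * x := by omega

theorem phases_fail (hm : 1 ≤ m) (hmn : m ≤ n) {c k i : ℕ} (hc : 8 ≤ c * rate) (hk : 1 ≤ k)
    (hkm : 4 * k ≤ m) (hi : i < n - m + 1) (hq : 2 * k ≤ (errPositions m t p i).card)
    {st : ℕ → Loc} (hst : AllValid n m t p st) :
    (phases c n m k t p st).fail (fun st => Done m k t p i (st i)) ≤ tiny n := by
  have hqm : (errPositions m t p i).card ≤ m := by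
    simpa using card_le_card (errPositions_subset m t p i)
  obtain ⟨l, hl1, hlw, hκq, hκm, hgood⟩ := exists_phase hk hkm hq hqm
  refine Rand.fail_loopR_of_pass (I := AllValid n m t p) (l := l) ?_ ?_ ?_ _ _ hl1 hlw hst
  · exact fun j st hst => (loopR_ext (fun _ st => samplingStep_holds n m _ t p st) _ _ st).mono
      fun _ h => h.valid hst
  · exact fun j st _ hd => (loopR_ext (fun _ st => samplingStep_holds n m _ t p st) _ _ st).mono
      fun _ h => hd.ext (h i hi)
  intro st hst
  have hκpos : 1 ≤ 2 ^ (l + 1) * k := Nat.mul_pos (by positivity) hk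
  generalize 2 ^ (l + 1) * k = κ at *
  have hloop := Rand.ev_loopR_le (I := AllValid n m t p)
    (body := fun _ st => samplingStep n m (m / κ) t p st)
    (φ := fun st => potential (k + 1) (st i).L.card) (ρ := ENNReal.ofReal (1 - rate))
    (fun _ st hst => (samplingStep_holds n m _ t p st).mono fun _ h => h.valid hst)
    (fun _ st hst => samplingStep_potential hm hmn hi hgood hst fun L hL hLk => ?_)
    (c * max k (Nat.clog 2 n)) 0 hst
  · refine (Rand.fail_le_ev (Rand.holds_true _) fun st' _ hd => ?_).trans (hloop.trans ?_)
    · refine one_le_potential ?_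
      by_contra hcon
      exact hd (Or.inl (by omega))
    · exact (mul_le_mul_right (potential_le_two_pow _ _) _).trans
        (two_pow_mul_le_tiny hc (by omega) le_rfl)
  · -- at least half of the mismatches are still unknown, and `κ / 4` is at most that number
    have h1 : κ ≤ 4 * (errPositions m t p i \ L).card := by
      rw [card_sdiff_of_subset hL]; omega
    have h1' : (κ : ℝ) ≤ 4 * (errPositions m t p i \ L).card := by exact_mod_cast h1
    have h2 := one_div_le_div hκpos hκm
    have hκ' : (0 : ℝ) < κ := by exact_mod_cast hκpos
    calc 2 * rate = (κ / 4) * (1 / (2 * κ) * Real.exp (-16)) := by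
          rw [rate]; field_simp; norm_num
      _ ≤ (errPositions m t p i \ L).card * (((m / κ : ℕ) : ℝ) / m * Real.exp (-16)) := by
          gcongr; linarith

end FirstStep

/-! ### Vectors with one field per sample -/

/-- The digits of a number to the base `B`. -/
theorem sum_pow_mul_ediv_emod {B : ℤ} (F : ℕ) {d : ℕ → ℤ} (hd : ∀ v, 0 ≤ d v ∧ d v < B)
    {r : ℕ} (hr : r < F) : (∑ v ∈ range F, B ^ v * d v) / B ^ r % B = d r := by
  have hB : 0 < B := (hd 0).1.trans_lt (hd 0).2
  have hlow : ∀ r, 0 ≤ ∑ v ∈ range r, B ^ v * d v ∧ ∑ v ∈ range r, B ^ v * d v < B ^ r := by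
    intro r
    induction r with
    | zero => simp
    | succ r ih =>
      rw [sum_range_succ, pow_succ]
      have hpos : 0 < B ^ r := pow_pos hB r
      refine ⟨add_nonneg ih.1 (mul_nonneg hpos.le (hd r).1), ?_⟩
      have : d r ≤ B - 1 := by have := (hd r).2; omega
      nlinarith [ih.2]
  obtain ⟨G, rfl⟩ : ∃ G, F = r + 1 + G := ⟨F - (r + 1), by omega⟩
  have hsplit : ∑ v ∈ range (r + 1 + G), B ^ v * d v =
      ∑ v ∈ range r, B ^ v * d v + B ^ r * (d r + B * ∑ v ∈ range G, B ^ v * d (r + 1 + v)) := by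
    rw [sum_range_add, sum_range_succ, mul_add, mul_sum, mul_sum, add_assoc]
    congr 2
    exact sum_congr rfl fun v _ => by ring
  rw [hsplit, Int.add_mul_ediv_left _ _ (pow_pos hB r).ne',
    Int.ediv_eq_zero_of_lt (hlow r).1 (hlow r).2, zero_add, Int.add_mul_emod_self_left,
    Int.emod_eq_of_lt (hd r).1 (hd r).2]

theorem fieldsPerWord_pos (n m : ℕ) : 0 < fieldsPerWord n m := by
  unfold fieldsPerWord; omega

/-- The rows of the incidence table: one digit to the base `2 ^ fieldBits m` per sample. -/
theorem incidence_val (n m N : ℕ) (Ss : List (Finset ℕ)) {j : ℕ} (hj : j < m) :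
    ((incidence n m N Ss).val j).1 = (fun u => if u < wordCount n m N then
      ∑ v ∈ range (fieldsPerWord n m), if j ∈ Ss.getD (u * fieldsPerWord n m + v) ∅
          then (2 : ℤ) ^ (fieldBits m * v) else 0 else 0) ∧
    ((incidence n m N Ss).val j).2 =
      (range (wordCount n m N)).filter fun u => ((incidence n m N Ss).val j).1 u ≠ 0 := by
  have h : (incidence n m N Ss).val j = _ := val_tab_of_lt _ hj
  rw [h]
  exact ⟨rfl, rfl⟩

/-- A field of a weighted sum of incidence vectors is the weight of the sample in question, as long
as no field overflows. -/
theorem field_incidence {n m N : ℕ} (Ss : List (Finset ℕ)) {L : Finset ℕ} (hL : L ⊆ range m)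
    {g : ℕ → ℤ} (hg : ∀ j, 0 ≤ g j) (hsum : ∑ j ∈ L, g j < 2 ^ fieldBits m) {x : ℕ} (hx : x < N) :
    field n m (fun u => ∑ j ∈ L, g j * ((incidence n m N Ss).val j).1 u) x =
      ∑ j ∈ L ∩ Ss.getD x ∅, g j := by
  set F := fieldsPerWord n m with hF
  have hFpos : 0 < F := fieldsPerWord_pos n m
  have hu : x / F < wordCount n m N :=
    Nat.lt_succ_of_le (Nat.div_le_div_right hx.le)
  have hword : ∑ j ∈ L, g j * ((incidence n m N Ss).val j).1 (x / F) =
      ∑ v ∈ range F, (2 ^ fieldBits m) ^ v * ∑ j ∈ L ∩ Ss.getD (x / F * F + v) ∅, g j := by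
    have : ∀ j ∈ L, g j * ((incidence n m N Ss).val j).1 (x / F) =
        ∑ v ∈ range F, (2 ^ fieldBits m) ^ v *
          if j ∈ Ss.getD (x / F * F + v) ∅ then g j else 0 := by
      intro j hj
      rw [(incidence_val n m N Ss (mem_range.1 (hL hj))).1]
      simp only [hu, if_true, mul_sum]
      refine sum_congr rfl fun v _ => ?_
      split_ifs
      · rw [pow_mul]; ring
      · simp
    rw [sum_congr rfl this, sum_comm]
    refine sum_congr rfl fun v _ => ?_
    rw [← mul_sum, sum_ite_mem]
  simp only [field, ← hF]
  rw [hword, pow_mul, sum_pow_mul_ediv_emod F (fun v => ⟨sum_nonneg fun j _ => hg j,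
    (sum_le_sum_of_subset_of_nonneg inter_subset_left fun j _ _ => hg j).trans_lt hsum⟩)
    (Nat.mod_lt _ hFpos), Nat.div_add_mod']

section Residual

variable {n m : ℕ} {t p : ℕ → ℤ}

theorem err_le (ht : ∀ i, 0 ≤ t i) (hp : ∀ j, 0 ≤ p j) (ht' : ∀ i, t i ≤ m + 1)
    (hp' : ∀ j, p j ≤ m + 1) (i j : ℕ) : err t p i j ≤ ((m : ℤ) + 1) ^ 4 := by
  have h1 := ht (i + j)
  have h2 := hp j
  have h3 := ht' (i + j)
  have h4 := hp' j
  have h5 : (t (i + j) - p j) ^ 2 ≤ ((m : ℤ) + 1) ^ 2 := sq_le_sq' (by linarith) (by linarith)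
  calc err t p i j ≤ ((m : ℤ) + 1) ^ 2 * (m + 1) * (m + 1) := by
        unfold err; gcongr
    _ = _ := by ring

/-- The fields are wide enough for the sums of error terms, even when weighted by positions. -/
theorem sum_err_lt (ht : ∀ i, 0 ≤ t i) (hp : ∀ j, 0 ≤ p j) (ht' : ∀ i, t i ≤ m + 1)
    (hp' : ∀ j, p j ≤ m + 1) (i : ℕ) {L : Finset ℕ} (hL : L ⊆ range m) {w : ℕ → ℤ}
    (hw : ∀ j < m, w j ≤ m) :
    ∑ j ∈ L, w j * err t p i j < 2 ^ fieldBits m := by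
  have h1 : ∑ j ∈ L, w j * err t p i j ≤ m * (m * ((m : ℤ) + 1) ^ 4) := by
    calc ∑ j ∈ L, w j * err t p i j ≤ L.card • (m * ((m : ℤ) + 1) ^ 4) := by
          refine sum_le_card_nsmul _ _ _ fun j hj => ?_
          exact mul_le_mul (hw j (mem_range.1 (hL hj))) (err_le ht hp ht' hp' i j)
            (err_nonneg ht hp i j) (by positivity)
      _ ≤ m * (m * ((m : ℤ) + 1) ^ 4) := by
          rw [nsmul_eq_mul]
          gcongr
          simpa using card_le_card hL
  have h2 : (m : ℤ) * (m * ((m : ℤ) + 1) ^ 4) < ((m : ℤ) + 1) ^ 6 := by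
    have : (0 : ℤ) < ((m : ℤ) + 1) ^ 4 := by positivity
    have hm : (0 : ℤ) ≤ m := by positivity
    calc (m : ℤ) * (m * ((m : ℤ) + 1) ^ 4) = (m * m) * ((m : ℤ) + 1) ^ 4 := by ring
      _ < ((m + 1) * (m + 1)) * ((m : ℤ) + 1) ^ 4 := by gcongr <;> omega
      _ = _ := by ring
  have h3 : ((m : ℤ) + 1) ^ 6 ≤ 2 ^ fieldBits m := by
    have : (m + 1) ^ 6 ≤ 2 ^ fieldBits m := by
      rw [fieldBits, mul_comm, pow_mul]
      exact Nat.pow_le_pow_left (Nat.lt_size_self _).le 6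
    exact_mod_cast this
  linarith

/-- An unknown mismatch that is alone among the unknown ones in sample `x` is found when that sample
is searched. -/
theorem residualUpdate_single (hm : 1 ≤ m) (hmn : m ≤ n) (ht : ∀ i, 0 ≤ t i) (hp : ∀ j, 0 ≤ p j)
    (ht' : ∀ i, t i ≤ m + 1) (hp' : ∀ j, p j ≤ m + 1) {i j x N : ℕ} (hi : i < n - m + 1)
    (hx : x < N) (Ss : List (Finset ℕ)) {s : Loc} (hs : s.L ⊆ errPositions m t p i)
    (h : (errPositions m t p i \ s.L) ∩ Ss.getD x ∅ = {j}) (s' : Loc) :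
    j ∈ (residualUpdate n m (sampleSums n m N Ss t p).val t p i s
      (knownSums n m N (incidence n m N Ss).val t p i s.L).val x s').val.L := by
  have hmem : j ∈ (errPositions m t p i \ s.L) ∩ Ss.getD x ∅ := h ▸ mem_singleton_self j
  obtain ⟨hjM, hjS⟩ := mem_inter.1 hmem
  obtain ⟨hjM, hjL⟩ := mem_sdiff.1 hjM
  obtain ⟨hjm, hne⟩ := mem_errPositions.1 hjM
  have hL : s.L ⊆ range m := hs.trans (errPositions_subset m t p i)
  have hsamples : (sampleSums n m N Ss t p).val x =
      ((mask m p (Ss.getD x ∅)).val, (errorSums n m t (mask m p (Ss.getD x ∅)).val).val) :=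
    val_tab_of_lt _ hx
  set S := Ss.getD x ∅ with hS
  have hD := field_incidence (n := n) Ss hL (g := fun j => err t p i j) (err_nonneg ht hp i) (by
    rcases s.L.eq_empty_or_nonempty with he | he
    · simp [he]
    · simpa using sum_err_lt ht hp ht' hp' i hL (w := fun _ => 1)
        fun j _ => by exact_mod_cast hm) hx
  have hD' := field_incidence (n := n) Ss hL (g := fun j => (j : ℤ) * err t p i j)
    (fun j => mul_nonneg (by positivity) (err_nonneg ht hp i j))
    (sum_err_lt ht hp ht' hp' i hL (w := fun j => (j : ℤ)) fun j hj => by exact_mod_cast hj.le) hx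
  rw [← hS] at hD hD'
  -- the unknown part of an error sum over the sample consists of the term of `j` alone
  have hdiff : ∀ g : ℕ → ℤ, ∑ j ∈ errPositions m t p i ∩ S, g j * err t p i j -
      ∑ j ∈ s.L ∩ S, g j * err t p i j = g j * err t p i j := by
    intro g
    have hsub : s.L ∩ S ⊆ errPositions m t p i ∩ S := inter_subset_inter_right hs
    have hsd : (errPositions m t p i ∩ S) \ (s.L ∩ S) = {j} := by
      rw [← h]; ext y; simp only [mem_sdiff, mem_inter]; tauto
    rw [← sum_sdiff hsub, hsd, sum_singleton]; ring
  have h1 : err t (mask m p S).val i j = err t p i j := by rw [err_mask t p S i hjm, if_pos hjS]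
  have hiso : isolate m t ((sampleSums n m N Ss t p).val x).1 i
      ((((sampleSums n m N Ss t p).val x).2 i).1 - field n m (fun u =>
        ((knownSums n m N (incidence n m N Ss).val t p i s.L).val u).1) x)
      ((((sampleSums n m N Ss t p).val x).2 i).2 - (i * field n m (fun u =>
        ((knownSums n m N (incidence n m N Ss).val t p i s.L).val u).1) x + field n m (fun u =>
        ((knownSums n m N (incidence n m N Ss).val t p i s.L).val u).2) x)) = some j := by
    rw [hsamples]
    simp only [knownSums]
    rw [hD, hD', errorSums_val hm hmn _ _ hi]
    have e1 := hdiff fun _ => 1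
    have e2 := hdiff fun j => (i : ℤ) + j
    have e3 := sum_err_mask m t p S i fun _ => 1
    simp only [one_mul] at e1 e3
    simp only
    rw [e3, e1, sum_err_mask m t p S i fun j => (i : ℤ) + j, mul_sum, ← sum_add_distrib]
    simp only [← add_mul]
    rw [e2, ← h1]
    exact isolate_single hjm (by rwa [h1])
  simp only [residualUpdate, val_charge]
  rw [hiso]
  simp only [hjL, if_false, Loc.L_add]
  exact mem_insert_self _ _

theorem loopT_of_pass {α : Type} {body : ℕ → α → Timed α} {Q : α → Prop} {l : ℕ}
    (hQ : ∀ x a, Q a → Q (body x a).val) (hl : ∀ a, Q (body l a).val) (N x : ℕ) (hx : x ≤ l)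
    (hlN : l < x + N) (a : α) : Q (loopT body N x a).val := by
  induction N generalizing x a with
  | zero => omega
  | succ N ih =>
    rcases hx.eq_or_lt with rfl | hlt
    · exact loopT_induction hQ N (x + 1) (hl a)
    · exact ih (x + 1) hlt (by omega) _

/-- The elements of `R` that are alone among those of `R` in one of the samples. -/
def isolated (R : Finset ℕ) (Ss : List (Finset ℕ)) : Finset ℕ :=
  R.filter fun j => ∃ S ∈ Ss, R ∩ S = {j}

/-- A residual search that is not skipped finds every unknown mismatch that some sample isolates
among the unknown ones. -/
theorem residualSearch_isolated (hm : 1 ≤ m) (hmn : m ≤ n) (ht : ∀ i, 0 ≤ t i) (hp : ∀ j, 0 ≤ p j)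
    (ht' : ∀ i, t i ≤ m + 1) (hp' : ∀ j, p j ≤ m + 1) {c k i : ℕ} (hi : i < n - m + 1)
    (Ss : List (Finset ℕ)) {st : ℕ → Loc} (hst : (st i).Valid m t p i)
    (hdone : ¬ Done m k t p i (st i))
    (hwork : ∑ j ∈ (st i).L, ((incidence n m Ss.length Ss).val j).2.card ≤
      8 * c * k * fieldBits m) :
    isolated (errPositions m t p i \ (st i).L) Ss ⊆
      ((residualSearch c n m k Ss.length Ss t p st).val i).L := by
  have hns := fun h => hdone ((hst.settled_iff ht hp).1 h)
  intro j hj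
  obtain ⟨-, S, hS, hjS⟩ := mem_filter.1 hj
  obtain ⟨x, hx, rfl⟩ := List.mem_iff_getElem.1 hS
  rw [residualSearch_val _ _ _ _ _ _ _ _ _ hi, residualAt, Timed.val_bind, val_charge,
    if_neg (by rintro (h | h | h); exacts [hns (Or.inl h), hns (Or.inr h), absurd h (by omega)])]
  refine loopT_of_pass (Q := fun s' : Loc => j ∈ s'.L) (l := x)
    (fun y s' hs' => (residualUpdate_ext _ _ _ _ _ _ _ _ _ _ _).2 hs') (fun s' => ?_) _ _
    (Nat.zero_le x) (by simpa using hx) _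
  refine residualUpdate_single hm hmn ht hp ht' hp' hi hx Ss hst.1 ?_ s'
  rwa [List.getD_eq_getElem _ _ hx]

/-! ### The number of words that are touched -/

theorem card_incidence_le (N : ℕ) (Ss : List (Finset ℕ)) {j : ℕ} (hj : j < m) :
    ((incidence n m N Ss).val j).2.card ≤
      ((range Ss.length).filter fun x => j ∈ Ss.getD x ∅).card := by
  have hF : 0 < fieldsPerWord n m := fieldsPerWord_pos n m
  refine le_trans (card_le_card (t := ((range Ss.length).filter fun x => j ∈ Ss.getD x ∅).image
    fun x => x / fieldsPerWord n m) ?_) card_image_le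
  intro u hu
  rw [(incidence_val n m N Ss hj).2, mem_filter, (incidence_val n m N Ss hj).1] at hu
  obtain ⟨hu, hne⟩ := hu
  beta_reduce at hne
  rw [if_pos (mem_range.1 hu)] at hne
  obtain ⟨v, hv, hne⟩ := exists_ne_zero_of_sum_ne_zero hne
  have hmem : j ∈ Ss.getD (u * fieldsPerWord n m + v) ∅ := by
    by_contra h; exact hne (if_neg h)
  refine mem_image.2 ⟨u * fieldsPerWord n m + v, mem_filter.2 ⟨mem_range.2 ?_, hmem⟩, ?_⟩
  · by_contra h
    rw [List.getD_eq_default _ _ (not_lt.1 h)] at hmem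
    simp at hmem
  · rw [mul_comm, Nat.mul_add_div hF, Nat.div_eq_of_lt (mem_range.1 hv), add_zero]

theorem sum_card_incidence_le (N : ℕ) (Ss : List (Finset ℕ)) {L : Finset ℕ} (hL : L ⊆ range m) :
    ∑ j ∈ L, ((incidence n m N Ss).val j).2.card ≤
      ∑ x ∈ range Ss.length, (L ∩ Ss.getD x ∅).card := by
  refine (sum_le_sum fun j hj => card_incidence_le N Ss (mem_range.1 (hL hj))).trans_eq ?_
  simp only [card_filter]
  rw [sum_comm]
  refine sum_congr rfl fun x _ => ?_
  rw [← card_filter, filter_mem_eq_inter]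

theorem sum_card_incidence_le_wordCount (N : ℕ) (Ss : List (Finset ℕ)) {L : Finset ℕ}
    (hL : L ⊆ range m) :
    ∑ j ∈ L, ((incidence n m N Ss).val j).2.card ≤ L.card * wordCount n m N := by
  refine (sum_le_card_nsmul _ _ _ fun j hj => ?_).trans_eq (smul_eq_mul _ _)
  rw [(incidence_val n m N Ss (mem_range.1 (hL hj))).2]
  exact (card_filter_le _ _).trans (by simp)

theorem fieldBits_pos (m : ℕ) : 0 < fieldBits m := by
  have : 0 < Nat.size (m + 1) := Nat.size_pos.2 (Nat.succ_pos m)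
  unfold fieldBits; omega

/-- With `c log n` samples a vector has `O(c)` words per bit of a field. -/
theorem wordCount_le {c : ℕ} : wordCount n m (c * Nat.clog 2 n) ≤ 2 * c * fieldBits m + 1 := by
  have hb := fieldBits_pos m
  unfold wordCount fieldsPerWord
  gcongr
  set Λ := Nat.clog 2 n
  set b := fieldBits m
  refine Nat.div_le_of_le_mul ?_
  have h1 : Λ < b * (Λ / b + 1) := Nat.lt_mul_div_succ Λ hb
  have h2 : Λ / b + 1 ≤ 2 * max 1 (Λ / b) := by omega
  have h3 : Λ ≤ b * (2 * max 1 (Λ / b)) := h1.le.trans (Nat.mul_le_mul_left _ h2)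
  calc c * Λ ≤ c * (b * (2 * max 1 (Λ / b))) := Nat.mul_le_mul_left _ h3
    _ = _ := by ring

/-! ### Many independent samples -/

theorem drawMany_holds (m s N : ℕ) : (drawMany m s N).Holds fun l => l.length = N := by
  induction N with
  | zero => exact Rand.holds_pure rfl
  | succ N ih =>
    exact (Rand.holds_true _).bind fun S _ => ih.bind fun l hl =>
      Rand.holds_lift (by simpa using hl)

theorem ev_drawMany_succ (m s N : ℕ) (f : List (Finset ℕ) → ℝ≥0∞) :
    (drawMany m s (N + 1)).ev f =
      (draw m s).ev fun S => (drawMany m s N).ev fun l => f (S :: l) := by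
  simp only [drawMany, Rand.ev_bind, Rand.ev_lift, val_charge]

theorem isolated_subset (R : Finset ℕ) (Ss : List (Finset ℕ)) : isolated R Ss ⊆ R :=
  filter_subset _ _

theorem isolated_cons (R S : Finset ℕ) (l : List (Finset ℕ)) :
    isolated R (S :: l) = isolated R [S] ∪ isolated R l := by
  ext j
  simp only [isolated, mem_filter, mem_union, List.mem_cons, exists_eq_or_imp]
  tauto

/-- The potential argument for samples that are drawn in advance: they isolate elements of `R`, one
sample after the other, as in a sequence of sampling steps. -/
theorem ev_drawMany_potential {s g : ℕ} {R : Finset ℕ} (hR : R ⊆ range m)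
    (h : GoodSize m s R.card)
    (hp : ∀ F ⊆ R, F.card < g → 2 * rate ≤ (R \ F).card * (s / m * Real.exp (-16)))
    (N : ℕ) {F : Finset ℕ} (hF : F ⊆ R) :
    ((drawMany m s N).ev fun l => potential g (F ∪ isolated R l).card) ≤
      ENNReal.ofReal (1 - rate) ^ N * potential g F.card := by
  induction N generalizing F with
  | zero => simp [drawMany, isolated]
  | succ N ih =>
    rw [ev_drawMany_succ]
    have hrate : 2 * rate ≤ 1 := by
      have : Real.exp (-16) ≤ 1 := Real.exp_le_one_iff.2 (by norm_num)
      unfold rate; linarith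
    have hstep : ((draw m s).ev fun S => potential g (F ∪ isolated R [S]).card) ≤
        ENNReal.ofReal (1 - rate) * potential g F.card := by
      have := ev_potential_le (x := draw m s) (f := fun S => (F ∪ isolated R [S]).card)
        (g := g) (y := F.card) (Q := fun S => ∃ j ∈ R \ F, R ∩ S = {j}) (p := 2 * rate)
        (fun y _ => card_le_card subset_union_left) hrate ?_ ?_
      · simpa using this
      · intro hg
        have hx := hp F hF hg
        refine fail_draw_le_of_goodSize h hR sdiff_subset ?_ hx
        by_contra h0
        have h0 : R.card = 0 := by omega
        have : R \ F = ∅ := by rw [card_eq_zero.1 h0]; simp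
        rw [this] at hx
        simp only [card_empty, Nat.cast_zero, zero_mul] at hx
        linarith [rate_pos]
      · rintro y - ⟨j, hj, hS⟩
        have hj := mem_sdiff.1 hj
        refine card_lt_card ⟨subset_union_left, fun hsub => hj.2 (hsub ?_)⟩
        exact mem_union_right _ (mem_filter.2 ⟨hj.1, y.val, by simp, hS⟩)
    calc ((draw m s).ev fun S => (drawMany m s N).ev fun l =>
          potential g (F ∪ isolated R (S :: l)).card)
        ≤ (draw m s).ev fun S => ENNReal.ofReal (1 - rate) ^ N *
            potential g (F ∪ isolated R [S]).card := by
          refine Rand.ev_mono fun S => ?_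
          have := ih (F := F ∪ isolated R [S]) (union_subset hF (isolated_subset _ _))
          simp only [union_assoc, ← isolated_cons R S] at this
          exact this
      _ = ENNReal.ofReal (1 - rate) ^ N *
            (draw m s).ev fun S => potential g (F ∪ isolated R [S]).card := Rand.ev_const_mul _ _ _
      _ ≤ ENNReal.ofReal (1 - rate) ^ N * (ENNReal.ofReal (1 - rate) * potential g F.card) := by
          gcongr
      _ = _ := by ring

theorem ev_drawMany_two_pow (s N : ℕ) (L : Finset ℕ) :
    ((drawMany m s N).ev fun l => 2 ^ ∑ x ∈ range N, (L ∩ l.getD x ∅).card) =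
      ((draw m s).ev fun S => 2 ^ (L ∩ S).card) ^ N := by
  induction N with
  | zero => simp [drawMany]
  | succ N ih =>
    rw [ev_drawMany_succ, pow_succ, ← ih, ← Rand.ev_const_mul]
    refine congrArg _ (funext fun S => ?_)
    rw [mul_comm, ← Rand.ev_const_mul]
    refine congrArg _ (funext fun l => ?_)
    rw [sum_range_succ', pow_add, mul_comm]
    simp only [List.getD_cons_succ, List.getD_cons_zero]

/-- The subtraction of the known mismatches rarely touches too many words. -/
theorem drawMany_fail_work {c k κ : ℕ} (hm : 1 ≤ m) (hc : 1 ≤ c) (hκ : 1 ≤ κ) (hκk : κ ≤ k)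
    {L : Finset ℕ} (hL : L ⊆ range m) (hLk : L.card ≤ k) :
    (drawMany m (m / κ) (c * max κ (Nat.clog 2 n))).fail (fun Ss =>
      ∑ j ∈ L, ((incidence n m Ss.length Ss).val j).2.card ≤ 8 * c * k * fieldBits m) ≤
      tiny n := by
  have hb := fieldBits_pos m
  have hcb : 1 ≤ c * fieldBits m := Nat.mul_pos hc hb
  rcases le_total κ (Nat.clog 2 n) with hle | hle
  · -- few words per pattern position
    rw [max_eq_right hle]
    refine (Rand.fail_eq_zero ((drawMany_holds _ _ _).mono fun Ss hSs => ?_)).trans_le zero_le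
    rw [hSs]
    refine (sum_card_incidence_le_wordCount _ _ hL).trans ?_
    calc L.card * wordCount n m (c * Nat.clog 2 n) ≤ k * (2 * c * fieldBits m + 1) :=
          Nat.mul_le_mul hLk wordCount_le
      _ = k * (2 * (c * fieldBits m) + 1) := by ring
      _ ≤ k * (8 * (c * fieldBits m)) := Nat.mul_le_mul_left _ (by omega)
      _ = _ := by ring
  · -- the number of incidences has a small exponential moment
    rw [max_eq_left hle]
    set N := c * κ with hN
    have hmarkov : (drawMany m (m / κ) N).fail (fun Ss =>
        ∑ j ∈ L, ((incidence n m Ss.length Ss).val j).2.card ≤ 8 * c * k * fieldBits m) ≤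
        (drawMany m (m / κ) N).ev fun l =>
          ENNReal.ofReal ((2 ^ (8 * (c * k)))⁻¹) * 2 ^ ∑ x ∈ range N, (L ∩ l.getD x ∅).card := by
      refine Rand.fail_le_ev (drawMany_holds _ _ _) fun Ss hSs hlt => ?_
      have h1 := (not_le.1 hlt).trans_le (sum_card_incidence_le _ _ hL)
      rw [hSs] at h1
      have h2 : 8 * (c * k) ≤ ∑ x ∈ range N, (L ∩ Ss.getD x ∅).card := by
        refine le_trans ?_ h1.le
        calc 8 * (c * k) = 8 * c * k * 1 := by ring
          _ ≤ 8 * c * k * fieldBits m := Nat.mul_le_mul_left _ hb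
      calc (1 : ℝ≥0∞) = ENNReal.ofReal ((2 ^ (8 * (c * k)))⁻¹) * 2 ^ (8 * (c * k)) := by
            rw [ENNReal.ofReal_inv_of_pos (by positivity), ENNReal.ofReal_pow (by norm_num),
              ENNReal.ofReal_ofNat, ENNReal.inv_mul_cancel] <;> simp
        _ ≤ _ := by gcongr; exact one_le_two
    refine hmarkov.trans ?_
    rw [Rand.ev_const_mul, ev_drawMany_two_pow]
    have hκ0 : (0 : ℝ) < κ := by exact_mod_cast hκ
    have hm0 : (0 : ℝ) < m := by exact_mod_cast hm
    have hbase : (1 + ((m / κ : ℕ) : ℝ) / m) ^ L.card ≤ Real.exp (k / κ) := by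
      have h1 : ((m / κ : ℕ) : ℝ) / m ≤ 1 / κ := by
        rw [div_le_div_iff₀ hm0 hκ0, one_mul]
        exact_mod_cast Nat.div_mul_le_self m κ
      calc (1 + ((m / κ : ℕ) : ℝ) / m) ^ L.card ≤ (1 + ((m / κ : ℕ) : ℝ) / m) ^ k :=
            pow_le_pow_right₀ (le_add_of_nonneg_right (by positivity)) hLk
        _ ≤ Real.exp (1 / κ) ^ k := by
            refine pow_le_pow_left₀ (by positivity) ?_ k
            linarith [Real.add_one_le_exp (1 / κ : ℝ)]
        _ = Real.exp (k / κ) := by rw [← Real.exp_nat_mul]; congr 1; ring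
    have hpow : ((draw m (m / κ)).ev fun S => 2 ^ (L ∩ S).card) ^ N ≤
        ENNReal.ofReal (Real.exp (c * k)) := by
      calc _ ≤ ENNReal.ofReal (Real.exp (k / κ)) ^ N := by
            gcongr
            exact (ev_draw_two_pow_le hm (Nat.div_le_self _ _) hL).trans
              (ENNReal.ofReal_le_ofReal hbase)
        _ = ENNReal.ofReal (Real.exp (c * k)) := by
            rw [← ENNReal.ofReal_pow (Real.exp_pos _).le, ← Real.exp_nat_mul, hN]
            congr 2; push_cast; field_simp
    refine (mul_le_mul_right hpow _).trans ?_
    rw [← ENNReal.ofReal_mul (by positivity)]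
    refine ENNReal.ofReal_le_ofReal ?_
    have h2 : Real.exp (5 * (c * k)) ≤ 2 ^ (8 * (c * k)) := by
      have : (2 : ℝ) ^ (8 * (c * k)) = Real.exp (Real.log 2 * (8 * (c * k) : ℕ)) := by
        rw [mul_comm (Real.log 2), Real.exp_nat_mul, Real.exp_log (by norm_num)]
      rw [this]
      refine Real.exp_le_exp.2 ?_
      push_cast
      have := Real.log_two_gt_d9
      have hck : (0 : ℝ) ≤ c * k := by positivity
      nlinarith
    have hΛ : (Nat.clog 2 n : ℝ) ≤ c * k := by
      have : Nat.clog 2 n ≤ c * k := hle.trans (hκk.trans (Nat.le_mul_of_pos_left k hc))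
      exact_mod_cast this
    calc ((2 : ℝ) ^ (8 * (c * k)))⁻¹ * Real.exp (c * k)
        ≤ (Real.exp (5 * (c * k)))⁻¹ * Real.exp (c * k) := by gcongr
      _ = Real.exp (-(5 * (c * k)) + c * k) := by rw [← Real.exp_neg, Real.exp_add]
      _ ≤ _ := Real.exp_le_exp.2 (by push_cast; linarith)

/-! ### Algorithm 2 finds all of fewer than `2 k` mismatches -/

/-- One iteration of Algorithm 2 about halves the number of unknown mismatches. -/
theorem iteration_fail (hm : 1 ≤ m) (hmn : m ≤ n) (ht : ∀ i, 0 ≤ t i) (hp : ∀ j, 0 ≤ p j)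
    (ht' : ∀ i, t i ≤ m + 1) (hp' : ∀ j, p j ≤ m + 1) {c k κ i : ℕ} (hc : 8 ≤ c * rate)
    (hκ : 1 ≤ κ) (hκk : κ ≤ k) (hkm : 4 * k ≤ m) (hi : i < n - m + 1) {st : ℕ → Loc}
    (hst : AllValid n m t p st)
    (hr : Done m k t p i (st i) ∨ (errPositions m t p i \ (st i).L).card ≤ 2 * κ - 1) :
    (drawMany m (m / κ) (c * max κ (Nat.clog 2 n)) >>= fun Ss =>
      Rand.lift (residualSearch c n m k (c * max κ (Nat.clog 2 n)) Ss t p st)).fail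
      (fun st' => Done m k t p i (st' i) ∨
        (errPositions m t p i \ (st' i).L).card ≤ 2 * (κ / 2) - 1) ≤ 2 * tiny n := by
  classical
  set N := c * max κ (Nat.clog 2 n) with hN
  by_cases hdone : Done m k t p i (st i)
  · refine (Rand.fail_eq_zero ?_).trans_le zero_le
    exact (Rand.holds_true _).bind fun Ss _ =>
      Rand.holds_lift (Or.inl (hdone.ext (residualSearch_ext c n m k N Ss t p st i hi)))
  have hr := hr.resolve_left hdone
  have hc1 : 1 ≤ c := by
    by_contra h0
    obtain rfl : c = 0 := by omega
    norm_num at hc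
  set R := errPositions m t p i \ (st i).L with hR
  have hRm : R ⊆ range m := sdiff_subset.trans (errPositions_subset m t p i)
  have hLk : (st i).L.card ≤ k := not_lt.1 fun h => hdone (Or.inl h)
  have hgood : GoodSize m (m / κ) R.card := goodSize_div hκ hr (by omega)
  -- the iteration succeeds once fewer than `a` mismatches are unknown
  obtain ⟨a, ha⟩ : ∃ a, max 1 (2 * (κ / 2)) = a := ⟨_, rfl⟩
  set g := R.card - (a - 1) with hg
  have hpot : (drawMany m (m / κ) N).fail (fun Ss => g ≤ (isolated R Ss).card) ≤ tiny n := by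
    have h1 := ev_drawMany_potential (g := g) hRm hgood (fun F hF hFg => ?_) N (empty_subset R)
    · simp only [empty_union] at h1
      refine (Rand.fail_le_ev (Rand.holds_true _) fun Ss _ h =>
        one_le_potential (not_le.1 h)).trans (h1.trans ?_)
      exact (mul_le_mul_right (potential_le_two_pow _ _) _).trans
        (two_pow_mul_le_tiny hc (by omega) le_rfl)
    · have h2 : κ ≤ 2 * (R \ F).card := by rw [card_sdiff_of_subset hF]; omega
      have h2' : (κ : ℝ) ≤ 2 * (R \ F).card := by exact_mod_cast h2
      have h3 := one_div_le_div (m := m) hκ (by omega)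
      have hκ' : (0 : ℝ) < κ := by exact_mod_cast hκ
      calc 2 * rate ≤ (κ / 2) * (1 / (2 * κ) * Real.exp (-16)) := by
            have : (κ / 2 : ℝ) * (1 / (2 * κ) * Real.exp (-16)) = Real.exp (-16) / 4 := by
              field_simp; norm_num
            rw [this, rate]; linarith [Real.exp_pos (-16)]
        _ ≤ (R \ F).card * (((m / κ : ℕ) : ℝ) / m * Real.exp (-16)) := by
            gcongr; linarith
  have hwork := drawMany_fail_work (n := n) hm hc1 hκ hκk
    ((hst i hi).1.trans (errPositions_subset m t p i)) hLk
  have hboth := (Rand.fail_and_le _ _ _).trans (add_le_add hwork hpot)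
  rw [← two_mul] at hboth
  refine le_trans ?_ hboth
  rw [Rand.fail_bind]
  refine Rand.ev_mono_of_holds (drawMany_holds _ _ _) fun Ss hSs => ?_
  rw [Rand.fail_lift]
  split_ifs with h1 h2 h2
  · exact le_rfl
  · exact zero_le
  · refine absurd (Or.inr ?_) h1
    have hiso := residualSearch_isolated hm hmn ht hp ht' hp' (c := c) hi Ss (hst i hi) hdone h2.1
    rw [hSs] at hiso
    have hext := (residualSearch_ext c n m k N Ss t p st i hi).2
    set L' := ((residualSearch c n m k N Ss t p st).val i).L
    have hsub : errPositions m t p i \ L' ⊆ R \ isolated R Ss := by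
      intro j hj
      obtain ⟨hj1, hj2⟩ := mem_sdiff.1 hj
      exact mem_sdiff.2 ⟨mem_sdiff.2 ⟨hj1, fun h => hj2 (hext h)⟩, fun h => hj2 (hiso h)⟩
    have h3 := card_le_card hsub
    rw [card_sdiff_of_subset (isolated_subset _ _)] at h3
    have h4 := h2.2
    omega
  · exact le_rfl

theorem algorithm2_fail (hm : 1 ≤ m) (hmn : m ≤ n) (ht : ∀ i, 0 ≤ t i) (hp : ∀ j, 0 ≤ p j)
    (ht' : ∀ i, t i ≤ m + 1) (hp' : ∀ j, p j ≤ m + 1) {c k i : ℕ} (hc : 8 ≤ c * rate)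
    (hk : 1 ≤ k) (hkm : 4 * k ≤ m) (hi : i < n - m + 1)
    (hq : (errPositions m t p i).card ≤ 2 * k - 1) :
    (algorithm2 c n m k t p).fail (fun st => Done m k t p i (st i)) ≤ n * tiny n := by
  change (Rand.lift (start n m t p) >>= _).fail _ ≤ _
  rw [Rand.fail_bind, Rand.ev_lift]
  obtain ⟨hst, hempty⟩ := start_val hm hmn t p
  set st := (start n m t p).val
  have hloop := Rand.fail_loopR_le (I := AllValid n m t p) (N₀ := Nat.log 2 k + 1)
    (ε := 2 * tiny n) (body := fun l st =>
      drawMany m (m / (k / 2 ^ l)) (c * max (k / 2 ^ l) (Nat.clog 2 n)) >>=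
      fun Ss => Rand.lift (residualSearch c n m k (c * max (k / 2 ^ l) (Nat.clog 2 n)) Ss t p st))
    (G := fun l st => Done m k t p i (st i) ∨
      (errPositions m t p i \ (st i).L).card ≤ 2 * (k / 2 ^ l) - 1)
    (fun l st hst => ((Rand.holds_true _).bind fun Ss _ => Rand.holds_lift
      (residualSearch_ext c n m k _ Ss t p st)).mono fun _ h => h.valid hst)
    (fun l st hl hst hG => ?_) (Nat.log 2 k + 1) 0 (by omega) hst
    (Or.inr (by rw [hempty]; simpa using hq))
  · refine (Rand.fail_mono_of_holds (I := fun _ => True) (Rand.holds_true _)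
      fun st' _ h => ?_).trans (hloop.trans ?_)
    · refine h.elim id fun h => Or.inr ?_
      rw [zero_add, Nat.div_eq_of_lt (Nat.lt_pow_succ_log_self (by norm_num) k)] at h
      exact sdiff_eq_empty_iff_subset.1 (card_eq_zero.1 (by omega))
    · have h1 : Nat.log 2 k < k := Nat.log_lt_self 2 (by omega)
      calc ((Nat.log 2 k + 1 : ℕ) : ℝ≥0∞) * (2 * tiny n)
          = ((2 * (Nat.log 2 k + 1) : ℕ) : ℝ≥0∞) * tiny n := by push_cast; ring
        _ ≤ n * tiny n := by gcongr; omega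
  · have h1 : 2 ^ l ≤ k := (Nat.pow_le_pow_right (by norm_num) (by omega)).trans
      (Nat.pow_log_le_self 2 (by omega))
    have h2 : k / 2 ^ (l + 1) = k / 2 ^ l / 2 := by rw [pow_succ, Nat.div_div_eq_div_mul]
    rw [h2]
    exact iteration_fail hm hmn ht hp ht' hp' hc ((Nat.one_le_div_iff (by positivity)).2 h1)
      (Nat.div_le_self _ _) hkm hi hst hG

end Residual

/-! ### Running times -/

section Cost

variable {n m : ℕ} (t p : ℕ → ℤ)

theorem mask_steps (m : ℕ) (p : ℕ → ℤ) (S : Finset ℕ) : (mask m p S).steps = m * 4 := by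
  simp only [mask, steps_tab_charge]

theorem draw_costLe (m s : ℕ) : (draw m s).CostLe (5 * m + 1) := by
  intro y hy
  obtain ⟨S, -, rfl⟩ := (PMF.mem_support_map_iff _ _ _).1 hy
  exact le_rfl

theorem drawMany_costLe (m s N : ℕ) : (drawMany m s N).CostLe (N * (5 * m + 2)) := by
  induction N with
  | zero => simpa [drawMany] using Rand.costLe_pure ([] : List (Finset ℕ))
  | succ N ih =>
    have := (draw_costLe m s).bind (f := fun S => drawMany m s N >>= fun l =>
      Rand.lift (charge 1 (S :: l))) fun S => ih.bind fun l => Rand.costLe_lift (b := 1) le_rfl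
    exact this.mono (by linarith)

theorem start_steps (hm : 1 ≤ m) (hmn : m ≤ n) :
    (start n m t p).steps ≤ 3104 * (n * (Nat.clog 2 m + 1)) := by
  simp only [start, Timed.steps_bind, steps_tab_charge]
  refine (add_le_add (errorSums_steps hm hmn _ _) le_rfl).trans ?_
  have : n - m + 1 ≤ n := by omega
  nlinarith

theorem samplingStep_costLe (hm : 1 ≤ m) (hmn : m ≤ n) (s : ℕ) (st : ℕ → Loc) :
    (samplingStep n m s t p st).CostLe (3150 * (n * (Nat.clog 2 m + 1))) := by
  have h : ∀ S, (sampleWith n m t p st S).steps ≤ 3121 * n * (Nat.clog 2 m + 1) + 20 * n := by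
    intro S
    simp only [sampleWith, Timed.steps_bind, mask_steps, steps_tab_charge]
    refine (add_le_add le_rfl (add_le_add (oneMismatch_steps hm hmn _ _) le_rfl)).trans ?_
    omega
  rw [samplingStep_eq]
  refine ((draw_costLe m s).bind fun S => Rand.costLe_lift (h S)).mono ?_
  nlinarith

theorem algorithm1_costLe (hm : 1 ≤ m) (hmn : m ≤ n) (c k : ℕ) :
    (algorithm1 c n m k t p).CostLe (3104 * (n * (Nat.clog 2 m + 1)) +
      c * k * Nat.clog 2 n * (3150 * (n * (Nat.clog 2 m + 1)) + 1)) :=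
  (Rand.costLe_lift (start_steps t p hm hmn)).bind fun st =>
    Rand.costLe_loopR (fun _ st => samplingStep_costLe t p hm hmn _ st) _ _ st

theorem phases_costLe (hm : 1 ≤ m) (hmn : m ≤ n) (c k : ℕ) (st : ℕ → Loc) :
    (phases c n m k t p st).CostLe (Nat.log 2 (m / (2 * k)) *
      (c * max k (Nat.clog 2 n) * (3150 * (n * (Nat.clog 2 m + 1)) + 1) + 1)) :=
  Rand.costLe_loopR (fun _ st => Rand.costLe_loopR
    (fun _ st => samplingStep_costLe t p hm hmn _ st) _ _ st) _ _ st

theorem incidence_steps (hn : 2 ≤ n) (N : ℕ) (Ss : List (Finset ℕ)) :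
    (incidence n m N Ss).steps ≤ m * (11 * (N + Nat.clog 2 n) + 1) := by
  have hF : 0 < fieldsPerWord n m := fieldsPerWord_pos n m
  have hFle : fieldsPerWord n m ≤ Nat.clog 2 n := by
    have h1 : 0 < Nat.clog 2 n := Nat.clog_pos (by norm_num) hn
    have h2 : Nat.clog 2 n / fieldBits m ≤ Nat.clog 2 n := Nat.div_le_self _ _
    unfold fieldsPerWord; omega
  have hw : wordCount n m N * fieldsPerWord n m ≤ N + Nat.clog 2 n := by
    have := Nat.div_mul_le_self N (fieldsPerWord n m)
    rw [wordCount, add_mul]; omega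
  have hw' : wordCount n m N ≤ N + Nat.clog 2 n := (Nat.le_mul_of_pos_right _ hF).trans hw
  have hsum : ∀ f : ℕ → ℤ, (sumUp (fieldsPerWord n m) fun v => charge 6 (f v)).steps ≤
      fieldsPerWord n m * 7 := fun f => steps_sumUp_le fun v => le_rfl
  have hword : ∀ f : ℕ → ℕ → ℤ, (tab (wordCount n m N) fun u =>
      sumUp (fieldsPerWord n m) fun v => charge 6 (f u v)).steps ≤
      wordCount n m N * (fieldsPerWord n m * 7 + 1) := fun f => steps_tab_le fun u => hsum _
  refine (steps_tab_le (b := 11 * (N + Nat.clog 2 n)) fun j => ?_)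
  simp only [Timed.steps_bind, steps_charge]
  refine (add_le_add (hword _) le_rfl).trans ?_
  nlinarith

theorem sampleSums_steps (hm : 1 ≤ m) (hmn : m ≤ n) (N : ℕ) (Ss : List (Finset ℕ)) :
    (sampleSums n m N Ss t p).steps ≤ N * (3107 * (n * (Nat.clog 2 m + 1))) := by
  refine (steps_tab_le (b := m * 4 + (3100 * n * (Nat.clog 2 m + 1) + 2)) fun x => ?_).trans
    (Nat.mul_le_mul_left _ (by nlinarith))
  simp only [Timed.steps_bind, mask_steps, steps_charge]
  gcongr
  exact errorSums_steps hm hmn _ _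

/-- The bound does not depend on the state, since the search skips an alignment whose subtraction
would be too long. -/
theorem residualAt_steps (c k N : ℕ) (rows : ℕ → (ℕ → ℤ) × Finset ℕ)
    (samples : ℕ → (ℕ → ℤ) × (ℕ → ℤ × ℤ)) (i : ℕ) (s : Loc) :
    (residualAt c n m k N rows samples t p i s).steps ≤
      9 + 14 * k + 63 * N + 80 * (c * k * fieldBits m) := by
  rw [residualAt, Timed.steps_bind, val_charge, steps_charge]
  by_cases h1 : s.E = 0 ∨ k < s.L.card
  · rw [if_pos h1, if_pos (by tauto), steps_charge]
    omega
  rw [if_neg h1]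
  have hk : s.L.card ≤ k := not_lt.1 fun h => h1 (Or.inr h)
  split_ifs with h2
  · rw [steps_charge]; omega
  · have hwork : ∑ j ∈ s.L, (rows j).2.card ≤ 8 * c * k * fieldBits m :=
      not_lt.1 fun h => h2 (Or.inr (Or.inr h))
    have hloop := steps_loopT_le (b := 60)
      (body := residualUpdate n m samples t p i s (knownSums n m N rows t p i s.L).val)
      (fun _ _ => le_rfl) N 0 s
    have hK : (knownSums n m N rows t p i s.L).steps ≤
        2 * (N + 1) + (12 * k + 10 * (8 * c * k * fieldBits m)) := by
      have hW : wordCount n m N ≤ N + 1 := Nat.succ_le_succ (Nat.div_le_self _ _)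
      simp only [knownSums, sum_add_distrib, sum_const, smul_eq_mul, ← mul_sum]
      have : s.L.card * 12 ≤ 12 * k := by omega
      gcongr
    rw [Timed.steps_bind]
    calc _ ≤ 3 + 2 * k + (2 * (N + 1) + (12 * k + 10 * (8 * c * k * fieldBits m)) + N * 61) := by
          gcongr
      _ = 5 + 14 * k + 63 * N + 80 * (c * k * fieldBits m) := by ring
      _ ≤ _ := by omega

theorem fieldBits_le (hm : 2 ≤ m) : fieldBits m ≤ 6 * (Nat.clog 2 m + 1) := by
  unfold fieldBits
  gcongr
  rw [Nat.size_le, pow_succ]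
  have := Nat.le_pow_clog (b := 2) (by norm_num) m
  omega

theorem residualSearch_steps (hm : 2 ≤ m) (hmn : m ≤ n) {c k N : ℕ} (hc : 1 ≤ c) (hk : 1 ≤ k)
    (hN : N ≤ c * (k + Nat.clog 2 n)) (Ss : List (Finset ℕ)) (st : ℕ → Loc) :
    (residualSearch c n m k N Ss t p st).steps ≤
      4000 * (c * (k + Nat.clog 2 n) * (n * (Nat.clog 2 m + 1))) := by
  have hb := fieldBits_le hm
  rw [residualSearch_eq]
  simp only [Timed.steps_bind]
  have htab : ∀ rows samples, (tab (n - m + 1) fun i =>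
      charge 1 (st i) >>= residualAt c n m k N rows samples t p i).steps ≤
      n * ((1 + (9 + 14 * k + 63 * N + 80 * (c * k * fieldBits m))) + 1) := by
    intro rows samples
    refine (steps_tab_le (b := 1 + (9 + 14 * k + 63 * N + 80 * (c * k * fieldBits m)))
      fun i => ?_).trans (Nat.mul_le_mul_right _ (by omega))
    rw [Timed.steps_bind, steps_charge]
    exact Nat.add_le_add_left (residualAt_steps t p _ _ _ _ _ _ _) _
  refine (add_le_add (incidence_steps (by omega) N Ss) (add_le_add
    (sampleSums_steps t p (by omega) hmn N Ss) (htab _ _))).trans ?_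
  set Λ := Nat.clog 2 n
  obtain ⟨l, hl⟩ : ∃ l, Nat.clog 2 m + 1 = l := ⟨_, rfl⟩
  have hl1 : 1 ≤ l := by omega
  rw [hl] at hb ⊢
  obtain ⟨X, hX⟩ : ∃ X, c * (k + Λ) = X := ⟨_, rfl⟩
  have hkX : k + Λ ≤ X := hX ▸ Nat.le_mul_of_pos_left _ hc
  have hckX : c * k ≤ X := by rw [← hX, mul_add]; omega
  rw [hX] at hN ⊢
  have hbX : c * k * fieldBits m ≤ X * (6 * l) := Nat.mul_le_mul hckX hb
  have hX1 : 1 ≤ X := by omega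
  have hXl : X ≤ X * l := Nat.le_mul_of_pos_right _ hl1
  calc m * (11 * (N + Λ) + 1) + (N * (3107 * (n * l)) +
        n * ((1 + (9 + 14 * k + 63 * N + 80 * (c * k * fieldBits m))) + 1))
      ≤ n * (23 * (X * l)) + (X * (3107 * (n * l)) + n * (88 * (X * l) + 80 * (X * (6 * l)))) :=
        Nat.add_le_add (Nat.mul_le_mul hmn (by omega)) (Nat.add_le_add (Nat.mul_le_mul_right _ hN)
          (Nat.mul_le_mul_left _ (by omega)))
    _ = 3698 * (X * (n * l)) := by ring
    _ ≤ 4000 * (X * (n * l)) := Nat.mul_le_mul_right _ (by norm_num)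

/-- The dominant term of the running time of a round. -/
def work (n m k : ℕ) : ℕ := (k + Nat.clog 2 n) * (n * (Nat.clog 2 m + 1) ^ 2)

theorem algorithm2_costLe (hm : 2 ≤ m) (hmn : m ≤ n) {c k : ℕ} (hc : 1 ≤ c) (hk : 1 ≤ k)
    (hkm : k ≤ m) : (algorithm2 c n m k t p).CostLe (8000 * (c * work n m k)) := by
  have h1 := (Rand.costLe_lift (start_steps t p (by omega) hmn)).bind (f := fun st =>
    loopR (fun l st => drawMany m (m / (k / 2 ^ l)) (c * max (k / 2 ^ l) (Nat.clog 2 n)) >>=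
      fun Ss => Rand.lift (residualSearch c n m k (c * max (k / 2 ^ l) (Nat.clog 2 n)) Ss t p st))
      (Nat.log 2 k + 1) 0 st) fun st =>
    Rand.costLe_loopR (b := 4007 * (c * (k + Nat.clog 2 n) * (n * (Nat.clog 2 m + 1))))
      (fun l st => ?_) _ _ st
  · refine h1.mono ?_
    have hlog : Nat.log 2 k + 1 ≤ Nat.clog 2 m + 1 :=
      Nat.succ_le_succ ((Nat.log_mono_right hkm).trans (Nat.log_le_clog 2 m))
    rw [work]
    obtain ⟨l, hl⟩ : ∃ l, Nat.clog 2 m + 1 = l := ⟨_, rfl⟩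
    have hl1 : 1 ≤ l := by omega
    rw [hl] at hlog ⊢
    obtain ⟨X, hX⟩ : ∃ X, c * (k + Nat.clog 2 n) = X := ⟨_, rfl⟩
    have hX1 : 1 ≤ X := hX ▸ Nat.mul_pos hc (by omega)
    rw [← mul_assoc c, hX]
    have hXW : 1 ≤ X * (n * l) := Nat.mul_pos hX1 (Nat.mul_pos (by omega) hl1)
    have hW : n * l ≤ X * (n * l ^ 2) := by
      calc n * l = 1 * (n * (l * 1)) := by ring
        _ ≤ X * (n * (l * l)) := by gcongr
        _ = X * (n * l ^ 2) := by ring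
    calc 3104 * (n * l) + (Nat.log 2 k + 1) * (4007 * (X * (n * l)) + 1)
        ≤ 3104 * (X * (n * l ^ 2)) + l * (4008 * (X * (n * l))) := by
          gcongr; omega
      _ = 7112 * (X * (n * l ^ 2)) := by ring
      _ ≤ _ := Nat.mul_le_mul_right _ (by norm_num)
  · have hN : c * max (k / 2 ^ l) (Nat.clog 2 n) ≤ c * (k + Nat.clog 2 n) := by
      have := Nat.div_le_self k (2 ^ l)
      gcongr; omega
    refine ((drawMany_costLe _ _ _).bind fun Ss => Rand.costLe_lift
      (residualSearch_steps t p hm hmn hc hk hN Ss st)).mono ?_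
    have h2 : 5 * m + 2 ≤ 7 * (n * (Nat.clog 2 m + 1)) := by nlinarith
    calc _ ≤ c * (k + Nat.clog 2 n) * (7 * (n * (Nat.clog 2 m + 1))) +
          4000 * (c * (k + Nat.clog 2 n) * (n * (Nat.clog 2 m + 1))) := by gcongr
      _ = _ := by ring

theorem phases_costLe_work (hm : 2 ≤ m) (hmn : m ≤ n) {c k : ℕ} (hc : 1 ≤ c) (hk : 1 ≤ k)
    (st : ℕ → Loc) : (phases c n m k t p st).CostLe (3152 * (c * work n m k)) := by
  refine (phases_costLe t p (by omega) hmn c k st).mono ?_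
  have hlog : Nat.log 2 (m / (2 * k)) ≤ Nat.clog 2 m + 1 :=
    (Nat.log_mono_right (Nat.div_le_self _ _)).trans ((Nat.log_le_clog 2 m).trans (Nat.le_succ _))
  have hmax : c * max k (Nat.clog 2 n) ≤ c * (k + Nat.clog 2 n) := by gcongr; omega
  rw [work]
  obtain ⟨l, hl⟩ : ∃ l, Nat.clog 2 m + 1 = l := ⟨_, rfl⟩
  have hl1 : 1 ≤ l := by omega
  rw [hl] at hlog ⊢
  obtain ⟨X, hX⟩ : ∃ X, c * (k + Nat.clog 2 n) = X := ⟨_, rfl⟩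
  have hX1 : 1 ≤ X := hX ▸ Nat.mul_pos hc (by omega)
  rw [← mul_assoc c, hX]
  rw [hX] at hmax
  have hnl : 1 ≤ n * l := Nat.mul_pos (by omega) hl1
  have hXW : 1 ≤ X * (n * l) := Nat.mul_pos hX1 hnl
  calc _ ≤ l * (X * (3151 * (n * l)) + X * (n * l)) := by
        gcongr; omega
    _ = _ := by ring

theorem algorithm1_costLe_work (hm : 2 ≤ m) (hmn : m ≤ n) {c k : ℕ} (hc : 1 ≤ c) (hk : 1 ≤ k) :
    (algorithm1 c n m k t p).CostLe
      (3104 * (c * work n m k) + 3151 * (c * (k * Nat.clog 2 n * (n * (Nat.clog 2 m + 1))))) := by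
  refine (algorithm1_costLe t p (by omega) hmn c k).mono ?_
  rw [work]
  obtain ⟨l, hl⟩ : ∃ l, Nat.clog 2 m + 1 = l := ⟨_, rfl⟩
  have hl1 : 1 ≤ l := by omega
  rw [hl]
  have hnl : 1 ≤ n * l := Nat.mul_pos (by omega) hl1
  have hW : n * l ≤ c * ((k + Nat.clog 2 n) * (n * l ^ 2)) := by
    calc n * l = 1 * (1 * (n * (l * 1))) := by ring
      _ ≤ c * ((k + Nat.clog 2 n) * (n * (l * l))) := by gcongr; omega
      _ = _ := by ring
  calc _ ≤ 3104 * (c * ((k + Nat.clog 2 n) * (n * l ^ 2))) +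
        c * k * Nat.clog 2 n * (3151 * (n * l)) := by gcongr; omega
    _ = _ := by ring

/-- The dominant terms of the running time of a round, for either choice of the first step. -/
def roundWork (a : FirstStep) (n m k : ℕ) : ℕ :=
  match a with
  | .alg1 => work n m k + k * Nat.clog 2 n * (n * (Nat.clog 2 m + 1))
  | .alg2 => work n m k

theorem firstStep_costLe (a : FirstStep) (hm : 2 ≤ m) (hmn : m ≤ n) {c k : ℕ} (hc : 1 ≤ c)
    (hk : 1 ≤ k) (hkm : k ≤ m) :
    (firstStep a c n m k t p).CostLe (8000 * (c * roundWork a n m k)) := by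
  cases a
  · refine (algorithm1_costLe_work t p hm hmn hc hk).mono ?_
    simp only [roundWork, mul_add]
    omega
  · exact algorithm2_costLe t p hm hmn hc hk hkm

theorem work_le_roundWork (a : FirstStep) (n m k : ℕ) : work n m k ≤ roundWork a n m k := by
  cases a
  · exact Nat.le_add_right _ _
  · exact le_rfl

theorem rounds_costLe (a : FirstStep) (hm : 2 ≤ m) (hmn : m ≤ n) {c k : ℕ} (hc : 1 ≤ c)
    (hk : 1 ≤ k) (hkm : k ≤ m) (N : ℕ) :
    (rounds a c n m k t p N).CostLe (N * (12000 * (c * roundWork a n m k))) := by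
  have hn : n ≤ c * roundWork a n m k := by
    refine le_trans ?_ (Nat.mul_le_mul_left c (work_le_roundWork a n m k))
    calc n = 1 * (1 * (n * 1 ^ 2)) := by ring
      _ ≤ c * work n m k := by unfold work; gcongr <;> omega
  induction N with
  | zero => simpa [rounds] using Rand.costLe_pure (none : Option Output)
  | succ N ih =>
    refine Rand.CostLe.mono (b := 8000 * (c * roundWork a n m k) + (3152 * (c * work n m k) +
      (4 * (n - m + 1) + 1 + (4 * (n - m + 1) + N * (12000 * (c * roundWork a n m k))))))
      ((firstStep_costLe t p a hm hmn hc hk hkm).bind fun st =>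
        (phases_costLe_work t p hm hmn hc hk st).bind fun st =>
          (Rand.costLe_lift le_rfl).bind fun st => ?_) ?_
    · split_ifs
      · exact Rand.costLe_lift (Nat.le_add_right _ _)
      · exact ih.mono (Nat.le_add_left _ _)
    · have h1 : c * work n m k ≤ c * roundWork a n m k :=
        Nat.mul_le_mul_left c (work_le_roundWork a n m k)
      rw [add_mul, one_mul]
      omega

theorem algorithm3_costLe (a : FirstStep) (T : Fin n → ℕ) (P : Fin m → ℕ) (hm : 2 ≤ m)
    (hmn : m ≤ n) {c k : ℕ} (hc : 1 ≤ c) (hk : 1 ≤ k) (hkm : k ≤ m) (N : ℕ) :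
    (algorithm3 a c k T P N).CostLe (14 * n + N * (12000 * (c * roundWork a n m k))) := by
  have h1 : (encodeText T P).steps ≤ 4 * m + n * 5 := by
    simp only [encodeText, Timed.steps_bind, steps_tab_charge, steps_charge]
    exact le_rfl
  have h2 : (encodePattern P).steps ≤ m * 5 := by
    simp only [encodePattern, steps_tab_charge]
    exact le_rfl
  refine ((Rand.costLe_lift h1).bind fun t => (Rand.costLe_lift h2).bind fun p =>
    rounds_costLe t p a hm hmn hc hk hkm N).mono ?_
  omega

end Cost

theorem clog_add_one_le {x : ℕ} (hx : 4 ≤ x) : (Nat.clog 2 x + 1 : ℝ) ≤ 3 * Real.log x := by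
  have h1 : 2 ^ (Nat.clog 2 x).pred < x := Nat.pow_pred_clog_lt_self (by norm_num) (by omega)
  obtain ⟨e, he⟩ : ∃ e, Nat.clog 2 x = e + 1 :=
    ⟨_, (Nat.succ_pred_eq_of_pos (Nat.clog_pos (by norm_num) (by omega))).symm⟩
  rw [he, Nat.pred_succ] at h1
  have h2 : (e : ℝ) * Real.log 2 ≤ Real.log x := by
    rw [← Real.log_pow]
    exact Real.log_le_log (by positivity) (by exact_mod_cast h1.le)
  have h3 : 2 * Real.log 2 ≤ Real.log x := by
    have : (2 : ℝ) * Real.log 2 = Real.log ((2 : ℝ) ^ 2) := by rw [Real.log_pow]; norm_num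
    rw [this]
    exact Real.log_le_log (by positivity) (by norm_num; exact_mod_cast hx)
  have h4 := Real.log_two_gt_d9
  have he0 : (0 : ℝ) ≤ e := Nat.cast_nonneg e
  rw [he]
  push_cast
  nlinarith

theorem one_le_log {x : ℕ} (hx : 4 ≤ x) : 1 ≤ Real.log x := by
  have h3 : 2 * Real.log 2 ≤ Real.log x := by
    have : (2 : ℝ) * Real.log 2 = Real.log ((2 : ℝ) ^ 2) := by rw [Real.log_pow]; norm_num
    rw [this]
    exact Real.log_le_log (by positivity) (by norm_num; exact_mod_cast hx)
  linarith [Real.log_two_gt_d9]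

theorem work_le {n m k : ℕ} (hm : 4 ≤ m) (hmn : m ≤ n) :
    (work n m k : ℝ) ≤ 27 * (n * k * Real.log m ^ 2 + n * Real.log m ^ 2 * Real.log n) := by
  have h1 := clog_add_one_le hm
  have h2 := clog_add_one_le (hm.trans hmn)
  have h3 : (0 : ℝ) ≤ Nat.clog 2 m + 1 := by positivity
  have hn := one_le_log (hm.trans hmn)
  unfold work
  push_cast
  calc ((k : ℝ) + Nat.clog 2 n) * (n * (Nat.clog 2 m + 1) ^ 2)
      ≤ (3 * (k + Real.log n)) * (n * (3 * Real.log m) ^ 2) := by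
        have : (k : ℝ) ≤ 3 * k := by linarith [Nat.cast_nonneg (α := ℝ) k]
        gcongr; linarith
    _ = _ := by ring

theorem roundWork_alg2_le {n m k : ℕ} (hm : 4 ≤ m) (hmn : m ≤ n) :
    (roundWork .alg2 n m k : ℝ) ≤ 36 * bound2 n m k := by
  have h1 := work_le (k := k) hm hmn
  have hlm := one_le_log hm
  have hln := one_le_log (hm.trans hmn)
  have hlln := Real.log_nonneg hln
  have h2 : 0 ≤ n * Real.log m * Real.log n * Real.log (Real.log n) := by positivity
  have h3 : 0 ≤ n * k * Real.log m ^ 2 + n * Real.log m ^ 2 * Real.log n := by positivity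
  simp only [roundWork, bound2]
  linarith

theorem roundWork_alg1_le {n m k : ℕ} (hm : 4 ≤ m) (hmn : m ≤ n) :
    (roundWork .alg1 n m k : ℝ) ≤ 36 * bound1 n m k := by
  have h1 := work_le (k := k) hm hmn
  have hlm := one_le_log hm
  have hln := one_le_log (hm.trans hmn)
  have h2 := clog_add_one_le hm
  have h3 := clog_add_one_le (hm.trans hmn)
  have h4 : ((k * Nat.clog 2 n * (n * (Nat.clog 2 m + 1)) : ℕ) : ℝ) ≤
      9 * (n * k * Real.log m * Real.log n) := by
    push_cast
    calc (k : ℝ) * Nat.clog 2 n * (n * (Nat.clog 2 m + 1))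
        ≤ k * (3 * Real.log n) * (n * (3 * Real.log m)) := by gcongr; linarith
      _ = _ := by ring
  have h5 : 0 ≤ n * k * Real.log m ^ 2 + n * Real.log m ^ 2 * Real.log n := by positivity
  have h6 : 0 ≤ n * k * Real.log m * Real.log n := by positivity
  simp only [roundWork, bound1]
  push_cast at h4 ⊢
  linarith

theorem le_bound2 {n m k : ℕ} (hk : 1 ≤ k) (hm : 4 ≤ m) (hmn : m ≤ n) : (n : ℝ) ≤ bound2 n m k := by
  have hlm := one_le_log hm
  have hln := one_le_log (hm.trans hmn)
  have hlln := Real.log_nonneg hln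
  have hk' : (1 : ℝ) ≤ k := by exact_mod_cast hk
  have h1 : (n : ℝ) * 1 * 1 ^ 2 ≤ n * k * Real.log m ^ 2 := by gcongr
  have h2 : 0 ≤ n * Real.log m * Real.log n * Real.log (Real.log n) := by positivity
  have h3 : 0 ≤ n * Real.log m ^ 2 * Real.log n := by positivity
  unfold bound2
  linarith

theorem le_bound1 {n m k : ℕ} (hk : 1 ≤ k) (hm : 4 ≤ m) (hmn : m ≤ n) : (n : ℝ) ≤ bound1 n m k := by
  have hlm := one_le_log hm
  have hln := one_le_log (hm.trans hmn)
  have hk' : (1 : ℝ) ≤ k := by exact_mod_cast hk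
  have h1 : (n : ℝ) * 1 * 1 ^ 2 ≤ n * k * Real.log m ^ 2 := by gcongr
  have h2 : 0 ≤ n * k * Real.log m * Real.log n := by positivity
  have h3 : 0 ≤ n * Real.log m ^ 2 * Real.log n := by positivity
  unfold bound1
  linarith

/-! ### The probability that a round fails -/

section Failure

variable {n m : ℕ}

theorem tiny_le (hn : 1 ≤ n) : tiny n ≤ ENNReal.ofReal ((n : ℝ)⁻¹ ^ 4) := by
  refine ENNReal.ofReal_le_ofReal ?_
  have h1 : (n : ℝ) ≤ Real.exp (Nat.clog 2 n) := by
    calc (n : ℝ) ≤ 2 ^ Nat.clog 2 n := by exact_mod_cast Nat.le_pow_clog (by norm_num) n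
      _ ≤ Real.exp 1 ^ Nat.clog 2 n := by
          gcongr; linarith [Real.add_one_le_exp (1 : ℝ)]
      _ = Real.exp (Nat.clog 2 n) := by rw [← Real.exp_nat_mul, mul_one]
  have hn' : (0 : ℝ) < n := by exact_mod_cast hn
  calc Real.exp (-(4 * Nat.clog 2 n : ℕ)) = (Real.exp (Nat.clog 2 n))⁻¹ ^ 4 := by
        rw [← Real.exp_neg, ← Real.exp_nat_mul]; push_cast; ring_nf
    _ ≤ (n : ℝ)⁻¹ ^ 4 := by gcongr

/-- An alignment with fewer than `2 k` mismatches is settled by the first step of a round, the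
others are settled by the phases. -/
theorem round_fail_at (a : FirstStep) {t p : ℕ → ℤ} (hm : 1 ≤ m) (hmn : m ≤ n)
    (ht : ∀ i, 0 ≤ t i) (hp : ∀ j, 0 ≤ p j) (ht' : ∀ i, t i ≤ m + 1) (hp' : ∀ j, p j ≤ m + 1)
    {c k i : ℕ} (hc : 8 ≤ c * rate) (hk : 1 ≤ k) (hkm : 4 * k ≤ m) (hi : i < n - m + 1) :
    (firstStep a c n m k t p >>= phases c n m k t p).fail (fun st => Done m k t p i (st i)) ≤
      n * tiny n := by
  have hfirst := firstStep_holds hm hmn a c k t p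
  rcases le_or_gt (2 * k) (errPositions m t p i).card with hq | hq
  · rw [Rand.fail_bind]
    refine (Rand.ev_mono_of_holds (g := fun _ => tiny n) hfirst fun st hst =>
      phases_fail hm hmn hc hk hkm hi hq hst).trans ?_
    rw [Rand.ev_const]
    exact le_mul_of_one_le_left zero_le (by exact_mod_cast hm.trans hmn)
  · have h1 : (firstStep a c n m k t p).fail (fun st => Done m k t p i (st i)) ≤ n * tiny n := by
      cases a
      · exact algorithm1_fail hm hmn hc hk hkm hi (by omega)
      · exact algorithm2_fail hm hmn ht hp ht' hp' hc hk hkm hi (by omega)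
    have := Rand.fail_bind_le (g := phases c n m k t p) (ε' := 0)
      (Q' := fun st => Done m k t p i (st i)) hfirst h1 fun st _ hd =>
        (Rand.fail_eq_zero ((phases_holds c n m k t p st).mono fun _ h => hd.ext (h i hi))).le
    simpa only [add_zero] using this

theorem round_fail (a : FirstStep) {t p : ℕ → ℤ} (hm : 1 ≤ m) (hmn : m ≤ n)
    (ht : ∀ i, 0 ≤ t i) (hp : ∀ j, 0 ≤ p j) (ht' : ∀ i, t i ≤ m + 1) (hp' : ∀ j, p j ≤ m + 1)
    {c k : ℕ} (hc : 8 ≤ c * rate) (hk : 1 ≤ k) (hkm : 4 * k ≤ m) :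
    (firstStep a c n m k t p >>= phases c n m k t p).fail
      (fun st => ∀ i < n - m + 1, (st i).Settled k) ≤ ENNReal.ofReal (n : ℝ)⁻¹ := by
  have hn : 1 ≤ n := hm.trans hmn
  have hn' : (1 : ℝ) ≤ n := by exact_mod_cast hn
  have hvalid : (firstStep a c n m k t p >>= phases c n m k t p).Holds (AllValid n m t p) :=
    (firstStep_holds hm hmn a c k t p).bind fun st hst =>
      (phases_holds c n m k t p st).mono fun _ h => h.valid hst
  refine (Rand.fail_mono_of_holds hvalid (Q := fun st => ∀ i ∈ range (n - m + 1),
    Done m k t p i (st i)) fun st hst h i hi =>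
      ((hst i hi).settled_iff ht hp).2 (h i (mem_range.2 hi))).trans ?_
  refine (Rand.fail_forall_le _ _ _).trans ?_
  refine (sum_le_card_nsmul _ _ _ fun i hi => round_fail_at a hm hmn ht hp ht' hp' hc hk hkm
    (mem_range.1 hi)).trans ?_
  rw [card_range, nsmul_eq_mul]
  calc ((n - m + 1 : ℕ) : ℝ≥0∞) * (n * tiny n)
      ≤ n * (n * ENNReal.ofReal ((n : ℝ)⁻¹ ^ 4)) := by
        gcongr
        · omega
        · exact tiny_le hn
    _ = ENNReal.ofReal (n * (n * (n : ℝ)⁻¹ ^ 4)) := by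
        rw [ENNReal.ofReal_mul (by positivity), ENNReal.ofReal_mul (by positivity),
          ENNReal.ofReal_natCast]
    _ ≤ ENNReal.ofReal (n : ℝ)⁻¹ := by
        refine ENNReal.ofReal_le_ofReal ?_
        have : n * (n * (n : ℝ)⁻¹ ^ 4) = (n : ℝ)⁻¹ ^ 2 := by field_simp
        rw [this, sq]
        exact mul_le_of_le_one_left (by positivity) (inv_le_one_of_one_le₀ hn')

/-- Rounds are independent, so that `N` of them fail with probability at most `n ^ (-N)`. -/
theorem rounds_fail (a : FirstStep) {t p : ℕ → ℤ} (hm : 1 ≤ m) (hmn : m ≤ n)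
    (ht : ∀ i, 0 ≤ t i) (hp : ∀ j, 0 ≤ p j) (ht' : ∀ i, t i ≤ m + 1) (hp' : ∀ j, p j ≤ m + 1)
    {c k : ℕ} (hc : 8 ≤ c * rate) (hk : 1 ≤ k) (hkm : 4 * k ≤ m) (N : ℕ) :
    (rounds a c n m k t p N).fail (fun o => o.isSome) ≤ ENNReal.ofReal (n : ℝ)⁻¹ ^ N := by
  classical
  induction N with
  | zero => simpa using Rand.fail_le_one _ _
  | succ N ih =>
    have hround := round_fail a hm hmn ht hp ht' hp' hc hk hkm
    have hle : (rounds a c n m k t p (N + 1)).fail (fun o => o.isSome) ≤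
        ENNReal.ofReal (n : ℝ)⁻¹ ^ N *
          (firstStep a c n m k t p >>= phases c n m k t p).fail
            (fun st => ∀ i < n - m + 1, (st i).Settled k) := by
      simp only [rounds, Rand.fail_bind, Rand.ev_lift, ← Rand.ev_const_mul]
      refine Rand.ev_mono fun st => ?_
      unfold Rand.fail
      rw [← Rand.ev_const_mul]
      refine Rand.ev_mono fun st => ?_
      by_cases h : ∀ i < n - m + 1, ((charge (4 * (n - m + 1) + 1) st).val i).Settled k
      · rw [if_pos h, Rand.ev_lift]
        simp
      · rw [if_neg h, if_neg (show ¬ ∀ i < n - m + 1, (st i).Settled k from h), mul_one]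
        exact ih
    rw [pow_succ]
    exact hle.trans (by gcongr)

theorem algorithm3_fail (a : FirstStep) (T : Fin n → ℕ) (P : Fin m → ℕ) (hm : 1 ≤ m)
    (hmn : m ≤ n) {c k : ℕ} (hc : 8 ≤ c * rate) (hk : 1 ≤ k) (hkm : 4 * k ≤ m) (N : ℕ) :
    (algorithm3 a c k T P N).fail (fun o => o.isSome) ≤ ENNReal.ofReal (n : ℝ)⁻¹ ^ N := by
  simp only [algorithm3, Rand.fail_bind, Rand.ev_lift]
  exact rounds_fail a hm hmn (encodeText_nonneg T P) (encodePattern_nonneg P) (encodeText_le T P)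
    (encodePattern_le P) hc hk hkm N

end Failure

/-- A run of `N` rounds bounds the halting probability of the algorithm without a cut-off. -/
theorem one_sub_le_haltProb {α : Type} {A : ℕ → Rand (Option α)} {N B : ℕ} {b : ℝ} {δ : ℝ≥0∞}
    (hcost : (A N).CostLe B) (hB : (B : ℝ) ≤ b) (hfail : (A N).fail (fun o => o.isSome) ≤ δ) :
    1 - δ ≤ haltProb A b := by
  classical
  refine le_trans ?_ (le_iSup _ N)
  rw [tsub_le_iff_right]
  refine le_trans ?_ (add_le_add le_rfl hfail)
  have h1 : PMF.toOuterMeasure (A N) {x : Timed (Option α) | x.val.isSome ∧ (x.steps : ℝ) ≤ b} =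
      ∑' y, {x : Timed (Option α) | x.val.isSome ∧ (x.steps : ℝ) ≤ b}.indicator (A N).law y :=
    PMF.toOuterMeasure_apply _ _
  rw [h1, Rand.fail, Rand.ev, ← ENNReal.tsum_add]
  refine (PMF.tsum_coe (A N).law).symm.le.trans ?_
  refine ENNReal.tsum_le_tsum fun y => ?_
  by_cases hy : y ∈ (A N).outcomes
  · have hsteps : (y.steps : ℝ) ≤ b := (Nat.cast_le.2 (hcost y hy)).trans hB
    by_cases hs : y.val.isSome
    · have hmem : y ∈ {x : Timed (Option α) | x.val.isSome ∧ (x.steps : ℝ) ≤ b} := ⟨hs, hsteps⟩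
      rw [Set.indicator_of_mem hmem]
      exact le_self_add
    · simp [hs]
  · have : (A N).law y = 0 := (PMF.apply_eq_zero_iff _ _).2 hy
    rw [this]
    exact zero_le

theorem le_haltProb_algorithm3 (a : FirstStep) {n m : ℕ} (T : Fin n → ℕ) (P : Fin m → ℕ)
    {c k : ℕ} (hc : 8 ≤ c * rate) (hk : 1 ≤ k) (hkm : 4 * k ≤ m) (hmn : m ≤ n) {α b : ℝ}
    (hα : 1 ≤ α) (hnb : (n : ℝ) ≤ b) (hwork : (roundWork a n m k : ℝ) ≤ 36 * b) :
    ENNReal.ofReal (1 - (n : ℝ) ^ (-α)) ≤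
      haltProb (algorithm3 a c k T P) ((14 + 24000 * 36 * c) * α * b) := by
  have hn1 : (1 : ℝ) ≤ n := by exact_mod_cast (by omega : 1 ≤ n)
  have hc1 : 1 ≤ c := by
    by_contra h0
    obtain rfl : c = 0 := by omega
    norm_num at hc
  set N := ⌈α⌉₊ with hN
  have hαN : α ≤ N := Nat.le_ceil α
  have hNα : (N : ℝ) ≤ 2 * α := by linarith [Nat.ceil_lt_add_one (by linarith : 0 ≤ α)]
  have hcost := algorithm3_costLe a T P (by omega) hmn hc1 hk (by omega : k ≤ m) N
  refine le_trans ?_ (one_sub_le_haltProb hcost ?_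
    (algorithm3_fail a T P (by omega) hmn hc hk hkm N))
  · rw [ENNReal.ofReal_sub _ (by positivity), ENNReal.ofReal_one, ← ENNReal.ofReal_pow
      (by positivity)]
    refine tsub_le_tsub_left (ENNReal.ofReal_le_ofReal ?_) 1
    rw [inv_pow, ← Real.rpow_natCast, ← Real.rpow_neg (by positivity)]
    exact Real.rpow_le_rpow_of_exponent_le hn1 (by linarith)
  · have hb : 0 ≤ b := by linarith
    push_cast
    calc 14 * (n : ℝ) + N * (12000 * (c * roundWork a n m k))
        ≤ 14 * (α * b) + (2 * α) * (12000 * (c * (36 * b))) := by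
          gcongr
          nlinarith
      _ = _ := by ring

end KMismatch

end

theorem mainTheorem2 :
    (∀ (a : KMismatch.FirstStep) (c k n m : ℕ) (T : Fin n → ℕ) (P : Fin m → ℕ),
      1 ≤ m → m ≤ n →
      ∀ N, ∀ x ∈ (KMismatch.algorithm3 a c k T P N).outcomes,
        ∀ out, x.val = some out → out.Correct k T P) ∧
    ∃ c₀ : ℕ, ∀ c : ℕ, c₀ ≤ c → ∃ (C : ℝ) (n₀ : ℕ), ∀ α : ℝ, 1 ≤ α →
      ∀ (n m k : ℕ) (T : Fin n → ℕ) (P : Fin m → ℕ),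
        n₀ ≤ n → m ≤ n → 1 ≤ k → 4 * k ≤ m →
        ENNReal.ofReal (1 - (n : ℝ) ^ (-α)) ≤
            KMismatch.haltProb (KMismatch.algorithm3 .alg2 c k T P)
              (C * α * KMismatch.bound2 n m k) ∧
        ENNReal.ofReal (1 - (n : ℝ) ^ (-α)) ≤
            KMismatch.haltProb (KMismatch.algorithm3 .alg1 c k T P)
              (C * α * KMismatch.bound1 n m k) := by
  refine ⟨fun a c k n m T P hm hmn N => KMismatch.algorithm3_correct hm hmn a c k T P N,
    ⌈8 / KMismatch.rate⌉₊, fun c hc => ⟨14 + 24000 * 36 * c, 0, ?_⟩⟩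
  intro α hα n m k T P _ hmn hk hkm
  have hc' : 8 ≤ c * KMismatch.rate := (div_le_iff₀ KMismatch.rate_pos).1 (Nat.ceil_le.1 hc)
  exact ⟨KMismatch.le_haltProb_algorithm3 .alg2 T P hc' hk hkm hmn hα
      (KMismatch.le_bound2 hk (by omega) hmn) (KMismatch.roundWork_alg2_le (by omega) hmn),
    KMismatch.le_haltProb_algorithm3 .alg1 T P hc' hk hkm hmn hα
      (KMismatch.le_bound1 hk (by omega) hmn) (KMismatch.roundWork_alg1_le (by omega) hmn)⟩
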